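/- Let $X$ be a complex Banach space, $T>0$, and let $C([0,T];X)$ carry the supremum norm. Let $B$ be the operator in $C([0,T];X)$ with domain $D(B)=\{u\in C^1([0,T];X): u(0)=0\}$ and $Bu=u'$. Throughout, $\operatorname{Arg}$ and complex powers are principal, and $0$ belongs to no sector $\{|\operatorname{Arg}(\lambda)|>\omega\}$, $\omega > 0$. Fix $a>0$ and $\theta_0\in(\frac{\pi}{2},\pi)$. For $\alpha>0$ set $$B^{-\alpha}:=-\frac{1}{2\pi i}\int_{\Gamma}\mu^{-\alpha}(\mu-B)^{-1}\,d\mu,\qquad \Gamma=\{\mu\in\mathbb C:|\operatorname{Arg}(\mu-a)|=\theta_0\},$$ with $\Gamma$ (including its vertex $a$) oriented from $\infty e^{-i\theta_0}$ to $\infty e^{i\theta_0}$. This bounded operator is injective, and $B^{\alpha}:=(B^{-\alpha})^{-1}$, with domain the range of $B^{-\alpha}$. For $\theta\in(0,\pi)$ and $r>0$ let $\Gamma(\theta,r)$ be the contour formed by the half-lines $\{\rho e^{\pm i\theta}:\rho\ge r\}$ and the arc $\{re^{i\varphi}:|\varphi|\le\theta\}$, oriented from $\infty e^{-i\theta}$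 to $\infty e^{i\theta}$. A linear operator $A:D(A)\subseteq Y\to Y$ in a complex Banach space $Y$ is said to be of type $\omega\in(0,\pi)$ if $\{\lambda\in\mathbb C:|\operatorname{Arg}(\lambda)|>\omega\}\subseteq\rho(A)$ and, for every $\epsilon>0$, there is $M(\epsilon)>0$ such that $\|\lambda(\lambda-A)^{-1}\|_{\mathcal L(Y)}\le M(\epsilon)$ whenever $|\operatorname{Arg}(\lambda)|\ge\omega+\epsilon$. Let $\alpha\in(0,2)$. Then: (I) Let $\lambda\in\mathbb C$, $\theta\in(\frac{\pi}{2},\pi)$ with $\alpha\theta<\pi$, and $r>0$ with $r^\alpha>|\lambda|$. Then $\lambda\in\rho(B^\alpha)$ and $$(\lambda-B^\alpha)^{-1}=-\frac{1}{2\pi i}\int_{\Gamma(\theta,r)}(\lambda-\mu^\alpha)^{-1}(\mu-B)^{-1}\,d\mu ,$$ the integral converging absolutely in operator norm; moreover, for every $f\in C([0,T];X)$ and $t\in[0,T]$, $$[(\lambda-B^\alpha)^{-1}f](t)=\frac{1}{2\pi i}\int_0^t\Big(\int_{\Gamma(\theta,r)}\frac{e^{\mu(t-s)}}{\lambda-\mu^\alpha}\,d\mu\Big)f(s)\,ds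 ,$$ where the inner integral converges absolutely for $0\le s<t$ and the outer integrand is integrable on $(0,t)$. (II) $B^\alpha$ is of type $\frac{\alpha\pi}{2}$. -/

import Mathlib

open MeasureTheory Set

namespace FracDeriv

/-! ### Resolvents of (possibly unbounded) linear operators and operators of type `ω` -/

section Operators

variable {Y : Type*} [NormedAddCommGroup Y] [NormedSpace ℂ Y]

/-- `R` is a bounded, everywhere defined two-sided inverse of `z - A : D(A) → Y`. -/
def IsResolventAt (A : Y →ₗ.[ℂ] Y) (z : ℂ) (R : Y →L[ℂ] Y) : Prop :=
  (∀ f : Y, ∃ u : A.domain, (u : Y) = R f ∧ z • (u : Y) - A u = f) ∧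
    ∀ u : A.domain, R (z • (u : Y) - A u) = u

/-- The resolvent set `ρ(A)`. -/
def resolvSet (A : Y →ₗ.[ℂ] Y) : Set ℂ :=
  {z | ∃ R : Y →L[ℂ] Y, IsResolventAt A z R}

theorem IsResolventAt.unique {A : Y →ₗ.[ℂ] Y} {z : ℂ} {R S : Y →L[ℂ] Y}
    (hR : IsResolventAt A z R) (hS : IsResolventAt A z S) : R = S := by
  ext f
  obtain ⟨u, hu, hf⟩ := hR.1 f
  have h := hS.2 u
  rw [hf] at h
  rw [h, hu]

open Classical in
/-- The resolvent operator `(z - A)⁻¹`, for `z ∈ ρ(A)` (and `0` for other `z`). -/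
noncomputable def resolv (A : Y →ₗ.[ℂ] Y) (z : ℂ) : Y →L[ℂ] Y :=
  if h : ∃ R : Y →L[ℂ] Y, IsResolventAt A z R then h.choose else 0

theorem IsResolventAt.resolv_eq {A : Y →ₗ.[ℂ] Y} {z : ℂ} {R : Y →L[ℂ] Y}
    (hR : IsResolventAt A z R) : resolv A z = R := by
  have h : ∃ R : Y →L[ℂ] Y, IsResolventAt A z R := ⟨R, hR⟩
  rw [resolv, dif_pos h]
  exact h.choose_spec.unique hR

/-- `A` is of type `ω`. As `Complex.arg 0 = 0`, the point `0` lies in none of the sectors. -/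
def IsOfType (A : Y →ₗ.[ℂ] Y) (ω : ℝ) : Prop :=
  0 < ω ∧ ω < Real.pi ∧
    (∀ z : ℂ, ω < |z.arg| → z ∈ resolvSet A) ∧
    ∀ ε : ℝ, 0 < ε → ∃ M : ℝ, 0 < M ∧
      ∀ z : ℂ, ω + ε ≤ |z.arg| → ‖z • resolv A z‖ ≤ M

end Operators

/-! ### Contour integrals -/

section Contours

variable {E : Type*} [NormedAddCommGroup E] [NormedSpace ℂ E]

/-- The unit vector `e^{iθ}`. -/
noncomputable def dir (θ : ℝ) : ℂ := Complex.exp (θ * Complex.I)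

/-- Integral of `F` over the two half-lines `{c + ρ e^{±iθ} : ρ > r}`, the lower one run from
infinity to its end point and the upper one from its end point to infinity. -/
noncomputable def raysIntegral (c : ℂ) (θ r : ℝ) (F : ℂ → E) : E :=
  -(∫ ρ in Ioi r, dir (-θ) • F (c + ρ * dir (-θ))) +
    ∫ ρ in Ioi r, dir θ • F (c + ρ * dir θ)

/-- Integral of `F` over the contour `Γ(θ, r)` formed by the half-lines `{ρ e^{±iθ} : ρ ≥ r}` and
the arc `{r e^{iφ} : |φ| ≤ θ}`, oriented from `∞ e^{-iθ}` to `∞ e^{iθ}`. -/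
noncomputable def keyholeIntegral (θ r : ℝ) (F : ℂ → E) : E :=
  raysIntegral 0 θ r F + ∫ φ in (-θ)..θ, (Complex.I * (r * dir φ)) • F (r * dir φ)

/-- Absolute convergence of the integral of `F` over `Γ(θ, r)`. -/
def KeyholeIntegrable (θ r : ℝ) (F : ℂ → E) : Prop :=
  IntegrableOn (fun ρ : ℝ => F (ρ * dir (-θ))) (Ioi r) ∧
    IntegrableOn (fun ρ : ℝ => F (ρ * dir θ)) (Ioi r) ∧
    IntervalIntegrable (fun φ : ℝ => F (r * dir φ)) volume (-θ) θ

end Contours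

/-! ### The derivative with zero initial value on `C([0, T]; X)` and its powers -/

section Derivative

variable (X : Type*) [NormedAddCommGroup X] [NormedSpace ℂ X] {T : ℝ} (hT : 0 < T)

/-- The operator `B` in `C([0, T]; X)`: `D(B) = {u ∈ C¹([0, T]; X) : u(0) = 0}`, `B u = u'`
(with one-sided derivatives at the end points). -/
noncomputable def opB : C(Icc (0 : ℝ) T, X) →ₗ.[ℂ] C(Icc (0 : ℝ) T, X) where
  domain :=
    { carrier := {u | ContDiffOn ℝ 1 (IccExtend hT.le u) (Icc 0 T) ∧
        u ⟨0, left_mem_Icc.2 hT.le⟩ = 0}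
      add_mem' := by
        rintro u v ⟨hu, hu0⟩ ⟨hv, hv0⟩
        exact ⟨hu.add hv, by simp [hu0, hv0]⟩
      zero_mem' := ⟨contDiffOn_const (c := (0 : X)), rfl⟩
      smul_mem' := by
        rintro c u ⟨hu, hu0⟩
        exact ⟨hu.const_smul c, by simp [hu0]⟩ }
  toFun :=
    { toFun := fun u =>
        ⟨fun t => derivWithin (IccExtend hT.le (u : C(Icc (0 : ℝ) T, X))) (Icc 0 T) t,
          (u.2.1.continuousOn_derivWithin (uniqueDiffOn_Icc hT) le_rfl).comp_continuous
            continuous_subtype_val fun t => t.2⟩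
      map_add' := by
        intro u v
        ext t
        exact derivWithin_add (u.2.1.differentiableOn one_ne_zero t t.2)
          (v.2.1.differentiableOn one_ne_zero t t.2)
      map_smul' := by
        intro c u
        ext t
        exact derivWithin_const_smul c (u.2.1.differentiableOn one_ne_zero t t.2) }

/-- The bounded operator `B^{-α} = -(2πi)⁻¹ ∫_Γ μ^{-α} (μ - B)⁻¹ dμ`, where
`Γ = {μ : |Arg (μ - a)| = θ}` is oriented from `∞ e^{-iθ}` to `∞ e^{iθ}`
(for `α > 0`, `a > 0`, `π / 2 < θ < π`). The integral is taken in operator norm. -/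
noncomputable def negPowB (a θ α : ℝ) : C(Icc (0 : ℝ) T, X) →L[ℂ] C(Icc (0 : ℝ) T, X) :=
  -((2 * Real.pi * Complex.I : ℂ)⁻¹ •
    raysIntegral (a : ℂ) θ 0 fun μ => μ ^ (-α : ℂ) • resolv (opB X hT) μ)

/-- The operator `B^α = (B^{-α})⁻¹`, with domain the range of `B^{-α}`. -/
noncomputable def powB (a θ α : ℝ) : C(Icc (0 : ℝ) T, X) →ₗ.[ℂ] C(Icc (0 : ℝ) T, X) :=
  LinearPMap.inverse
    ((negPowB X hT a θ α : C(Icc (0 : ℝ) T, X) →ₗ[ℂ] C(Icc (0 : ℝ) T, X)).toPMap ⊤)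

end Derivative

/-- The function `τ ↦ ∫_{Γ(θ, r)} e^{μ τ} / (z - μ^α) dμ`. -/
noncomputable def resolvKernel (α : ℝ) (z : ℂ) (θ r τ : ℝ) : ℂ :=
  keyholeIntegral θ r fun μ => Complex.exp (μ * τ) / (z - μ ^ (α : ℂ))

end FracDeriv

/-! Everything reduces to scalar convolution kernels. For every complex `μ` the resolvent of `B` is
minus the convolution with `e^{μ τ}` (`isResolventAt_resB`). By Fubini, the contour integral of
`ψ(μ) (μ - B)⁻¹` is therefore minus the convolution with the contour integral of `e^{μ τ} ψ(μ)`
(`keyAt_smul_resB_apply`). For `ψ(μ) = μ^{-β}` Hankel's formula (`keyAt_exp_mul_cpow`) evaluates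
that kernel on every contour used here as a multiple of `τ^{β-1} / Γ(β)`. So `J = B^{-α}` is the
fractional integral of order `α`. Euler's Beta integral gives the semigroup law for these integrals
(`IsFracInt.mul`); composing orders `α` and `2 - α` gives `B⁻²`, so `J` is injective.

For (I), `|μ|^α ≥ r^α > |λ|` on the contour, so `(λ - μ^α)⁻¹` expands in a geometric series there.
Integrated termwise, the candidate `R` for the resolvent is `-∑ λ^n J^{n+1}`. Hence `J R = R J` and
`λ J R = J + R`, which says that `R` is the resolvent of `J⁻¹` at `λ` (`isResolventAt_powB`). Part
(I) also puts every `λ` in the resolvent set.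

For (II), let `|Arg z| ≥ απ/2 + ε`, and take the contour angle slightly above `π/2`. Then `|z - μ^α|
≥ c (|z| + |μ|^α)` on the whole sector, so the contour can be collapsed to two half-lines from `0`.
This bounds the kernel of `z (z - B^α)⁻¹` by constants times `|z|^{1/2} τ^{α/2-1}` and `|z|⁻¹
τ^{-α-1}` (`norm_mul_resolvKernel_le`). Splitting at `τ = |z|^{-1/α}` gives an `L¹` bound
independent of `z`, hence a bound on the operator norm.

Contours are deformed without Cauchy's theorem: they are rescaled by `s > 0`, and the derivative in
`s` of the integral is the contour integral of an exact derivative, hence zero (`keyAt_scale_eq`).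
-/

namespace FracDeriv

set_option maxSynthPendingDepth 3

open Filter Topology Real

/-! ### The resolvent of `B` by variation of constants. -/

section ResolventOfDerivative

variable {X : Type*} [NormedAddCommGroup X] {T : ℝ} (hT : 0 < T)

theorem continuous_extend (f : C(Icc (0 : ℝ) T, X)) : Continuous (IccExtend hT.le f) :=
  f.continuous.Icc_extend'

theorem norm_extend_le (f : C(Icc (0 : ℝ) T, X)) (s : ℝ) : ‖IccExtend hT.le f s‖ ≤ ‖f‖ :=
  f.norm_coe_le_norm _

theorem integral_exp_nonneg {T : ℝ} (hT : 0 < T) (x : ℝ) :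
    0 ≤ ∫ s in (0 : ℝ)..T, Real.exp (x * s) :=
  intervalIntegral.integral_nonneg hT.le fun _ _ => (Real.exp_pos _).le

variable [NormedSpace ℂ X]

/-- The solution of `u' = μ u - f`, `u(0) = 0`. -/
noncomputable def resFun (μ : ℂ) (f : C(Icc (0 : ℝ) T, X)) (t : ℝ) : X :=
  -(Complex.exp (μ * t) • ∫ s in (0 : ℝ)..t, Complex.exp (-(μ * s)) • IccExtend hT.le f s)

theorem continuous_exp_smul_extend (μ : ℂ) (f : C(Icc (0 : ℝ) T, X)) :
    Continuous fun s : ℝ => Complex.exp (μ * s) • IccExtend hT.le f s :=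
  (by fun_prop : Continuous fun s : ℝ => Complex.exp (μ * s)).smul (continuous_extend hT f)

theorem resFun_eq_conv (μ : ℂ) (f : C(Icc (0 : ℝ) T, X)) (t : ℝ) :
    resFun hT μ f t = -∫ s in (0 : ℝ)..t, Complex.exp (μ * s) • IccExtend hT.le f (t - s) := by
  have h := intervalIntegral.integral_comp_sub_left
    (a := 0) (b := t) (fun s : ℝ => Complex.exp (μ * (t - s : ℝ)) • IccExtend hT.le f s) t
  simp only [sub_self, sub_zero, sub_sub_cancel] at h
  rw [resFun, h, ← intervalIntegral.integral_smul]
  congr 1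
  refine intervalIntegral.integral_congr fun s _ => ?_
  simp only [smul_smul, ← Complex.exp_add]
  congr 2
  push_cast
  ring

theorem norm_resFun_le (μ : ℂ) (f : C(Icc (0 : ℝ) T, X)) {t : ℝ} (ht : t ∈ Icc 0 T) :
    ‖resFun hT μ f t‖ ≤ (∫ s in (0 : ℝ)..T, Real.exp (μ.re * s)) * ‖f‖ := by
  have hc : Continuous fun s : ℝ => Real.exp (μ.re * s) := by fun_prop
  rw [resFun_eq_conv, norm_neg]
  calc ‖∫ s in (0 : ℝ)..t, Complex.exp (μ * s) • IccExtend hT.le f (t - s)‖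
      ≤ ∫ s in (0 : ℝ)..t, Real.exp (μ.re * s) * ‖f‖ := by
        refine intervalIntegral.norm_integral_le_of_norm_le ht.1 ?_
          ((hc.mul continuous_const).intervalIntegrable _ _)
        refine Eventually.of_forall fun s _ => ?_
        rw [norm_smul, Complex.norm_exp]
        simp only [Complex.mul_re, Complex.ofReal_re, Complex.ofReal_im, mul_zero, sub_zero]
        gcongr
        exact norm_extend_le hT f _
    _ = (∫ s in (0 : ℝ)..t, Real.exp (μ.re * s)) * ‖f‖ := intervalIntegral.integral_mul_const _ _
    _ ≤ _ := by
        gcongr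
        refine intervalIntegral.integral_mono_interval le_rfl ht.1 ht.2 ?_
          (hc.intervalIntegrable _ _)
        exact Eventually.of_forall fun s => (Real.exp_pos _).le

variable [CompleteSpace X]

theorem hasDerivAt_resFun (μ : ℂ) (f : C(Icc (0 : ℝ) T, X)) (t : ℝ) :
    HasDerivAt (resFun hT μ f) (μ • resFun hT μ f t - IccExtend hT.le f t) t := by
  have hc := continuous_exp_smul_extend hT (-μ) f
  simp only [neg_mul] at hc
  have h1 : HasDerivAt (fun t : ℝ => ∫ s in (0 : ℝ)..t,
      Complex.exp (-(μ * s)) • IccExtend hT.le f s)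
      (Complex.exp (-(μ * t)) • IccExtend hT.le f t) t :=
    intervalIntegral.integral_hasDerivAt_right (hc.intervalIntegrable _ _)
      (hc.stronglyMeasurableAtFilter _ _) hc.continuousAt
  have h2 : HasDerivAt (fun t : ℝ => Complex.exp (μ * t)) (μ * Complex.exp (μ * t)) t := by
    have : HasDerivAt (fun z : ℂ => Complex.exp (μ * z)) (Complex.exp (μ * t) * (μ * 1)) (t : ℂ) :=
      ((hasDerivAt_id (t : ℂ)).const_mul μ).cexp
    convert! this.comp_ofReal using 1
    ring
  convert! (h2.smul h1).neg using 1
  simp only [resFun, smul_neg, smul_smul, ← Complex.exp_add, add_neg_cancel, Complex.exp_zero,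
    one_smul]
  abel

theorem continuous_resFun (μ : ℂ) (f : C(Icc (0 : ℝ) T, X)) : Continuous (resFun hT μ f) :=
  continuous_iff_continuousAt.2 fun t => (hasDerivAt_resFun hT μ f t).continuousAt

theorem contDiff_resFun (μ : ℂ) (f : C(Icc (0 : ℝ) T, X)) : ContDiff ℝ 1 (resFun hT μ f) := by
  rw [contDiff_one_iff_deriv]
  refine ⟨fun t => (hasDerivAt_resFun hT μ f t).differentiableAt, ?_⟩
  rw [funext fun t => (hasDerivAt_resFun hT μ f t).deriv]
  exact ((continuous_resFun hT μ f).const_smul μ).sub (continuous_extend hT f)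

/-- The resolvent `(μ - B)⁻¹`. -/
noncomputable def resB (μ : ℂ) : C(Icc (0 : ℝ) T, X) →L[ℂ] C(Icc (0 : ℝ) T, X) :=
  LinearMap.mkContinuous
    { toFun := fun f => ⟨fun t => resFun hT μ f t,
        (continuous_resFun hT μ f).comp continuous_subtype_val⟩
      map_add' := by
        intro f g
        ext t
        have h1 := (continuous_exp_smul_extend hT (-μ) f).intervalIntegrable (μ := volume) 0 t
        have h2 := (continuous_exp_smul_extend hT (-μ) g).intervalIntegrable (μ := volume) 0 t
        simp only [neg_mul] at h1 h2
        have : ∀ s, IccExtend hT.le (f + g) s = IccExtend hT.le f s + IccExtend hT.le g s :=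
          fun s => rfl
        simp only [resFun, ContinuousMap.coe_mk, ContinuousMap.add_apply]
        rw [← neg_add, ← smul_add, ← intervalIntegral.integral_add h1 h2]
        simp only [← smul_add]
        rfl
      map_smul' := by
        intro c f
        ext t
        have : ∀ s : ℝ, Complex.exp (-(μ * s)) • IccExtend hT.le (c • f) s =
            c • Complex.exp (-(μ * s)) • IccExtend hT.le f s := fun s => smul_comm _ c _
        simp only [resFun, ContinuousMap.coe_mk, ContinuousMap.smul_apply, RingHom.id_apply, this]
        rw [smul_neg, intervalIntegral.integral_smul, smul_comm] }
    (∫ s in (0 : ℝ)..T, Real.exp (μ.re * s)) fun f =>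
      (ContinuousMap.norm_le _ (mul_nonneg (integral_exp_nonneg hT _) (norm_nonneg _))).2 fun t =>
        norm_resFun_le hT μ f t.2

theorem resB_apply (μ : ℂ) (f : C(Icc (0 : ℝ) T, X)) (t : Icc (0 : ℝ) T) :
    resB hT μ f t = resFun hT μ f t := rfl

theorem norm_resB_le (μ : ℂ) :
    ‖resB (X := X) hT μ‖ ≤ ∫ s in (0 : ℝ)..T, Real.exp (μ.re * s) :=
  LinearMap.mkContinuous_norm_le _ (integral_exp_nonneg hT _) _

theorem extend_resB_eqOn (μ : ℂ) (f : C(Icc (0 : ℝ) T, X)) :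
    EqOn (IccExtend hT.le (resB hT μ f)) (resFun hT μ f) (Icc 0 T) := by
  intro t ht
  rw [IccExtend_of_mem _ _ ht, resB_apply]

theorem isResolventAt_resB (μ : ℂ) : IsResolventAt (opB X hT) μ (resB hT μ) := by
  constructor
  · intro f
    refine ⟨⟨resB hT μ f, (contDiff_resFun hT μ f).contDiffOn.congr (extend_resB_eqOn hT μ f), ?_⟩,
      rfl, ?_⟩
    · rw [resB_apply]
      simp [resFun]
    · ext t
      have h : (opB X hT ⟨resB hT μ f, (contDiff_resFun hT μ f).contDiffOn.congr
          (extend_resB_eqOn hT μ f), by rw [resB_apply]; simp [resFun]⟩) t =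
          derivWithin (IccExtend hT.le (resB hT μ f)) (Icc 0 T) t := rfl
      rw [ContinuousMap.sub_apply, ContinuousMap.smul_apply, h,
        derivWithin_congr (extend_resB_eqOn hT μ f) (extend_resB_eqOn hT μ f t.2),
        (hasDerivAt_resFun hT μ f t).hasDerivWithinAt.derivWithin (uniqueDiffOn_Icc hT t t.2),
        resB_apply, IccExtend_val]
      abel
  · intro u
    ext t
    have hu := u.2.1
    have hu0 : IccExtend hT.le (u : C(Icc (0 : ℝ) T, X)) 0 = 0 := by
      rw [IccExtend_of_mem _ _ (left_mem_Icc.2 hT.le)]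
      exact u.2.2
    have hext : ∀ s ∈ Icc (0 : ℝ) T, IccExtend hT.le (μ • (u : C(Icc (0 : ℝ) T, X)) - opB X hT u) s
        = μ • IccExtend hT.le (u : C(Icc (0 : ℝ) T, X)) s
          - derivWithin (IccExtend hT.le (u : C(Icc (0 : ℝ) T, X))) (Icc 0 T) s := by
      intro s hs
      rw [IccExtend_of_mem _ _ hs, IccExtend_of_mem _ _ hs]
      rfl
    -- Integrating factor: `e^{-μ s} (μ u - u')` is the derivative of `-e^{-μ s} u`. Interior points
    -- suffice, and only there is `derivWithin` a two-sided derivative.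
    have hd : ∀ s ∈ Ioo (0 : ℝ) t, HasDerivAt (fun s : ℝ => -(Complex.exp (-(μ * s)) •
        IccExtend hT.le (u : C(Icc (0 : ℝ) T, X)) s)) (Complex.exp (-(μ * s)) •
        IccExtend hT.le (μ • (u : C(Icc (0 : ℝ) T, X)) - opB X hT u) s) s := by
      intro s hs
      have hs' : s ∈ Ioo (0 : ℝ) T := ⟨hs.1, hs.2.trans_le t.2.2⟩
      have h1 : HasDerivAt (IccExtend hT.le (u : C(Icc (0 : ℝ) T, X)))
          (derivWithin (IccExtend hT.le (u : C(Icc (0 : ℝ) T, X))) (Icc 0 T) s) s :=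
        ((hu.differentiableOn one_ne_zero) s
          (Ioo_subset_Icc_self hs')).hasDerivWithinAt.hasDerivAt (Icc_mem_nhds hs'.1 hs'.2)
      have h2 : HasDerivAt (fun t : ℝ => Complex.exp (-(μ * t)))
          (-μ * Complex.exp (-(μ * s))) s := by
        have : HasDerivAt (fun z : ℂ => Complex.exp (-(μ * z)))
            (Complex.exp (-(μ * s)) * (-(μ * 1))) (s : ℂ) :=
          ((hasDerivAt_id (s : ℂ)).const_mul μ).neg.cexp
        convert! this.comp_ofReal using 1
        ring
      rw [hext s (Ioo_subset_Icc_self hs')]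
      convert! (h2.smul h1).neg using 1
      simp only [smul_sub, smul_smul, neg_mul, neg_smul, neg_add, neg_neg, mul_comm _ μ]
      abel
    have hc1 : Continuous (fun s : ℝ => -(Complex.exp (-(μ * s)) •
        IccExtend hT.le (u : C(Icc (0 : ℝ) T, X)) s)) :=
      ((by fun_prop : Continuous fun s : ℝ => Complex.exp (-(μ * s))).smul
        (continuous_extend hT _)).neg
    have hc2 : Continuous (fun s : ℝ => Complex.exp (-(μ * s)) •
        IccExtend hT.le (μ • (u : C(Icc (0 : ℝ) T, X)) - opB X hT u) s) :=
      (by fun_prop : Continuous fun s : ℝ => Complex.exp (-(μ * s))).smul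
        (continuous_extend hT _)
    rw [resB_apply, resFun, intervalIntegral.integral_eq_sub_of_hasDerivAt_of_le t.2.1
      hc1.continuousOn hd (hc2.intervalIntegrable _ _), hu0, smul_zero, neg_zero, sub_zero,
      smul_neg, neg_neg, smul_smul, ← Complex.exp_add, add_neg_cancel, Complex.exp_zero, one_smul,
      IccExtend_val]

theorem resolv_opB (μ : ℂ) : resolv (opB X hT) μ = resB hT μ :=
  (isResolventAt_resB hT μ).resolv_eq

end ResolventOfDerivative

/-! ### The resolvent identity and injectivity of resolvents. -/

section ResolventIdentity

variable {Y : Type*} [NormedAddCommGroup Y] [NormedSpace ℂ Y]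

theorem IsResolventAt.sub_eq {A : Y →ₗ.[ℂ] Y} {μ ν : ℂ} {R S : Y →L[ℂ] Y}
    (hR : IsResolventAt A μ R) (hS : IsResolventAt A ν S) : R - S = (ν - μ) • (R ∘L S) := by
  ext f
  obtain ⟨u, hu, hf⟩ := hS.1 f
  have h := hR.2 u
  have h' : μ • (u : Y) - A u = f + (μ - ν) • S f := by
    rw [← hu, sub_smul, ← hf]; abel
  rw [h', map_add, map_smul, hu] at h
  simp only [_root_.sub_apply, _root_.smul_apply,
    ContinuousLinearMap.comp_apply]
  rw [← neg_sub μ ν, neg_smul, sub_eq_iff_eq_add]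
  nth_rewrite 2 [← h]
  abel

theorem IsResolventAt.injective {A : Y →ₗ.[ℂ] Y} {μ : ℂ} {R : Y →L[ℂ] Y}
    (hR : IsResolventAt A μ R) : Function.Injective R := by
  rw [injective_iff_map_eq_zero]
  intro f hf
  obtain ⟨u, hu, h⟩ := hR.1 f
  have : u = 0 := Subtype.ext (hu.trans hf)
  rw [← h, this]
  simp

end ResolventIdentity

/-! ### Norm continuity of `μ ↦ (μ - B)⁻¹`. -/

section ResolventContinuity

variable {X : Type*} [NormedAddCommGroup X] [NormedSpace ℂ X] [CompleteSpace X] {T : ℝ}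
  (hT : 0 < T)

theorem norm_resB_le_of_norm_le {K : ℝ} {μ : ℂ} (hμ : ‖μ‖ ≤ K) :
    ‖resB (X := X) hT μ‖ ≤ T * Real.exp (K * T) := by
  refine (norm_resB_le hT μ).trans ?_
  have h : ∀ s ∈ Icc (0 : ℝ) T, Real.exp (μ.re * s) ≤ Real.exp (K * T) := by
    intro s hs
    have h1 : μ.re ≤ K := (Complex.re_le_norm μ).trans hμ
    have h2 : 0 ≤ K := (norm_nonneg μ).trans hμ
    exact Real.exp_le_exp.2 (mul_le_mul h1 hs.2 hs.1 h2)
  calc ∫ s in (0 : ℝ)..T, Real.exp (μ.re * s) ≤ ∫ _ in (0 : ℝ)..T, Real.exp (K * T) :=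
        intervalIntegral.integral_mono_on hT.le
          ((by fun_prop : Continuous fun s : ℝ => Real.exp (μ.re * s)).intervalIntegrable _ _)
          (continuous_const.intervalIntegrable _ _) h
    _ = _ := by simp

/-- The resolvent identity turns a locally uniform norm bound into local Lipschitz continuity; it is
needed for measurability of the operator-valued integrands. -/
theorem continuous_resB : Continuous (resB (X := X) hT) := by
  refine continuous_iff_continuousAt.2 fun μ => ?_
  rw [ContinuousAt, tendsto_iff_norm_sub_tendsto_zero]
  set M : ℝ := T * Real.exp ((‖μ‖ + 1) * T)
  have hlim : Tendsto (fun ν : ℂ => ‖μ - ν‖ * (M * M)) (𝓝 μ) (𝓝 0) := by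
    have : Continuous fun ν : ℂ => ‖μ - ν‖ * (M * M) := by fun_prop
    simpa using this.tendsto μ
  refine squeeze_zero' (Eventually.of_forall fun _ => norm_nonneg _) ?_ hlim
  filter_upwards [Metric.ball_mem_nhds μ one_pos] with ν hν
  have hν' : ‖ν‖ ≤ ‖μ‖ + 1 := by
    rw [Metric.mem_ball, dist_eq_norm] at hν
    linarith [norm_le_norm_add_norm_sub' ν μ]
  have hM : 0 ≤ M := mul_nonneg hT.le (Real.exp_pos _).le
  rw [(isResolventAt_resB hT ν).sub_eq (isResolventAt_resB hT μ), norm_smul]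
  gcongr
  refine (ContinuousLinearMap.opNorm_comp_le _ _).trans ?_
  gcongr
  · exact norm_resB_le_of_norm_le hT hν'
  · exact norm_resB_le_of_norm_le hT (by linarith)

end ResolventContinuity

/-! ### Averages of resolvents as convolution operators. -/

section ConvolutionKernels

variable {X : Type*} [NormedAddCommGroup X] [NormedSpace ℂ X] {T : ℝ} (hT : 0 < T)
  {ν : Measure ℝ} {m φ : ℝ → ℂ}

theorem intervalIntegrable_conv {k : ℝ → ℂ} (hk : IntegrableOn k (Ioc 0 T))
    (f : C(Icc (0 : ℝ) T, X)) {t : ℝ} (ht : t ∈ Icc 0 T) :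
    IntervalIntegrable (fun s => k (t - s) • IccExtend hT.le f s) volume 0 t := by
  have h0 : IntervalIntegrable k volume 0 t :=
    (intervalIntegrable_iff_integrableOn_Ioc_of_le ht.1).2
      (hk.mono_set (Ioc_subset_Ioc_right ht.2))
  have h1 : IntervalIntegrable (fun s => k (t - s)) volume 0 t := by
    simpa using (h0.comp_sub_left t).symm
  exact h1.smul_continuousOn (continuous_extend hT f).continuousOn

/-- Young's inequality: this converts an `L¹` estimate of a kernel into an operator bound. -/
theorem norm_conv_le {k : ℝ → ℂ} (hk : IntegrableOn k (Ioc 0 T))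
    (f : C(Icc (0 : ℝ) T, X)) {t : ℝ} (ht : t ∈ Icc 0 T) :
    ‖∫ s in (0 : ℝ)..t, k (t - s) • IccExtend hT.le f s‖ ≤ (∫ s in Ioc 0 T, ‖k s‖) * ‖f‖ := by
  have h0 : IntervalIntegrable (fun s => ‖k s‖) volume 0 t :=
    (intervalIntegrable_iff_integrableOn_Ioc_of_le ht.1).2
      (hk.mono_set (Ioc_subset_Ioc_right ht.2)).norm
  have h1 : IntervalIntegrable (fun s => ‖k (t - s)‖) volume 0 t := by
    simpa using (h0.comp_sub_left t).symm
  calc ‖∫ s in (0 : ℝ)..t, k (t - s) • IccExtend hT.le f s‖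
      ≤ ∫ s in (0 : ℝ)..t, ‖k (t - s)‖ * ‖f‖ := by
        refine intervalIntegral.norm_integral_le_of_norm_le ht.1 ?_ (h1.mul_const _)
        refine Eventually.of_forall fun s _ => ?_
        rw [norm_smul]
        gcongr
        exact norm_extend_le hT f _
    _ = (∫ s in (0 : ℝ)..t, ‖k s‖) * ‖f‖ := by
        rw [intervalIntegral.integral_mul_const,
          intervalIntegral.integral_comp_sub_left (fun s => ‖k s‖)]
        simp
    _ ≤ _ := by
        gcongr
        rw [intervalIntegral.integral_of_le ht.1]
        exact setIntegral_mono_set hk.norm (Eventually.of_forall fun s => norm_nonneg _)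
          (Ioc_subset_Ioc_right ht.2).eventuallyLE

variable [CompleteSpace X]

/-- The bound on `‖(μ - B)⁻¹‖` is exactly the integral of `|e^{μ s}|` over `(0, T)`, so scalar
integrability on the product space already dominates the operator norm. -/
theorem integrable_smul_resB [SFinite ν] (hm : Continuous m) (hφ : AEStronglyMeasurable φ ν)
    (hint : Integrable (fun p : ℝ × ℝ => φ p.1 * Complex.exp (m p.1 * p.2))
      (ν.prod (volume.restrict (Ioc 0 T)))) :
    Integrable (fun ρ => φ ρ • resB (X := X) hT (m ρ)) ν := by
  refine hint.norm.integral_prod_left.mono'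
    (hφ.smul ((continuous_resB hT).comp hm).aestronglyMeasurable) ?_
  refine Eventually.of_forall fun ρ => ?_
  rw [norm_smul]
  simp only [norm_mul]
  rw [integral_const_mul, ← intervalIntegral.integral_of_le hT.le]
  gcongr
  refine (norm_resB_le hT (m ρ)).trans (le_of_eq ?_)
  refine intervalIntegral.integral_congr fun s _ => ?_
  simp [Complex.norm_exp]

/-- Evaluation at `f` and `t` is continuous and linear, so it passes inside the Bochner integral;
Fubini then integrates the exponentials first. -/
theorem integral_smul_resB_apply [SFinite ν] (hm : Continuous m) (hφ : AEStronglyMeasurable φ ν)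
    (hint : Integrable (fun p : ℝ × ℝ => φ p.1 * Complex.exp (m p.1 * p.2))
      (ν.prod (volume.restrict (Ioc 0 T)))) (f : C(Icc (0 : ℝ) T, X)) (t : Icc (0 : ℝ) T) :
    (∫ ρ, φ ρ • resB hT (m ρ) ∂ν) f t =
      -∫ s in (0 : ℝ)..t, (∫ ρ, φ ρ * Complex.exp (m ρ * (t - s : ℝ)) ∂ν) •
        IccExtend hT.le f s := by
  have hI := integrable_smul_resB (X := X) hT hm hφ hint
  have hint' : Integrable (fun p : ℝ × ℝ => φ p.1 * Complex.exp (m p.1 * p.2))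
      (ν.prod (volume.restrict (Ioc (0 : ℝ) t))) := by
    rw [← ν.restrict_univ, Measure.prod_restrict] at hint ⊢
    exact hint.mono_measure (Measure.restrict_mono
      (prod_mono_right (Ioc_subset_Ioc_right t.2.2)) le_rfl)
  have hsw : Integrable (Function.uncurry fun ρ s : ℝ => (φ ρ * Complex.exp (m ρ * s)) •
      IccExtend hT.le f (t - s)) (ν.prod (volume.restrict (Ioc (0 : ℝ) t))) := by
    have hc : Continuous fun p : ℝ × ℝ => IccExtend hT.le f ((t : ℝ) - p.2) :=
      (continuous_extend hT f).comp (by fun_prop)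
    refine (hint'.norm.mul_const ‖f‖).mono' (hint'.1.smul hc.aestronglyMeasurable) ?_
    refine Eventually.of_forall fun p => ?_
    simp only [Function.uncurry_def, norm_smul]
    gcongr
    exact norm_extend_le hT f _
  have heval : (∫ ρ, φ ρ • resB hT (m ρ) ∂ν) f t = ∫ ρ, φ ρ • resFun hT (m ρ) f t ∂ν := by
    rw [ContinuousLinearMap.integral_apply hI]
    exact ((ContinuousMap.evalCLM ℂ t).integral_comp_comm (hI.apply_continuousLinearMap f)).symm
  rw [heval]
  simp only [resFun_eq_conv, smul_neg, ← intervalIntegral.integral_smul, smul_smul]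
  rw [integral_neg]
  simp only [intervalIntegral.integral_of_le t.2.1]
  rw [integral_integral_swap hsw, ← intervalIntegral.integral_of_le t.2.1,
    ← intervalIntegral.integral_of_le t.2.1]
  have h := intervalIntegral.integral_comp_sub_left
    (a := 0) (b := (t : ℝ)) (fun s : ℝ => ∫ ρ, (φ ρ * Complex.exp (m ρ * s)) •
      IccExtend hT.le f (t - s) ∂ν) t
  simp only [sub_self, sub_zero, sub_sub_cancel] at h
  rw [← h]
  simp only [integral_smul_const]

end ConvolutionKernels

/-! ### Volterra convolutions as convolutions on the line. -/

section VolterraConvolution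

variable {E F G : Type*} [NormedAddCommGroup E] [NormedSpace ℂ E] [NormedAddCommGroup F]
  [NormedSpace ℂ F] [NormedAddCommGroup G] [NormedSpace ℂ G] {T : ℝ}

theorem convolution_indicator_of_mem (L : E →L[ℂ] F →L[ℂ] G) (a : ℝ → E) (b : ℝ → F) {x : ℝ}
    (hx : x ∈ Icc 0 T) :
    convolution ((Ioc 0 T).indicator a) ((Ioc 0 T).indicator b) L volume x =
      ∫ u in (0 : ℝ)..x, L (a u) (b (x - u)) := by
  -- At `u = x` the second factor is evaluated at `0`, which `Ioc 0 T` excludes; discarding that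
  -- null point makes the two integrands agree everywhere.
  rw [convolution_def, intervalIntegral.integral_of_le hx.1, integral_Ioc_eq_integral_Ioo,
    ← integral_indicator measurableSet_Ioo]
  congr 1 with u
  by_cases hu : u ∈ Ioo 0 x
  · rw [indicator_of_mem hu, indicator_of_mem (show u ∈ Ioc 0 T from ⟨hu.1, hu.2.le.trans hx.2⟩),
      indicator_of_mem (show x - u ∈ Ioc 0 T from ⟨by linarith [hu.2], by linarith [hu.1, hx.2]⟩)]
  · rw [indicator_of_notMem hu]
    by_cases h0 : u ∈ Ioc 0 T
    · have : x - u ∉ Ioc 0 T := fun h => hu ⟨h0.1, by linarith [h.1]⟩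
      rw [indicator_of_notMem this, map_zero]
    · rw [indicator_of_notMem h0, map_zero, _root_.zero_apply]

theorem convolution_indicator_of_nonpos (L : E →L[ℂ] F →L[ℂ] G) (a : ℝ → E) (b : ℝ → F) {x : ℝ}
    (hx : x ≤ 0) :
    convolution ((Ioc 0 T).indicator a) ((Ioc 0 T).indicator b) L volume x = 0 := by
  rw [convolution_def]
  refine integral_eq_zero_of_ae (Eventually.of_forall fun u => ?_)
  by_cases h0 : u ∈ Ioc 0 T
  · have : x - u ∉ Ioc 0 T := fun h => by linarith [h.1, h0.1]
    simp [indicator_of_notMem this]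
  · simp [indicator_of_notMem h0]

theorem convolutionExistsAt_mul_of_bounded {a b : ℝ → ℝ} (ha : Integrable a)
    (hb : AEStronglyMeasurable b) {M : ℝ} (hM : ∀ x, ‖b x‖ ≤ M) (x : ℝ) :
    ConvolutionExistsAt a b x (ContinuousLinearMap.mul ℝ ℝ) volume :=
  ha.mul_bdd (c := M) (hb.comp_quasiMeasurePreserving
    (quasiMeasurePreserving_sub_left_of_right_invariant volume x))
    (Eventually.of_forall fun _ => hM _)

end VolterraConvolution

/-! ### Associativity of Volterra convolution. -/

section Associativity

variable {X : Type*} [NormedAddCommGroup X] [NormedSpace ℂ X] [CompleteSpace X] {T : ℝ} (hT : 0 < T)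

/-- Extending all three functions by zero reduces this to associativity of convolution on the whole
line. -/
theorem conv_conv {a b : ℝ → ℂ} (ha : IntegrableOn a (Ioc 0 T)) (hb : IntegrableOn b (Ioc 0 T))
    (f : C(Icc (0 : ℝ) T, X)) {t : ℝ} (ht : t ∈ Icc 0 T) :
    ∫ s in (0 : ℝ)..t, a (t - s) • ∫ u in (0 : ℝ)..s, b (s - u) • IccExtend hT.le f u =
      ∫ s in (0 : ℝ)..t, (∫ u in (0 : ℝ)..(t - s), a u * b (t - s - u)) •
        IccExtend hT.le f s := by
  set a' := (Ioc 0 T).indicator a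
  set b' := (Ioc 0 T).indicator b
  set f' := (Ioc 0 T).indicator (IccExtend hT.le f)
  have ha' : Integrable a' := ha.integrable_indicator measurableSet_Ioc
  have hb' : Integrable b' := hb.integrable_indicator measurableSet_Ioc
  have hf' : Integrable f' :=
    ((continuous_extend hT f).integrableOn_Ioc).integrable_indicator measurableSet_Ioc
  have hf'b : ∀ x, ‖f' x‖ ≤ ‖f‖ := fun x =>
    (norm_indicator_le_norm_self _ _).trans (norm_extend_le hT f x)
  -- Associativity is needed at the given `t`, not almost everywhere. Since `f` is bounded, so is
  -- `|b| * |f|`, and its convolution with `|a|` exists at every point.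
  have hbf : ∀ x, ‖convolution (fun x => ‖b' x‖) (fun x => ‖f' x‖)
      (ContinuousLinearMap.mul ℝ ℝ) volume x‖ ≤ (∫ x, ‖b' x‖) * ‖f‖ := by
    intro x
    rw [convolution_def, ← integral_mul_const]
    refine norm_integral_le_of_norm_le (hb'.norm.mul_const _) (Eventually.of_forall fun u => ?_)
    simp only [ContinuousLinearMap.mul_apply', norm_mul, norm_norm]
    gcongr
    exact hf'b _
  have key := convolution_assoc (ContinuousLinearMap.mul ℂ ℂ)
    (ContinuousLinearMap.lsmul ℂ ℂ (E := X))
    (ContinuousLinearMap.lsmul ℂ ℂ (E := X)) (ContinuousLinearMap.lsmul ℂ ℂ (E := X))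
    (f := a') (g := b') (k := f') (ν := volume) (μ := volume) (x₀ := t)
    (fun x y z => mul_smul x y z) ha'.1 hb'.1 hf'.1
    (ha'.ae_convolution_exists _ hb') (hb'.norm.ae_convolution_exists _ hf'.norm)
    (convolutionExistsAt_mul_of_bounded ha'.norm
      (hb'.norm.integrable_convolution _ hf'.norm).1 hbf t)
  have h1 : convolution a' (convolution b' f' (ContinuousLinearMap.lsmul ℂ ℂ (E := X)) volume)
      (ContinuousLinearMap.lsmul ℂ ℂ (E := X)) volume t =
      ∫ s in (0 : ℝ)..t, a (t - s) • ∫ u in (0 : ℝ)..s, b (s - u) • IccExtend hT.le f u := by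
    have h := intervalIntegral.integral_comp_sub_left (a := 0) (b := t) (fun s => a s •
      ∫ u in (0 : ℝ)..(t - s), b (t - s - u) • IccExtend hT.le f u) t
    simp only [sub_self, sub_zero, sub_sub_cancel] at h
    rw [h, convolution_def, intervalIntegral.integral_of_le ht.1, integral_Ioc_eq_integral_Ioo,
      ← integral_indicator measurableSet_Ioo]
    congr 1 with s
    by_cases hs : s ∈ Ioo 0 t
    · rw [indicator_of_mem hs, convolution_indicator_of_mem _ _ _
        (⟨by linarith [hs.2], by linarith [hs.1, ht.2]⟩ : t - s ∈ Icc 0 T)]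
      simp only [a', ContinuousLinearMap.lsmul_apply]
      rw [indicator_of_mem (show s ∈ Ioc 0 T from ⟨hs.1, hs.2.le.trans ht.2⟩)]
      have h := intervalIntegral.integral_comp_sub_left (a := 0) (b := t - s) (fun u =>
        b (t - s - u) • IccExtend hT.le f u) (t - s)
      simp only [sub_self, sub_zero, sub_sub_cancel] at h
      rw [h]
    · rw [indicator_of_notMem hs]
      by_cases h0 : s ∈ Ioc 0 T
      · rw [convolution_indicator_of_nonpos, map_zero]
        by_contra h
        exact hs ⟨h0.1, by linarith⟩
      · simp [a', indicator_of_notMem h0]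
  have h2 : convolution (convolution a' b' (ContinuousLinearMap.mul ℂ ℂ) volume) f'
      (ContinuousLinearMap.lsmul ℂ ℂ (E := X)) volume t =
      ∫ s in (0 : ℝ)..t, (∫ u in (0 : ℝ)..(t - s), a u * b (t - s - u)) •
        IccExtend hT.le f s := by
    have h := intervalIntegral.integral_comp_sub_left (a := 0) (b := t) (fun s =>
      (∫ u in (0 : ℝ)..s, a u * b (s - u)) • IccExtend hT.le f (t - s)) t
    simp only [sub_self, sub_zero, sub_sub_cancel] at h
    rw [h, convolution_def, intervalIntegral.integral_of_le ht.1, integral_Ioc_eq_integral_Ioo,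
      ← integral_indicator measurableSet_Ioo]
    congr 1 with s
    by_cases hs : s ∈ Ioo 0 t
    · rw [indicator_of_mem hs, convolution_indicator_of_mem _ _ _
        (⟨hs.1.le, hs.2.le.trans ht.2⟩ : s ∈ Icc 0 T)]
      simp only [f', ContinuousLinearMap.lsmul_apply, ContinuousLinearMap.mul_apply']
      rw [indicator_of_mem (show t - s ∈ Ioc 0 T from
          ⟨by linarith [hs.2], by linarith [hs.1, ht.2]⟩)]
    · rw [indicator_of_notMem hs]
      by_cases h0 : 0 < s
      · have : t - s ∉ Ioc 0 T := fun h => hs ⟨h0, by linarith [h.1]⟩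
        simp only [f']
        rw [indicator_of_notMem this, map_zero]
      · rw [convolution_indicator_of_nonpos _ _ _ (not_lt.1 h0), map_zero, _root_.zero_apply]
  rw [← h1, ← key, h2]

end Associativity

/-! ### The kernels of fractional integration. -/

section FractionalKernel

/-- The kernel `τ ^ (β - 1) / Γ(β)` of the fractional integral of order `β`. -/
noncomputable def fracKernel (β τ : ℝ) : ℂ := ((τ ^ (β - 1) / Real.Gamma β : ℝ) : ℂ)

theorem integrableOn_fracKernel {β : ℝ} (hβ : 0 < β) (T : ℝ) :
    IntegrableOn (fracKernel β) (Ioc 0 T) := by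
  have h : IntervalIntegrable (fun x : ℝ => x ^ (β - 1)) volume 0 T :=
    intervalIntegral.intervalIntegrable_rpow' (by linarith)
  exact ((h.1).div_const _).ofReal

/-- Euler's Beta integral, rescaled to `(0, τ)`; this is the semigroup law at kernel level. -/
theorem fracKernel_conv {α β τ : ℝ} (hα : 0 < α) (hβ : 0 < β) (hτ : 0 < τ) :
    ∫ u in (0 : ℝ)..τ, fracKernel α u * fracKernel β (τ - u) = fracKernel (α + β) τ := by
  have hb := Complex.betaIntegral_scaled α β hτ
  have hg := Complex.Gamma_mul_Gamma_eq_betaIntegral (s := α) (t := β) (by simpa) (by simpa)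
  have h1 : ∫ u in (0 : ℝ)..τ, fracKernel α u * fracKernel β (τ - u) =
      ∫ u in (0 : ℝ)..τ, (u : ℂ) ^ ((α : ℂ) - 1) * ((τ : ℂ) - u) ^ ((β : ℂ) - 1) /
        (Complex.Gamma α * Complex.Gamma β) := by
    refine intervalIntegral.integral_congr fun u hu => ?_
    rw [uIcc_of_le hτ.le] at hu
    simp only [fracKernel]
    rw [Complex.ofReal_div, Complex.ofReal_div, Complex.ofReal_cpow hu.1,
      Complex.ofReal_cpow (sub_nonneg.2 hu.2), ← Complex.Gamma_ofReal, ← Complex.Gamma_ofReal]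
    push_cast
    rw [div_mul_div_comm]
  have hne : ∀ {x : ℝ}, 0 < x → Complex.Gamma x ≠ 0 := fun {x} hx =>
    Complex.Gamma_ne_zero_of_re_pos (by simpa)
  rw [h1, intervalIntegral.integral_div, hb, hg, fracKernel, Complex.ofReal_div,
    Complex.ofReal_cpow hτ.le, ← Complex.Gamma_ofReal]
  have h2 := hne (add_pos hα hβ)
  have h3 : Complex.betaIntegral α β ≠ 0 := fun h => by
    rw [h, mul_zero] at hg
    exact mul_ne_zero (hne hα) (hne hβ) hg
  push_cast at h2 ⊢
  field_simp

end FractionalKernel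

/-! ### Plane geometry of sectors and shifted rays. -/

section Geometry

theorem dir_re (θ : ℝ) : (dir θ).re = Real.cos θ := Complex.exp_ofReal_mul_I_re θ

theorem dir_im (θ : ℝ) : (dir θ).im = Real.sin θ := Complex.exp_ofReal_mul_I_im θ

@[simp]
theorem norm_dir (θ : ℝ) : ‖dir θ‖ = 1 := Complex.norm_exp_ofReal_mul_I θ

theorem continuous_dir : Continuous dir := by
  unfold dir
  fun_prop

theorem hasDerivAt_dir (θ : ℝ) : HasDerivAt dir (Complex.I * dir θ) θ := by
  have : HasDerivAt (fun z : ℂ => Complex.exp (z * Complex.I))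
      (Complex.exp (θ * Complex.I) * (1 * Complex.I)) (θ : ℂ) :=
    ((hasDerivAt_id (θ : ℂ)).mul_const Complex.I).cexp
  convert! this.comp_ofReal using 1
  rw [one_mul, mul_comm]
  rfl

/-- The closed sector of half-opening `θ` around the positive real axis, without its vertex. -/
def sector (θ : ℝ) : Set ℂ := {μ | μ ≠ 0 ∧ Real.cos θ * ‖μ‖ ≤ μ.re}

variable {c θ r ρ s φ : ℝ} {μ : ℂ}

theorem sector_subset_slitPlane (hθ : π / 2 < θ) (hθ' : θ < π) : sector θ ⊆ Complex.slitPlane := by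
  rintro μ ⟨h0, h⟩
  rw [Complex.mem_slitPlane_iff]
  by_contra! hμ
  have h1 : ‖μ‖ = -μ.re := by
    have : μ = (μ.re : ℂ) := Complex.ext rfl (by simp [hμ.2])
    rw [this, Complex.norm_real, Real.norm_eq_abs, abs_of_nonpos (by simpa using hμ.1)]
    simp
  have h2 : 0 < ‖μ‖ := norm_pos_iff.2 h0
  have h3 : -1 < Real.cos θ := by
    rw [← Real.cos_pi]
    exact Real.cos_lt_cos_of_nonneg_of_le_pi (by linarith [pi_pos]) le_rfl hθ'
  nlinarith

theorem abs_arg_le_of_mem_sector (hθ : 0 ≤ θ) (h : μ ∈ sector θ) :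
    |μ.arg| ≤ θ := by
  have h2 : 0 < ‖μ‖ := norm_pos_iff.2 h.1
  have h1 : Real.cos θ ≤ Real.cos |μ.arg| := by
    rw [Real.cos_abs, Complex.cos_arg h.1, le_div_iff₀ h2]
    exact h.2
  by_contra! h3
  exact absurd h1 (not_le.2 (Real.cos_lt_cos_of_nonneg_of_le_pi hθ (Complex.abs_arg_le_pi μ) h3))

theorem smul_mem_sector (hs : 0 < s) (h : μ ∈ sector θ) : (s : ℂ) * μ ∈ sector θ := by
  refine ⟨mul_ne_zero (by exact_mod_cast hs.ne') h.1, ?_⟩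
  rw [norm_mul, Complex.norm_real, Real.norm_of_nonneg hs.le, Complex.re_ofReal_mul]
  nlinarith [mul_le_mul_of_nonneg_left h.2 hs.le]

theorem re_add_mul_dir : ((c : ℂ) + ρ * dir φ).re = c + ρ * Real.cos φ := by
  simp [dir_re]

theorem norm_add_mul_dir_le (hc : 0 ≤ c) (hρ : 0 ≤ ρ) : ‖(c : ℂ) + ρ * dir φ‖ ≤ c + ρ := by
  refine (norm_add_le _ _).trans ?_
  simp [abs_of_nonneg hc, abs_of_nonneg hρ]

theorem cos_le_cos_of_abs_le (hθ' : θ < π) (hφ : |φ| ≤ θ) : Real.cos θ ≤ Real.cos φ := by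
  rw [← Real.cos_abs φ]
  exact Real.cos_le_cos_of_nonneg_of_le_pi (abs_nonneg _) hθ'.le hφ

/-- The constant of `le_norm_add_mul_dir`. -/
noncomputable def apt (θ : ℝ) : ℝ := (1 + Real.cos θ) / 2

theorem apt_pos (hθ : π / 2 < θ) (hθ' : θ < π) : 0 < apt θ := by
  have h3 : -1 < Real.cos θ := by
    rw [← Real.cos_pi]
    exact Real.cos_lt_cos_of_nonneg_of_le_pi (by linarith [pi_pos]) le_rfl hθ'
  unfold apt
  linarith

/-- With `k = cos θ`, the squared norm is at least `c² + ρ² + 2cρk`, which equals `(1 + k)/2 · (c +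
ρ)² + (1 - k)/2 · (c - ρ)²`. As `apt θ ≤ 1`, its square may replace it in the lower bound. -/
theorem le_norm_add_mul_dir (hθ' : θ < π) (hφ : |φ| ≤ θ) (hc : 0 ≤ c) (hρ : 0 ≤ ρ) :
    apt θ * (c + ρ) ≤ ‖(c : ℂ) + ρ * dir φ‖ := by
  have h1 := cos_le_cos_of_abs_le hθ' hφ
  have h2 := Real.neg_one_le_cos θ
  have h3 := Real.cos_le_one θ
  have h4 := Real.cos_le_one φ
  have hq0 : 0 ≤ apt θ := by unfold apt; linarith
  have hq1 : apt θ ≤ 1 := by unfold apt; linarith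
  have hq : 2 * apt θ = 1 + Real.cos θ := by unfold apt; ring
  refine le_of_sq_le_sq ?_ (norm_nonneg _)
  rw [← Complex.normSq_eq_norm_sq, Complex.normSq_apply, re_add_mul_dir]
  have him : ((c : ℂ) + ρ * dir φ).im = ρ * Real.sin φ := by simp [dir_im]
  rw [him]
  have h5 := Real.sin_sq_add_cos_sq φ
  have h6 : (c + ρ * Real.cos φ) * (c + ρ * Real.cos φ) + ρ * Real.sin φ * (ρ * Real.sin φ) =
      c ^ 2 + ρ ^ 2 + 2 * (c * ρ) * Real.cos φ := by
    linear_combination ρ ^ 2 * h5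
  rw [h6]
  have h7 : apt θ ^ 2 ≤ apt θ := by nlinarith
  have h8 : 0 ≤ c * ρ := mul_nonneg hc hρ
  calc (apt θ * (c + ρ)) ^ 2 = apt θ ^ 2 * (c + ρ) ^ 2 := by ring
    _ ≤ apt θ * (c + ρ) ^ 2 := by gcongr
    _ ≤ _ := by
        unfold apt
        nlinarith [mul_nonneg (sub_nonneg.2 h3) (sq_nonneg (c - ρ)),
          mul_nonneg h8 (sub_nonneg.2 h1)]

/-- Since `cos θ ≤ 0`, the estimate `‖μ‖ ≥ ρ - c` gives `cos θ ‖μ‖ ≤ ρ cos θ - c cos θ ≤ ρ cos φ +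
c`. -/
theorem add_mul_dir_mem_sector (hθ : π / 2 < θ) (hθ' : θ < π) (hφ : |φ| ≤ θ) (hc : 0 ≤ c)
    (hρ : 0 ≤ ρ) (h : 0 < c + ρ) : (c : ℂ) + ρ * dir φ ∈ sector θ := by
  refine ⟨norm_pos_iff.1 ((mul_pos (apt_pos hθ hθ') h).trans_le
    (le_norm_add_mul_dir hθ' hφ hc hρ)), ?_⟩
  rw [re_add_mul_dir]
  have h1 := cos_le_cos_of_abs_le hθ' hφ
  have h2 : Real.cos θ ≤ 0 := Real.cos_nonpos_of_pi_div_two_le_of_le hθ.le (by linarith)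
  have h3 := Real.neg_one_le_cos θ
  have h4 : ρ - c ≤ ‖(c : ℂ) + ρ * dir φ‖ := by
    have := norm_sub_norm_le ((ρ : ℂ) * dir φ) (-(c : ℂ))
    rw [sub_neg_eq_add, add_comm ((ρ : ℂ) * dir φ)] at this
    simpa [abs_of_nonneg hc, abs_of_nonneg hρ, sub_eq_neg_add] using this
  nlinarith

end Geometry

/-! ### Integrals over shifted keyhole contours. -/

section Keyhole

variable {E : Type*} [NormedAddCommGroup E]

/-- Absolute convergence of `keyAt c θ r F`. -/
def KeyIntAt (c θ r : ℝ) (F : ℂ → E) : Prop :=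
  IntegrableOn (fun ρ : ℝ => F (c + ρ * dir (-θ))) (Ioi r) ∧
    IntegrableOn (fun ρ : ℝ => F (c + ρ * dir θ)) (Ioi r) ∧
    IntervalIntegrable (fun φ : ℝ => F (c + r * dir φ)) volume (-θ) θ

theorem keyholeIntegrable_iff (θ r : ℝ) (F : ℂ → E) :
    KeyholeIntegrable θ r F ↔ KeyIntAt 0 θ r F := by
  simp [KeyholeIntegrable, KeyIntAt]

variable {c θ r : ℝ} {F G : ℂ → E}

theorem KeyIntAt.add (hF : KeyIntAt c θ r F) (hG : KeyIntAt c θ r G) :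
    KeyIntAt c θ r fun μ => F μ + G μ :=
  ⟨hF.1.add hG.1, hF.2.1.add hG.2.1, hF.2.2.add hG.2.2⟩

theorem KeyIntAt.smul {R : Type*} [NormedRing R] [Module R E] [IsBoundedSMul R E]
    (a : R) (hF : KeyIntAt c θ r F) : KeyIntAt c θ r fun μ => a • F μ :=
  ⟨hF.1.smul a, hF.2.1.smul a, hF.2.2.smul a⟩

variable [NormedSpace ℂ E]

/-- The integral over the contour `c + Γ(θ, r)`; for `r = 0` it is the integral over the two
half-lines that start at `c`. -/
noncomputable def keyAt (c θ r : ℝ) (F : ℂ → E) : E :=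
  raysIntegral c θ r F + ∫ φ in (-θ)..θ, (Complex.I * (r * dir φ)) • F (c + r * dir φ)

theorem keyholeIntegral_eq_keyAt (θ r : ℝ) (F : ℂ → E) : keyholeIntegral θ r F = keyAt 0 θ r F := by
  simp [keyholeIntegral, keyAt]

theorem raysIntegral_eq_keyAt (c θ : ℝ) (F : ℂ → E) : raysIntegral c θ 0 F = keyAt c θ 0 F := by
  simp [keyAt]

theorem intervalIntegrable_arc (hF : KeyIntAt c θ r F) : IntervalIntegrable
    (fun φ : ℝ => (Complex.I * (r * dir φ)) • F (c + r * dir φ)) volume (-θ) θ :=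
  hF.2.2.continuousOn_smul
    ((continuous_const.mul (continuous_const.mul continuous_dir)).continuousOn)

theorem keyAt_add (hF : KeyIntAt c θ r F) (hG : KeyIntAt c θ r G) :
    keyAt c θ r (fun μ => F μ + G μ) = keyAt c θ r F + keyAt c θ r G := by
  simp only [keyAt, raysIntegral, integral_smul]
  simp only [smul_add]
  rw [integral_add hF.1 hG.1, integral_add hF.2.1 hG.2.1,
    intervalIntegral.integral_add (intervalIntegrable_arc hF) (intervalIntegrable_arc hG)]
  simp only [smul_add]
  abel

theorem keyAt_smul (a : ℂ) (F : ℂ → E) :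
    keyAt c θ r (fun μ => a • F μ) = a • keyAt c θ r F := by
  simp only [keyAt, raysIntegral, integral_smul, smul_comm _ a, intervalIntegral.integral_smul,
    smul_add, smul_neg]

/-- The fundamental theorem of calculus along the contour. -/
theorem keyAt_deriv_eq_zero [CompleteSpace E] {G G' : ℂ → E} (hθ : π / 2 < θ) (hθ' : θ < π)
    (hc : 0 ≤ c) (hr : 0 ≤ r) (hcr : 0 < c + r) (hG : ∀ μ ∈ sector θ, HasDerivAt G (G' μ) μ)
    (hG' : KeyIntAt c θ r G')
    (h0 : ∀ φ, |φ| = θ → Tendsto (fun ρ : ℝ => G (c + ρ * dir φ)) atTop (𝓝 0)) :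
    keyAt c θ r G' = 0 := by
  have hθ0 : 0 < θ := by linarith [pi_pos]
  have hray : ∀ φ, |φ| = θ → IntegrableOn (fun ρ : ℝ => G' (c + ρ * dir φ)) (Ioi r) →
      ∫ ρ in Ioi r, dir φ • G' (c + ρ * dir φ) = -G (c + r * dir φ) := by
    intro φ hφ hi
    have hd : ∀ ρ ∈ Ici r, HasDerivAt (fun ρ : ℝ => G (c + ρ * dir φ))
        (dir φ • G' (c + ρ * dir φ)) ρ := by
      intro ρ hρ
      have h1 : HasDerivAt (fun ρ : ℝ => (c : ℂ) + ρ * dir φ) (dir φ) ρ := by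
        have : HasDerivAt (fun z : ℂ => (c : ℂ) + z * dir φ) (1 * dir φ) (ρ : ℂ) :=
          ((hasDerivAt_id (ρ : ℂ)).mul_const (dir φ)).const_add _
        rw [one_mul] at this
        exact this.comp_ofReal
      exact (hG _ (add_mul_dir_mem_sector hθ hθ' hφ.le hc (hr.trans hρ)
        (by linarith [mem_Ici.1 hρ]))).scomp ρ h1
    rw [integral_Ioi_of_hasDerivAt_of_tendsto (hd r self_mem_Ici).continuousAt.continuousWithinAt
      (fun ρ hρ => hd ρ (mem_Ici_of_Ioi hρ)) (hi.smul _) (h0 φ hφ), zero_sub]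
  have harc : ∫ φ in (-θ)..θ, (Complex.I * (r * dir φ)) • G' (c + r * dir φ) =
      G (c + r * dir θ) - G (c + r * dir (-θ)) := by
    refine intervalIntegral.integral_eq_sub_of_hasDerivAt (f := fun φ => G (c + r * dir φ))
      (fun φ hφ => ?_) (intervalIntegrable_arc hG')
    rw [uIcc_of_le (by linarith)] at hφ
    have h1 : HasDerivAt (fun φ : ℝ => (c : ℂ) + r * dir φ) (Complex.I * (r * dir φ)) φ := by
      convert! ((hasDerivAt_dir φ).const_mul (r : ℂ)).const_add (c : ℂ) using 1
      ring
    exact (hG _ (add_mul_dir_mem_sector hθ hθ' (abs_le.2 hφ) hc hr hcr)).scomp φ h1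
  rw [keyAt, raysIntegral, harc, hray θ (abs_of_pos hθ0) hG'.2.1,
    hray (-θ) (by rw [abs_neg, abs_of_pos hθ0]) hG'.1]
  abel

theorem keyAt_scale {s : ℝ} (hs : 0 < s) (F : ℂ → E) :
    keyAt (s * c) θ (s * r) F = keyAt c θ r fun μ => (s : ℂ) • F (s * μ) := by
  have hray : ∀ φ, ∫ ρ in Ioi (s * r), dir φ • F ((s * c : ℝ) + ρ * dir φ) =
      ∫ ρ in Ioi r, dir φ • (s : ℂ) • F (s * (c + ρ * dir φ)) := by
    intro φ
    have := integral_comp_mul_left_Ioi (fun ρ : ℝ => dir φ • F ((s * c : ℝ) + ρ * dir φ)) r hs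
    rw [eq_inv_smul_iff₀ hs.ne', ← integral_smul] at this
    rw [← this]
    congr 1 with ρ
    rw [smul_comm, Complex.coe_smul]
    congr 4
    push_cast
    ring
  simp only [keyAt, raysIntegral, hray]
  congr 2 with φ
  have h1 : Complex.I * ((s * r : ℝ) * dir φ) = Complex.I * (r * dir φ) * s := by
    push_cast; ring
  have h2 : ((s * c : ℝ) : ℂ) + (s * r : ℝ) * dir φ = s * (c + r * dir φ) := by
    push_cast; ring
  rw [smul_smul, h1, h2]

end Keyhole

/-! ### Exponential decay along the rays and absolute convergence. -/

section ExponentialBounds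

/-- Growth bound for integrands of inverse Laplace transforms at time `τ`. -/
def ExpBound (θ τ β A : ℝ) (F : ℂ → ℂ) : Prop :=
  ∀ μ ∈ sector θ, ‖F μ‖ ≤ A * ((1 + ‖μ‖) * Real.exp (τ * μ.re) * ‖μ‖ ^ (-β))

variable {c θ r s τ β A : ℝ} {F F' : ℂ → ℂ}

/-- The constants are uniform for vertices in `[0, K]`, which supplies a common dominating function
when the contour is rescaled. -/
theorem ExpBound.exists_ray_bound (hF : ExpBound θ τ β A F) (hA : 0 ≤ A) (hθ : π / 2 < θ)
    (hθ' : θ < π) (hτ : 0 < τ) (hβ : 0 ≤ β) (K : ℝ) :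
    ∃ C b : ℝ, 0 ≤ C ∧ 0 < b ∧ ∀ φ x ρ : ℝ, |φ| = θ → 0 ≤ x → x ≤ K → 0 ≤ ρ → 0 < x + ρ →
      ‖F (x + ρ * dir φ)‖ ≤ C * (x + ρ) ^ (-β) * Real.exp (-b * ρ) := by
  have hκ : 0 < -Real.cos θ := by
    have := Real.cos_neg_of_pi_div_two_lt_of_lt hθ (by linarith)
    linarith
  have hq := apt_pos hθ hθ'
  -- Half of the decay rate `τ |cos θ|`: the other half absorbs the linear factor `1 + ‖μ‖`.
  set b : ℝ := τ * (-Real.cos θ) / 2 with hb_def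
  have hb : 0 < b := by positivity
  refine ⟨A * ((1 + |K|) * (1 + b⁻¹) * Real.exp (τ * |K|) * apt θ ^ (-β)), b, by positivity, hb,
    fun φ x ρ hφ hx hxK hρ hxρ => ?_⟩
  have hmem := add_mul_dir_mem_sector hθ hθ' hφ.le hx hρ hxρ
  have hK : x ≤ |K| := hxK.trans (le_abs_self K)
  have h1 : 1 + ‖(x : ℂ) + ρ * dir φ‖ ≤ (1 + |K|) * ((1 + b⁻¹) * Real.exp (b * ρ)) := by
    have h2 : 1 + ρ ≤ (1 + b⁻¹) * Real.exp (b * ρ) := by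
      have h3 := Real.add_one_le_exp (b * ρ)
      have h4 : (1 + b⁻¹) * (b * ρ + 1) ≤ (1 + b⁻¹) * Real.exp (b * ρ) := by gcongr
      have h5 : (1 + b⁻¹) * (b * ρ + 1) = 1 + ρ + (b * ρ + b⁻¹) := by field_simp; ring
      have h6 : 0 ≤ b * ρ + b⁻¹ := by positivity
      linarith
    calc 1 + ‖(x : ℂ) + ρ * dir φ‖ ≤ 1 + (|K| + ρ) := by
          linarith [norm_add_mul_dir_le (φ := φ) hx hρ]
      _ ≤ (1 + |K|) * (1 + ρ) := by nlinarith [abs_nonneg K]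
      _ ≤ _ := by gcongr
  have h2 : Real.exp (τ * ((x : ℂ) + ρ * dir φ).re) ≤
      Real.exp (τ * |K|) * (Real.exp (-b * ρ) * Real.exp (-b * ρ)) := by
    rw [← Real.exp_add, ← Real.exp_add, re_add_mul_dir, ← Real.cos_abs, hφ]
    refine Real.exp_le_exp.2 ?_
    have : τ * x ≤ τ * |K| := by gcongr
    have h3 : -b * ρ + -b * ρ = τ * (ρ * Real.cos θ) := by rw [hb_def]; ring
    rw [h3]
    linarith
  have h3 : ‖(x : ℂ) + ρ * dir φ‖ ^ (-β) ≤ apt θ ^ (-β) * (x + ρ) ^ (-β) := by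
    rw [← Real.mul_rpow hq.le hxρ.le]
    exact Real.rpow_le_rpow_of_nonpos (mul_pos hq hxρ) (le_norm_add_mul_dir hθ' hφ.le hx hρ)
      (by linarith)
  calc ‖F (x + ρ * dir φ)‖ ≤ A * ((1 + ‖(x : ℂ) + ρ * dir φ‖) *
        Real.exp (τ * ((x : ℂ) + ρ * dir φ).re) * ‖(x : ℂ) + ρ * dir φ‖ ^ (-β)) := hF _ hmem
    _ ≤ A * (((1 + |K|) * ((1 + b⁻¹) * Real.exp (b * ρ))) *
        (Real.exp (τ * |K|) * (Real.exp (-b * ρ) * Real.exp (-b * ρ))) *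
        (apt θ ^ (-β) * (x + ρ) ^ (-β))) := by gcongr
    _ = A * ((1 + |K|) * (1 + b⁻¹) * Real.exp (τ * |K|) * apt θ ^ (-β)) * (x + ρ) ^ (-β) *
        Real.exp (-b * ρ) * (Real.exp (b * ρ) * Real.exp (-b * ρ)) := by ring
    _ = _ := by rw [← Real.exp_add, neg_mul, add_neg_cancel, Real.exp_zero, mul_one]

theorem ExpBound.exists_arc_bound (hF : ExpBound θ τ β A F) (hA : 0 ≤ A) (hθ : π / 2 < θ)
    (hθ' : θ < π) (hτ : 0 < τ) (hβ : 0 ≤ β) (K : ℝ) :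
    ∃ C : ℝ, 0 ≤ C ∧ ∀ φ x ρ : ℝ, |φ| ≤ θ → 0 ≤ x → 0 ≤ ρ → x + ρ ≤ K → 0 < x + ρ →
      ‖F (x + ρ * dir φ)‖ ≤ C * (x + ρ) ^ (-β) := by
  have hq := apt_pos hθ hθ'
  refine ⟨A * ((1 + |K|) * Real.exp (τ * |K|) * apt θ ^ (-β)), by positivity,
    fun φ x ρ hφ hx hρ hxK hxρ => ?_⟩
  have hmem := add_mul_dir_mem_sector hθ hθ' hφ hx hρ hxρ
  have h1 : ‖(x : ℂ) + ρ * dir φ‖ ≤ |K| :=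
    (norm_add_mul_dir_le hx hρ).trans (hxK.trans (le_abs_self K))
  have h2 : ((x : ℂ) + ρ * dir φ).re ≤ |K| := (Complex.re_le_norm _).trans h1
  have h3 : ‖(x : ℂ) + ρ * dir φ‖ ^ (-β) ≤ apt θ ^ (-β) * (x + ρ) ^ (-β) := by
    rw [← Real.mul_rpow hq.le hxρ.le]
    exact Real.rpow_le_rpow_of_nonpos (mul_pos hq hxρ) (le_norm_add_mul_dir hθ' hφ hx hρ)
      (by linarith)
  calc ‖F (x + ρ * dir φ)‖ ≤ A * ((1 + ‖(x : ℂ) + ρ * dir φ‖) *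
        Real.exp (τ * ((x : ℂ) + ρ * dir φ).re) * ‖(x : ℂ) + ρ * dir φ‖ ^ (-β)) := hF _ hmem
    _ ≤ A * ((1 + |K|) * Real.exp (τ * |K|) * (apt θ ^ (-β) * (x + ρ) ^ (-β))) := by gcongr
    _ = _ := by ring

theorem continuous_ray (c φ : ℝ) : Continuous fun ρ : ℝ => (c : ℂ) + ρ * dir φ := by fun_prop

theorem continuous_arc (c r : ℝ) : Continuous fun φ : ℝ => (c : ℂ) + r * dir φ :=
  continuous_const.add (continuous_const.mul continuous_dir)

theorem continuousOn_comp_ray {E : Type*} [TopologicalSpace E] {F : ℂ → E} {φ : ℝ}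
    (hF : ContinuousOn F (sector θ)) (hθ : π / 2 < θ) (hθ' : θ < π)
    (hc : 0 ≤ c) (hr : 0 ≤ r) (hφ : |φ| ≤ θ) :
    ContinuousOn (fun ρ : ℝ => F (c + ρ * dir φ)) (Ioi r) :=
  hF.comp (continuous_ray c φ).continuousOn fun ρ hρ =>
    add_mul_dir_mem_sector hθ hθ' hφ hc (hr.trans (le_of_lt hρ)) (by linarith [mem_Ioi.1 hρ])

theorem continuousOn_comp_arc {E : Type*} [TopologicalSpace E] {F : ℂ → E}
    (hF : ContinuousOn F (sector θ)) (hθ : π / 2 < θ) (hθ' : θ < π)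
    (hc : 0 ≤ c) (hr : 0 ≤ r) (hcr : 0 < c + r) :
    ContinuousOn (fun φ : ℝ => F (c + r * dir φ)) (Icc (-θ) θ) :=
  hF.comp (continuous_arc c r).continuousOn fun _ hφ =>
    add_mul_dir_mem_sector hθ hθ' (abs_le.2 hφ) hc hr hcr

theorem integrableOn_exp_decay {b : ℝ} (hb : 0 < b) (C r : ℝ) :
    IntegrableOn (fun ρ : ℝ => C * Real.exp (-b * ρ)) (Ioi r) :=
  (integrableOn_exp_mul_Ioi (by linarith) r).const_mul C

theorem ExpBound.keyIntAt (hF : ExpBound θ τ β A F) (hA : 0 ≤ A) (hθ : π / 2 < θ)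
    (hθ' : θ < π) (hτ : 0 < τ) (hβ : 0 ≤ β) (hc : 0 ≤ c) (hr : 0 ≤ r) (hcr : 0 < c + r)
    (hFc : ContinuousOn F (sector θ)) : KeyIntAt c θ r F := by
  have hθ0 : 0 < θ := by linarith [pi_pos]
  obtain ⟨C, b, hC, hb, h⟩ := hF.exists_ray_bound hA hθ hθ' hτ hβ c
  have hray : ∀ φ, |φ| = θ → IntegrableOn (fun ρ : ℝ => F (c + ρ * dir φ)) (Ioi r) := by
    intro φ hφ
    refine (integrableOn_exp_decay hb (C * (c + r) ^ (-β)) r).mono'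
      ((continuousOn_comp_ray hFc hθ hθ' hc hr hφ.le).aestronglyMeasurable measurableSet_Ioi) ?_
    filter_upwards [ae_restrict_mem measurableSet_Ioi] with ρ hρ
    rw [mem_Ioi] at hρ
    refine (h φ c ρ hφ hc le_rfl (hr.trans hρ.le) (by linarith)).trans ?_
    gcongr ?_ * _
    gcongr ?_ * ?_
    exact Real.rpow_le_rpow_of_nonpos hcr (by linarith) (by linarith)
  refine ⟨hray (-θ) (by rw [abs_neg, abs_of_pos hθ0]), hray θ (abs_of_pos hθ0), ?_⟩
  refine ContinuousOn.intervalIntegrable ?_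
  rw [uIcc_of_le (by linarith)]
  exact continuousOn_comp_arc hFc hθ hθ' hc hr hcr

end ExponentialBounds

/-! ### Deforming contours by scaling and collapsing them onto `0`. -/

section Collapse

variable {c θ r s τ β A : ℝ} {F F' : ℂ → ℂ}

theorem ExpBound.scale (hF : ExpBound θ τ β A F) (hA : 0 ≤ A) (hs : 0 < s) :
    ExpBound θ (τ * s) β (A * (1 + s) * s ^ (-β)) fun μ => F (s * μ) := by
  intro μ hμ
  have h := hF _ (smul_mem_sector hs hμ)
  rw [norm_mul, Complex.norm_real, Real.norm_of_nonneg hs.le, Complex.re_ofReal_mul,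
    Real.mul_rpow hs.le (norm_nonneg _)] at h
  refine h.trans ?_
  have h1 : 1 + s * ‖μ‖ ≤ (1 + s) * (1 + ‖μ‖) := by nlinarith [norm_nonneg μ]
  calc A * ((1 + s * ‖μ‖) * Real.exp (τ * (s * μ.re)) * (s ^ (-β) * ‖μ‖ ^ (-β)))
      ≤ A * (((1 + s) * (1 + ‖μ‖)) * Real.exp (τ * (s * μ.re)) * (s ^ (-β) * ‖μ‖ ^ (-β))) := by
        gcongr
    _ = _ := by rw [← mul_assoc τ]; ring

theorem tendsto_affine_mul_exp_neg (C : ℝ) {b : ℝ} (hb : 0 < b) :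
    Tendsto (fun ρ : ℝ => (C + ρ) * Real.exp (-b * ρ)) atTop (𝓝 0) := by
  have h1 : Tendsto (fun ρ : ℝ => b * ρ) atTop atTop := tendsto_id.const_mul_atTop hb
  have h2 := (Real.tendsto_pow_mul_exp_neg_atTop_nhds_zero 1).comp h1
  have h3 := (Real.tendsto_pow_mul_exp_neg_atTop_nhds_zero 0).comp h1
  have h4 := (h3.const_mul C).add (h2.const_mul b⁻¹)
  simp only [mul_zero, add_zero] at h4
  refine h4.congr fun ρ => ?_
  simp only [Function.comp_apply, pow_zero, pow_one, neg_mul]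
  field_simp

theorem tendsto_mul_ray (hF : ExpBound θ τ β A F) (hA : 0 ≤ A) (hθ : π / 2 < θ)
    (hθ' : θ < π) (hτ : 0 < τ) (hβ : 0 ≤ β) (hc : 0 ≤ c) {φ : ℝ} (hφ : |φ| = θ) :
    Tendsto (fun ρ : ℝ => ((c : ℂ) + ρ * dir φ) * F (c + ρ * dir φ)) atTop (𝓝 0) := by
  obtain ⟨C, b, hC, hb, h⟩ := hF.exists_ray_bound hA hθ hθ' hτ hβ c
  refine squeeze_zero_norm' ?_ (by simpa using (tendsto_affine_mul_exp_neg c hb).const_mul C)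
  filter_upwards [eventually_ge_atTop (1 : ℝ)] with ρ hρ
  have h1 : (c + ρ) ^ (-β) ≤ 1 := Real.rpow_le_one_of_one_le_of_nonpos (by linarith) (by linarith)
  rw [norm_mul]
  calc ‖(c : ℂ) + ρ * dir φ‖ * ‖F (c + ρ * dir φ)‖
      ≤ (c + ρ) * (C * (c + ρ) ^ (-β) * Real.exp (-b * ρ)) := by
        exact mul_le_mul (norm_add_mul_dir_le hc (by linarith))
          (h φ c ρ hφ hc le_rfl (by linarith) (by linarith)) (norm_nonneg _) (by linarith)
    _ ≤ (c + ρ) * (C * 1 * Real.exp (-b * ρ)) := by gcongr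
    _ = C * ((c + ρ) * Real.exp (-(b * ρ))) := by rw [neg_mul]; ring

theorem hasDerivAt_comp_real_mul (hs : 0 < s) {μ : ℂ} (hμ : μ ∈ sector θ)
    (hd : ∀ μ ∈ sector θ, HasDerivAt F (F' μ) μ) :
    HasDerivAt (fun s : ℝ => (s : ℂ) • F (s * μ)) (F (s * μ) + s * μ * F' (s * μ)) s := by
  have h1 : HasDerivAt (fun z : ℂ => z * μ) (1 * μ) (s : ℂ) := (hasDerivAt_id _).mul_const μ
  have h2 : HasDerivAt (fun z : ℂ => F (z * μ)) (F' (s * μ) * (1 * μ)) (s : ℂ) :=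
    (hd _ (smul_mem_sector hs hμ)).comp (s : ℂ) h1
  have h3 := ((hasDerivAt_id (s : ℂ)).mul h2).comp_ofReal
  convert! h3 using 1
  simp only [id]
  ring

theorem continuousOn_comp_scale (hs : 0 < s) (hF : ContinuousOn F (sector θ)) :
    ContinuousOn (fun μ => F (s * μ)) (sector θ) :=
  hF.comp (by fun_prop) fun _ hμ => smul_mem_sector hs hμ

/-- Differentiation under the integral sign; the hypothesis on `F + μ F'` provides the domination,
since this is the derivative of `s F(s μ)` in `s`, up to rescaling. -/
theorem hasDerivAt_keyAt_scale (hF : ExpBound θ τ β A F)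
    (hD : ExpBound θ τ β A fun μ => F μ + μ * F' μ)
    (hA : 0 ≤ A) (hθ : π / 2 < θ) (hθ' : θ < π) (hτ : 0 < τ) (hβ : 0 ≤ β) (hc : 0 ≤ c)
    (hr : 0 ≤ r) (hcr : 0 < c + r) (hd : ∀ μ ∈ sector θ, HasDerivAt F (F' μ) μ)
    (hF' : ContinuousOn F' (sector θ)) (hs : 0 < s) :
    HasDerivAt (fun s : ℝ => keyAt c θ r fun μ => (s : ℂ) • F (s * μ))
      (keyAt c θ r fun μ => F (s * μ) + s * μ * F' (s * μ)) s := by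
  have hθ0 : 0 < θ := by linarith [pi_pos]
  have hFc : ContinuousOn F (sector θ) := fun μ hμ => (hd μ hμ).continuousAt.continuousWithinAt
  have hDc : ContinuousOn (fun μ => F μ + μ * F' μ) (sector θ) :=
    hFc.add (continuousOn_id.mul hF')
  have hDs := continuousOn_comp_scale hs hDc
  have hFs : ∀ {s : ℝ}, 0 < s → KeyIntAt c θ r fun μ => (s : ℂ) • F (s * μ) := fun {s} hs =>
    ((hF.scale hA hs).keyIntAt (by positivity) hθ hθ' (by positivity) hβ hc hr hcr
      (continuousOn_comp_scale hs hFc)).smul (s : ℂ)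
  -- For scales `x` in this window the vertex is at most `2sc`, the distance parameter `x(c + ρ)` is
  -- at least `(s/2)(c + r)`, and the decay rate is at least `b s / 2`.
  have hnhds : Ioo (s / 2) (2 * s) ∈ 𝓝 s := Ioo_mem_nhds (by linarith) (by linarith)
  have hlow : (s / 2) * (c + r) > 0 := by positivity
  have hray : ∀ φ, |φ| = θ →
      (∀ {s : ℝ}, 0 < s → IntegrableOn (fun ρ : ℝ => (s : ℂ) • F (s * (c + ρ * dir φ))) (Ioi r)) →
      HasDerivAt (fun s : ℝ => ∫ ρ in Ioi r, dir φ • (s : ℂ) • F (s * (c + ρ * dir φ)))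
        (∫ ρ in Ioi r, dir φ • (F (s * (c + ρ * dir φ)) +
          s * (c + ρ * dir φ) * F' (s * (c + ρ * dir φ)))) s := by
    intro φ hφ hint
    obtain ⟨C, b, hC, hb, h⟩ := hD.exists_ray_bound hA hθ hθ' hτ hβ (2 * s * c)
    refine (hasDerivAt_integral_of_dominated_loc_of_deriv_le (μ := volume.restrict (Ioi r))
      (F := fun (s : ℝ) (ρ : ℝ) => dir φ • (s : ℂ) • F (s * (c + ρ * dir φ)))
      (F' := fun (s : ℝ) (ρ : ℝ) => dir φ • (F (s * (c + ρ * dir φ)) +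
          s * (c + ρ * dir φ) * F' (s * (c + ρ * dir φ))))
      (bound := fun ρ => C * ((s / 2) * (c + r)) ^ (-β) * Real.exp (-(b * (s / 2)) * ρ))
      hnhds ?_ ((hint hs).smul (dir φ)) ?_ ?_ ?_ ?_).2
    · filter_upwards [hnhds] with x hx
      exact ((hint (by linarith [hx.1])).smul (dir φ)).1
    · exact ((continuousOn_comp_ray hDs hθ hθ' hc hr hφ.le).aestronglyMeasurable
        measurableSet_Ioi).const_smul (dir φ)
    · filter_upwards [ae_restrict_mem measurableSet_Ioi] with ρ hρ x hx
      rw [mem_Ioi] at hρ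
      have hx0 : 0 < x := by linarith [hx.1]
      have e : (x : ℂ) * (c + ρ * dir φ) = (x * c : ℝ) + (x * ρ : ℝ) * dir φ := by
        push_cast; ring
      rw [norm_smul, norm_dir, one_mul, e]
      refine (h φ (x * c) (x * ρ) hφ (by positivity) (by gcongr; exact hx.2.le)
        (mul_nonneg hx0.le (by linarith)) (by nlinarith)).trans ?_
      have h1 : s / 2 * (c + r) ≤ x * c + x * ρ := by
        rw [← mul_add]
        gcongr
        exact hx.1.le
      gcongr ?_ * ?_
      · gcongr ?_ * ?_
        exact Real.rpow_le_rpow_of_nonpos hlow h1 (by linarith)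
      · refine Real.exp_le_exp.2 ?_
        have : b * (s / 2) * ρ ≤ b * x * ρ := by
          gcongr
          · linarith
          · exact hx.1.le
        linarith
    · exact integrableOn_exp_decay (by positivity) _ r
    · filter_upwards [ae_restrict_mem measurableSet_Ioi] with ρ hρ x hx
      rw [mem_Ioi] at hρ
      exact (hasDerivAt_comp_real_mul (by linarith [hx.1]) (add_mul_dir_mem_sector hθ hθ' hφ.le hc
        (hr.trans hρ.le) (by linarith)) hd).const_smul (dir φ)
  have harc : HasDerivAt (fun s : ℝ => ∫ φ in (-θ)..θ, (Complex.I * (r * dir φ)) •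
      (s : ℂ) • F (s * (c + r * dir φ))) (∫ φ in (-θ)..θ, (Complex.I * (r * dir φ)) •
        (F (s * (c + r * dir φ)) + s * (c + r * dir φ) * F' (s * (c + r * dir φ)))) s := by
    obtain ⟨C, hC, h⟩ := hD.exists_arc_bound hA hθ hθ' hτ hβ (2 * s * (c + r))
    refine (intervalIntegral.hasDerivAt_integral_of_dominated_loc_of_deriv_le (μ := volume)
      (F := fun (s : ℝ) (φ : ℝ) => (Complex.I * (r * dir φ)) • (s : ℂ) • F (s * (c + r * dir φ)))
      (F' := fun (s : ℝ) (φ : ℝ) => (Complex.I * (r * dir φ)) • (F (s * (c + r * dir φ)) +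
          s * (c + r * dir φ) * F' (s * (c + r * dir φ))))
      (bound := fun _ => r * (C * ((s / 2) * (c + r)) ^ (-β)))
      hnhds ?_ (intervalIntegrable_arc (hFs hs)) ?_ ?_ ?_ ?_).2
    · filter_upwards [hnhds] with x hx
      have hx0 : 0 < x := by linarith [hx.1]
      exact (intervalIntegrable_iff.1 (intervalIntegrable_arc (hFs hx0))).1
    · have : ContinuousOn (fun φ : ℝ => (Complex.I * (r * dir φ)) • (F (s * (c + r * dir φ)) +
          s * (c + r * dir φ) * F' (s * (c + r * dir φ)))) (Icc (-θ) θ) :=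
        (continuous_const.mul (continuous_const.mul continuous_dir)).continuousOn.smul
          (continuousOn_comp_arc hDs hθ hθ' hc hr hcr)
      rw [uIoc_of_le (by linarith)]
      exact (this.mono Ioc_subset_Icc_self).aestronglyMeasurable measurableSet_Ioc
    · refine Eventually.of_forall fun φ hφ x hx => ?_
      rw [uIoc_of_le (by linarith)] at hφ
      have hx0 : 0 < x := by linarith [hx.1]
      have e : (x : ℂ) * (c + r * dir φ) = (x * c : ℝ) + (x * r : ℝ) * dir φ := by
        push_cast; ring
      have hn : ‖Complex.I * (r * dir φ)‖ = r := by simp [abs_of_nonneg hr]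
      rw [norm_smul, hn, e]
      have h1 : s / 2 * (c + r) ≤ x * c + x * r := by
        rw [← mul_add]
        gcongr
        exact hx.1.le
      gcongr
      refine (h φ (x * c) (x * r) (abs_le.2 ⟨hφ.1.le, hφ.2⟩) (by positivity) (by positivity)
        (by rw [← mul_add]; gcongr; exact hx.2.le) (hlow.trans_le h1)).trans ?_
      gcongr ?_ * ?_
      exact Real.rpow_le_rpow_of_nonpos hlow h1 (by linarith)
    · exact intervalIntegrable_const
    · refine Eventually.of_forall fun φ hφ x hx => ?_
      rw [uIoc_of_le (by linarith)] at hφ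
      exact (hasDerivAt_comp_real_mul (by linarith [hx.1]) (add_mul_dir_mem_sector hθ hθ'
        (abs_le.2 ⟨hφ.1.le, hφ.2⟩) hc hr hcr) hd).const_smul (Complex.I * (r * dir φ))
  have h1 := hray (-θ) (by rw [abs_neg, abs_of_pos hθ0]) fun hs => (hFs hs).1
  have h2 := hray θ (abs_of_pos hθ0) fun hs => (hFs hs).2.1
  exact (h1.neg.add h2).add harc

/-- This replaces Cauchy's theorem. Rescaling pulls the integral back to a fixed contour, where its
derivative in `s` vanishes. -/
theorem keyAt_scale_eq (hF : ExpBound θ τ β A F)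
    (hD : ExpBound θ τ β A fun μ => F μ + μ * F' μ)
    (hA : 0 ≤ A) (hθ : π / 2 < θ) (hθ' : θ < π) (hτ : 0 < τ) (hβ : 0 ≤ β) (hc : 0 ≤ c)
    (hr : 0 ≤ r) (hcr : 0 < c + r) (hd : ∀ μ ∈ sector θ, HasDerivAt F (F' μ) μ)
    (hF' : ContinuousOn F' (sector θ)) (hs : 0 < s) :
    keyAt (s * c) θ (s * r) F = keyAt c θ r F := by
  have hFc : ContinuousOn F (sector θ) := fun μ hμ => (hd μ hμ).continuousAt.continuousWithinAt
  have hDc : ContinuousOn (fun μ => F μ + μ * F' μ) (sector θ) :=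
    hFc.add (continuousOn_id.mul hF')
  have hder : ∀ s ∈ Ioi (0 : ℝ),
      HasDerivAt (fun s : ℝ => keyAt c θ r fun μ => (s : ℂ) • F (s * μ)) 0 s := by
    intro s hs
    rw [mem_Ioi] at hs
    convert! hasDerivAt_keyAt_scale hF hD hA hθ hθ' hτ hβ hc hr hcr hd hF' hs using 1
    -- The `s`-derivative of `s F(s μ)` is also the `μ`-derivative of `μ F(s μ)`, so its contour
    -- integral is a difference of boundary values at infinity, both zero.
    refine (keyAt_deriv_eq_zero (G := fun μ => μ * F (s * μ)) hθ hθ' hc hr hcr (fun μ hμ => ?_)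
      ((hD.scale hA hs).keyIntAt (by positivity) hθ hθ' (by positivity) hβ hc hr hcr
        (continuousOn_comp_scale hs hDc))
      fun φ hφ => tendsto_mul_ray (hF.scale hA hs) (by positivity) hθ hθ' (by positivity) hβ hc
        hφ).symm
    have h1 : HasDerivAt (fun z : ℂ => (s : ℂ) * z) (s * 1) μ := (hasDerivAt_id _).const_mul _
    convert! (hasDerivAt_id μ).mul ((hd _ (smul_mem_sector hs hμ)).comp μ h1) using 1
    simp only [id, Function.comp_apply]
    ring
  have hconst := isOpen_Ioi.exists_is_const_of_deriv_eq_zero (convex_Ioi (0 : ℝ)).isPreconnected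
    (fun s hs => (hder s hs).differentiableAt.differentiableWithinAt)
    (fun s hs => (hder s hs).deriv)
  obtain ⟨a, ha⟩ := hconst
  have h1 := ha 1 (mem_Ioi.2 one_pos)
  simp only [Complex.ofReal_one, one_smul, one_mul] at h1
  rw [keyAt_scale hs, h1, ha s hs]

/-- The condition `β < 1` is used twice: `ρ^{-β}` is integrable at `0` along the rays, and the arc
contributes `O(s^{1-β})`. -/
theorem tendsto_keyAt_scale (hF : ExpBound θ τ β A F)
    (hA : 0 ≤ A) (hθ : π / 2 < θ) (hθ' : θ < π) (hτ : 0 < τ) (hβ : 0 ≤ β) (hβ' : β < 1)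
    (hc : 0 ≤ c) (hr : 0 ≤ r) (hcr : 0 < c + r) (hFc : ContinuousOn F (sector θ))
    (hFc' : ∀ μ ∈ sector θ, ContinuousAt F μ) :
    Tendsto (fun s => keyAt (s * c) θ (s * r) F) (𝓝[>] 0) (𝓝 (raysIntegral 0 θ 0 F)) := by
  have hθ0 : 0 < θ := by linarith [pi_pos]
  have hs1 : ∀ᶠ s : ℝ in 𝓝[>] 0, s ∈ Ioc (0 : ℝ) 1 := Ioc_mem_nhdsGT one_pos
  have hray : ∀ φ, |φ| = θ →
      Tendsto (fun s : ℝ => ∫ ρ in Ioi (s * r), dir φ • F ((s * c : ℝ) + ρ * dir φ)) (𝓝[>] 0)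
        (𝓝 (∫ ρ in Ioi (0 : ℝ), dir φ • F ((0 : ℝ) + ρ * dir φ))) := by
    intro φ hφ
    obtain ⟨C, b, hC, hb, h⟩ := hF.exists_ray_bound hA hθ hθ' hτ hβ c
    -- Indicators move the `s`-dependent domain to the fixed half-line, as dominated convergence
    -- requires.
    have heq : ∀ᶠ s : ℝ in 𝓝[>] 0,
        ∫ ρ in Ioi 0, (Ioi (s * r)).indicator (fun ρ : ℝ => dir φ • F ((s * c : ℝ) + ρ * dir φ)) ρ =
          ∫ ρ in Ioi (s * r), dir φ • F ((s * c : ℝ) + ρ * dir φ) := by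
      filter_upwards [hs1] with s hs
      rw [setIntegral_indicator measurableSet_Ioi, Ioi_inter_Ioi,
        sup_of_le_right (mul_nonneg hs.1.le hr)]
    refine Tendsto.congr' heq ?_
    refine tendsto_integral_filter_of_dominated_convergence
      (fun ρ => C * (ρ ^ (-β) * Real.exp (-b * ρ ^ (1 : ℝ)))) ?_ ?_ ?_ ?_
    · filter_upwards [hs1] with s hs
      refine AEStronglyMeasurable.indicator ?_ measurableSet_Ioi
      exact ((continuousOn_comp_ray hFc hθ hθ' (mul_nonneg hs.1.le hc) le_rfl
        hφ.le).aestronglyMeasurable measurableSet_Ioi).const_smul (dir φ)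
    · filter_upwards [hs1] with s hs
      filter_upwards [ae_restrict_mem measurableSet_Ioi] with ρ hρ
      rw [mem_Ioi] at hρ
      have hsc : 0 ≤ s * c := mul_nonneg hs.1.le hc
      refine (norm_indicator_le_norm_self _ _).trans ?_
      rw [norm_smul, norm_dir, one_mul]
      refine (h φ (s * c) ρ hφ hsc (mul_le_of_le_one_left hc hs.2) hρ.le
        (by linarith)).trans ?_
      rw [Real.rpow_one, ← mul_assoc]
      gcongr ?_ * _
      gcongr ?_ * ?_
      exact Real.rpow_le_rpow_of_nonpos hρ (by linarith) (by linarith)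
    · exact (integrableOn_rpow_mul_exp_neg_mul_rpow (by linarith) one_pos hb).const_mul C
    · filter_upwards [ae_restrict_mem measurableSet_Ioi] with ρ hρ
      rw [mem_Ioi] at hρ
      have hpt := add_mul_dir_mem_sector hθ hθ' hφ.le le_rfl hρ.le (by linarith)
      have ht1 : Tendsto (fun s : ℝ => dir φ • F ((s * c : ℝ) + ρ * dir φ)) (𝓝[>] 0)
          (𝓝 (dir φ • F ((0 : ℝ) + ρ * dir φ))) := by
        have h1 : Tendsto (fun s : ℝ => ((s * c : ℝ) : ℂ) + ρ * dir φ) (𝓝[>] 0)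
            (𝓝 ((0 : ℝ) + ρ * dir φ)) := by
          have : Continuous fun s : ℝ => ((s * c : ℝ) : ℂ) + ρ * dir φ := by fun_prop
          have h2 := (this.tendsto 0).mono_left (nhdsWithin_le_nhds (s := Ioi 0))
          rwa [zero_mul] at h2
        exact ((hFc' _ hpt).tendsto.comp h1).const_smul (dir φ)
      refine ht1.congr' ?_
      have hsr : ∀ᶠ s : ℝ in 𝓝[>] 0, s * r < ρ := by
        have : Continuous fun s : ℝ => s * r := by fun_prop
        have h2 := (this.tendsto 0).mono_left (nhdsWithin_le_nhds (s := Ioi 0))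
        rw [zero_mul] at h2
        exact h2.eventually (gt_mem_nhds hρ)
      filter_upwards [hsr] with s hs
      rw [indicator_of_mem (mem_Ioi.2 hs)]
  have harc : Tendsto (fun s : ℝ => ∫ φ in (-θ)..θ, (Complex.I * ((s * r : ℝ) * dir φ)) •
      F ((s * c : ℝ) + (s * r : ℝ) * dir φ)) (𝓝[>] 0) (𝓝 0) := by
    obtain ⟨C, hC, h⟩ := hF.exists_arc_bound hA hθ hθ' hτ hβ (c + r)
    have hlim : Tendsto (fun s : ℝ => r * C * (c + r) ^ (-β) * |θ - -θ| * s ^ (1 - β)) (𝓝[>] 0)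
        (𝓝 0) := by
      have h1 : Tendsto (fun s : ℝ => s ^ (1 - β)) (𝓝[>] 0) (𝓝 0) := by
        have h2 := (Real.continuousAt_rpow_const 0 (1 - β) (Or.inr (by linarith))).tendsto
        rw [Real.zero_rpow (by linarith)] at h2
        exact h2.mono_left nhdsWithin_le_nhds
      simpa using h1.const_mul (r * C * (c + r) ^ (-β) * |θ - -θ|)
    refine squeeze_zero_norm' ?_ hlim
    filter_upwards [hs1] with s hs
    have hb : ∀ φ ∈ uIoc (-θ) θ, ‖(Complex.I * ((s * r : ℝ) * dir φ)) •
        F ((s * c : ℝ) + (s * r : ℝ) * dir φ)‖ ≤ r * C * (c + r) ^ (-β) * s ^ (1 - β) := by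
      intro φ hφ
      rw [uIoc_of_le (by linarith)] at hφ
      have hn : ‖Complex.I * ((s * r : ℝ) * dir φ)‖ = s * r := by
        simp [abs_of_nonneg hr, abs_of_pos hs.1]
      rw [norm_smul, hn]
      have h1 := h φ (s * c) (s * r) (abs_le.2 ⟨hφ.1.le, hφ.2⟩) (mul_nonneg hs.1.le hc)
        (mul_nonneg hs.1.le hr) (by rw [← mul_add]; exact mul_le_of_le_one_left hcr.le hs.2)
        (by rw [← mul_add]; exact mul_pos hs.1 hcr)
      rw [← mul_add, Real.mul_rpow hs.1.le hcr.le] at h1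
      calc s * r * ‖F ((s * c : ℝ) + (s * r : ℝ) * dir φ)‖
          ≤ s * r * (C * (s ^ (-β) * (c + r) ^ (-β))) :=
            mul_le_mul_of_nonneg_left h1 (mul_nonneg hs.1.le hr)
        _ = r * C * (c + r) ^ (-β) * (s ^ (1 : ℝ) * s ^ (-β)) := by rw [Real.rpow_one]; ring
        _ = _ := by rw [← Real.rpow_add hs.1, ← sub_eq_add_neg]
    refine (intervalIntegral.norm_integral_le_of_norm_le_const hb).trans (le_of_eq ?_)
    ring
  have h1 := hray (-θ) (by rw [abs_neg, abs_of_pos hθ0])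
  have h2 := hray θ (abs_of_pos hθ0)
  have h3 := (h1.neg.add h2).add harc
  rw [add_zero] at h3
  exact h3

/-- The contour `c + Γ(θ, r)` may be collapsed to the two half-lines starting at `0`. -/
theorem keyAt_eq_raysIntegral (hF : ExpBound θ τ β A F)
    (hD : ExpBound θ τ β A fun μ => F μ + μ * F' μ)
    (hA : 0 ≤ A) (hθ : π / 2 < θ) (hθ' : θ < π) (hτ : 0 < τ) (hβ : 0 ≤ β) (hβ' : β < 1)
    (hc : 0 ≤ c) (hr : 0 ≤ r) (hcr : 0 < c + r) (hd : ∀ μ ∈ sector θ, HasDerivAt F (F' μ) μ)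
    (hF' : ContinuousOn F' (sector θ)) :
    keyAt c θ r F = raysIntegral 0 θ 0 F := by
  have h := tendsto_keyAt_scale hF hA hθ hθ' hτ hβ hβ' hc hr hcr
    (fun μ hμ => (hd μ hμ).continuousAt.continuousWithinAt) fun μ hμ => (hd μ hμ).continuousAt
  refine tendsto_nhds_unique (Tendsto.congr' ?_ tendsto_const_nhds) h
  filter_upwards [self_mem_nhdsWithin] with s hs
  exact (keyAt_scale_eq hF hD hA hθ hθ' hτ hβ hc hr hcr hd hF' hs).symm

end Collapse

/-! ### The Gamma integral with complex rate. -/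

section ComplexGammaIntegral

variable {a : ℝ} {z : ℂ}

theorem norm_rpow_mul_cexp (a : ℝ) (z : ℂ) {t : ℝ} (ht : 0 < t) :
    ‖((t ^ a : ℝ) : ℂ) * Complex.exp (-(z * t))‖ = t ^ a * Real.exp (-z.re * t ^ (1 : ℝ)) := by
  rw [norm_mul, Complex.norm_real, Real.norm_of_nonneg (Real.rpow_nonneg ht.le a),
    Complex.norm_exp]
  simp

theorem continuousOn_rpow_mul_cexp (a : ℝ) (z : ℂ) :
    ContinuousOn (fun t : ℝ => ((t ^ a : ℝ) : ℂ) * Complex.exp (-(z * t))) (Ioi 0) :=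
  (Complex.continuous_ofReal.comp_continuousOn (continuousOn_id.rpow_const
    fun t ht => Or.inl (ne_of_gt ht))).mul (by fun_prop)

theorem integrableOn_rpow_mul_cexp (ha : -1 < a) (hz : 0 < z.re) :
    IntegrableOn (fun t : ℝ => ((t ^ a : ℝ) : ℂ) * Complex.exp (-(z * t))) (Ioi 0) := by
  refine (integrableOn_rpow_mul_exp_neg_mul_rpow ha one_pos hz).mono'
    ((continuousOn_rpow_mul_cexp a z).aestronglyMeasurable measurableSet_Ioi) ?_
  filter_upwards [ae_restrict_mem measurableSet_Ioi] with t ht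
  rw [norm_rpow_mul_cexp a z ht]

theorem hasDerivAt_integral_rpow_mul_cexp (ha : -1 < a) (hz : 0 < z.re) :
    HasDerivAt (fun z : ℂ => ∫ t in Ioi (0 : ℝ), ((t ^ a : ℝ) : ℂ) * Complex.exp (-(z * t)))
      (-∫ t in Ioi (0 : ℝ), ((t ^ (a + 1) : ℝ) : ℂ) * Complex.exp (-(z * t))) z := by
  have hs : {w : ℂ | z.re / 2 < w.re} ∈ 𝓝 z :=
    (isOpen_lt continuous_const Complex.continuous_re).mem_nhds (by simpa using hz)
  have h := (hasDerivAt_integral_of_dominated_loc_of_deriv_le (μ := volume.restrict (Ioi (0 : ℝ)))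
    (F := fun (z : ℂ) (t : ℝ) => ((t ^ a : ℝ) : ℂ) * Complex.exp (-(z * t)))
    (F' := fun (z : ℂ) (t : ℝ) => -(((t ^ (a + 1) : ℝ) : ℂ) * Complex.exp (-(z * t))))
    (bound := fun t => t ^ (a + 1) * Real.exp (-(z.re / 2) * t ^ (1 : ℝ))) (x₀ := z) hs
    (Eventually.of_forall fun w =>
      (continuousOn_rpow_mul_cexp a w).aestronglyMeasurable measurableSet_Ioi)
    (integrableOn_rpow_mul_cexp ha hz)
    ((continuousOn_rpow_mul_cexp (a + 1) z).aestronglyMeasurable measurableSet_Ioi).neg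
    ?_ (integrableOn_rpow_mul_exp_neg_mul_rpow (by linarith) one_pos (by linarith)) ?_).2
  · rwa [integral_neg] at h
  · filter_upwards [ae_restrict_mem measurableSet_Ioi] with t ht w hw
    rw [mem_Ioi] at ht
    rw [norm_neg, norm_rpow_mul_cexp (a + 1) w ht]
    have h1 : 0 ≤ t ^ (a + 1) := Real.rpow_nonneg ht.le _
    gcongr
  · filter_upwards [ae_restrict_mem measurableSet_Ioi] with t ht w _
    rw [mem_Ioi] at ht
    have h1 : HasDerivAt (fun z : ℂ => Complex.exp (-(z * t)))
        (Complex.exp (-(w * t)) * (-(1 * t))) w := (((hasDerivAt_id w).mul_const (t : ℂ)).neg).cexp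
    convert! h1.const_mul ((t ^ a : ℝ) : ℂ) using 1
    rw [Real.rpow_add_one ht.ne']
    push_cast
    ring

/-- Integration by parts: `t^{a+1} e^{-zt}` vanishes at both ends of the half-line. -/
theorem mul_integral_rpow_mul_cexp (ha : -1 < a) (hz : 0 < z.re) :
    z * ∫ t in Ioi (0 : ℝ), ((t ^ (a + 1) : ℝ) : ℂ) * Complex.exp (-(z * t)) =
      (a + 1) * ∫ t in Ioi (0 : ℝ), ((t ^ a : ℝ) : ℂ) * Complex.exp (-(z * t)) := by
  have hd : ∀ t ∈ Ioi (0 : ℝ), HasDerivAt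
      (fun t : ℝ => ((t ^ (a + 1) : ℝ) : ℂ) * Complex.exp (-(z * t)))
      ((a + 1) * (((t ^ a : ℝ) : ℂ) * Complex.exp (-(z * t))) -
        z * (((t ^ (a + 1) : ℝ) : ℂ) * Complex.exp (-(z * t)))) t := by
    intro t ht
    rw [mem_Ioi] at ht
    have h1 : HasDerivAt (fun t : ℝ => ((t ^ (a + 1) : ℝ) : ℂ))
        (((a + 1) * t ^ (a + 1 - 1) : ℝ) : ℂ) t :=
      (Real.hasDerivAt_rpow_const (Or.inl ht.ne')).ofReal_comp
    have h2 : HasDerivAt (fun t : ℝ => Complex.exp (-(z * t)))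
        (Complex.exp (-(z * t)) * (-(z * 1))) t := by
      have : HasDerivAt (fun w : ℂ => Complex.exp (-(z * w)))
        (Complex.exp (-(z * t)) * (-(z * 1))) (t : ℂ) :=
          (((hasDerivAt_id (t : ℂ)).const_mul z).neg).cexp
      exact this.comp_ofReal
    convert! h1.mul h2 using 1
    rw [add_sub_cancel_right]
    push_cast
    ring
  have hi1 := integrableOn_rpow_mul_cexp ha hz
  have hi2 := integrableOn_rpow_mul_cexp (a := a + 1) (by linarith) hz
  have hcont : ContinuousWithinAt
      (fun t : ℝ => ((t ^ (a + 1) : ℝ) : ℂ) * Complex.exp (-(z * t))) (Ici 0) 0 := by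
    have h1 : ContinuousAt (fun t : ℝ => t ^ (a + 1)) 0 :=
      Real.continuousAt_rpow_const _ _ (Or.inr (by linarith))
    have h2 : ContinuousAt (fun t : ℝ => Complex.exp (-(z * t))) 0 := by fun_prop
    exact ((Complex.continuous_ofReal.continuousAt.comp h1).mul h2).continuousWithinAt
  have hint := (hi1.const_mul ((a : ℂ) + 1)).sub (hi2.const_mul z)
  -- Both the function and its derivative are integrable, which forces the limit at infinity to be
  -- zero.
  have hlim := tendsto_zero_of_hasDerivAt_of_integrableOn_Ioi hd hint hi2
  have h := integral_Ioi_of_hasDerivAt_of_tendsto hcont hd hint hlim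
  rw [integral_sub (hi1.const_mul _) (hi2.const_mul z), integral_const_mul, integral_const_mul,
    Real.zero_rpow (by linarith)] at h
  simp only [Complex.ofReal_zero, zero_mul, sub_zero] at h
  exact (sub_eq_zero.1 h).symm

/-- The Gamma integral with a complex rate. -/
theorem integral_rpow_mul_cexp (ha : -1 < a) (hz : 0 < z.re) :
    ∫ t in Ioi (0 : ℝ), ((t ^ a : ℝ) : ℂ) * Complex.exp (-(z * t)) =
      Real.Gamma (a + 1) * z ^ (-(a + 1) : ℂ) := by
  -- The product of `z^{a+1}` with the integral has zero derivative by the preceding integration by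
  -- parts. It is thus constant on the right half-plane, and its value is read off at `z = 1`.
  have hder : ∀ w ∈ {w : ℂ | 0 < w.re}, HasDerivAt (fun z : ℂ => z ^ ((a : ℂ) + 1) *
      ∫ t in Ioi (0 : ℝ), ((t ^ a : ℝ) : ℂ) * Complex.exp (-(z * t))) 0 w := by
    intro w hw
    have hw0 : w ≠ 0 := fun h => by simp [h] at hw
    have h1 : HasDerivAt (fun z : ℂ => z ^ ((a : ℂ) + 1))
        (((a : ℂ) + 1) * w ^ ((a : ℂ) + 1 - 1) * 1) w :=
      (hasDerivAt_id w).cpow_const (Or.inl hw)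
    convert! h1.mul (hasDerivAt_integral_rpow_mul_cexp ha hw) using 1
    have h2 := mul_integral_rpow_mul_cexp ha hw
    rw [add_sub_cancel_right, Complex.cpow_add _ _ hw0, Complex.cpow_one]
    linear_combination (w ^ (a : ℂ)) * h2
  have hopen : IsOpen {w : ℂ | 0 < w.re} := isOpen_lt continuous_const Complex.continuous_re
  obtain ⟨C, hC⟩ := hopen.exists_is_const_of_deriv_eq_zero
    (convex_halfSpace_re_gt 0).isPreconnected
    (fun w hw => (hder w hw).differentiableAt.differentiableWithinAt)
    (fun w hw => (hder w hw).deriv)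
  have h1 := hC 1 (by simp)
  have h2 := Real.integral_rpow_mul_exp_neg_mul_Ioi (a := a + 1) (r := 1) (by linarith) one_pos
  have h3 : ∫ t in Ioi (0 : ℝ), ((t ^ a : ℝ) : ℂ) * Complex.exp (-(1 * t)) =
      Real.Gamma (a + 1) := by
    rw [div_one, Real.one_rpow, one_mul] at h2
    rw [← h2, ← integral_complex_ofReal]
    refine setIntegral_congr_fun measurableSet_Ioi fun t _ => ?_
    simp
  simp only [Complex.one_cpow, one_mul] at h1 h3
  rw [h3] at h1
  have hz0 : z ≠ 0 := fun h => by simp [h] at hz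
  have h4 := hC z hz
  rw [← h1] at h4
  rw [Complex.cpow_neg, ← h4]
  have h5 : z ^ ((a : ℂ) + 1) ≠ 0 := by simp [Complex.cpow_eq_zero_iff, hz0]
  field_simp

end ComplexGammaIntegral

/-! ### Powers on rays and holomorphic symbols of negative order. -/

section Symbols

theorem dir_add (x y : ℝ) : dir (x + y) = dir x * dir y := by
  simp only [dir, ← Complex.exp_add]
  push_cast
  ring_nf

theorem dir_sub_dir_neg (x : ℝ) : dir x - dir (-x) = 2 * Complex.I * Real.sin x := by
  apply Complex.ext <;> simp [dir_re, dir_im, -Complex.ofReal_sin]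
  ring

theorem cpow_ray {ρ φ : ℝ} (b : ℝ) (hρ : 0 < ρ) (hφ : |φ| < π) :
    ((ρ : ℂ) * dir φ) ^ (b : ℂ) = ((ρ ^ b : ℝ) : ℂ) * dir (b * φ) := by
  have h0 : (ρ : ℂ) * dir φ ≠ 0 := by
    simp [hρ.ne', dir]
  have hlog : Complex.log ((ρ : ℂ) * dir φ) = Real.log ρ + φ * Complex.I := by
    rw [abs_lt] at hφ
    rw [Complex.log_ofReal_mul hρ (by simp [dir]), dir, Complex.log_exp (by simpa using hφ.1)
      (by simpa using hφ.2.le)]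
  rw [Complex.cpow_def_of_ne_zero h0, hlog, Real.rpow_def_of_pos hρ, dir, Complex.ofReal_exp,
    ← Complex.exp_add]
  push_cast
  ring_nf

/-- `φ` is holomorphic on the sector, with derivative `φ'`, and is of order `-β`. -/
structure IsSymbol (θ β A : ℝ) (φ φ' : ℂ → ℂ) : Prop where
  hasDerivAt : ∀ μ ∈ sector θ, HasDerivAt φ (φ' μ) μ
  continuousOn_deriv : ContinuousOn φ' (sector θ)
  norm_le : ∀ μ ∈ sector θ, ‖φ μ‖ ≤ A * ‖μ‖ ^ (-β)
  norm_deriv_le : ∀ μ ∈ sector θ, ‖μ * φ' μ‖ ≤ A * ‖μ‖ ^ (-β)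

variable {θ β A τ c r : ℝ} {φ φ' : ℂ → ℂ}

theorem hasDerivAt_cexp_mul (τ : ℝ) (μ : ℂ) :
    HasDerivAt (fun μ : ℂ => Complex.exp (μ * τ)) (τ * Complex.exp (μ * τ)) μ := by
  convert! ((hasDerivAt_id μ).mul_const (τ : ℂ)).cexp using 1
  simp [mul_comm]

theorem norm_cexp_mul (τ : ℝ) (μ : ℂ) : ‖Complex.exp (μ * τ)‖ = Real.exp (τ * μ.re) := by
  rw [Complex.norm_exp, Complex.re_mul_ofReal, mul_comm]

theorem expBound_of_norm_le (hA : 0 ≤ A) (h : ∀ μ ∈ sector θ, ‖φ μ‖ ≤ A * ‖μ‖ ^ (-β)) :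
    ExpBound θ τ β A fun μ => Complex.exp (μ * τ) * φ μ := by
  intro μ hμ
  rw [norm_mul, norm_cexp_mul]
  calc Real.exp (τ * μ.re) * ‖φ μ‖ ≤ Real.exp (τ * μ.re) * (A * ‖μ‖ ^ (-β)) := by
        gcongr
        exact h μ hμ
    _ = A * (1 * Real.exp (τ * μ.re) * ‖μ‖ ^ (-β)) := by ring
    _ ≤ _ := by
        gcongr
        linarith [norm_nonneg μ]

theorem IsSymbol.continuousOn (h : IsSymbol θ β A φ φ') : ContinuousOn φ (sector θ) :=
  fun μ hμ => (h.hasDerivAt μ hμ).continuousAt.continuousWithinAt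

theorem keyIntAt_exp_mul (hA : 0 ≤ A) (hφ : ContinuousOn φ (sector θ))
    (h : ∀ μ ∈ sector θ, ‖φ μ‖ ≤ A * ‖μ‖ ^ (-β)) (hθ : π / 2 < θ) (hθ' : θ < π) (hτ : 0 < τ)
    (hβ : 0 ≤ β) (hc : 0 ≤ c) (hr : 0 ≤ r) (hcr : 0 < c + r) :
    KeyIntAt c θ r fun μ => Complex.exp (μ * τ) * φ μ :=
  (expBound_of_norm_le hA h).keyIntAt hA hθ hθ' hτ hβ hc hr hcr
    ((by fun_prop : Continuous fun μ : ℂ => Complex.exp (μ * τ)).continuousOn.mul hφ)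

/-- For `F = e^{μ τ} φ` one has `F + μ F' = e^{μ τ} (φ + τ μ φ + μ φ')`. The middle term is why
`ExpBound` allows the factor `1 + ‖μ‖`, and it puts `τ` into the constant. -/
theorem IsSymbol.keyAt_eq_raysIntegral (h : IsSymbol θ β A φ φ') (hA : 0 ≤ A) (hθ : π / 2 < θ)
    (hθ' : θ < π) (hτ : 0 < τ) (hβ : 0 ≤ β) (hβ' : β < 1) (hc : 0 ≤ c) (hr : 0 ≤ r)
    (hcr : 0 < c + r) :
    keyAt c θ r (fun μ => Complex.exp (μ * τ) * φ μ) =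
      raysIntegral 0 θ 0 fun μ => Complex.exp (μ * τ) * φ μ := by
  have hexp : Continuous fun μ : ℂ => Complex.exp (μ * τ) := by fun_prop
  have hpos : ∀ μ : ℂ, 0 ≤ ‖μ‖ ^ (-β) := fun μ => Real.rpow_nonneg (norm_nonneg μ) _
  refine FracDeriv.keyAt_eq_raysIntegral (τ := τ) (β := β) (A := A * (2 + τ))
    (F' := fun μ => τ * Complex.exp (μ * τ) * φ μ + Complex.exp (μ * τ) * φ' μ) ?_ ?_
    (by positivity) hθ hθ' hτ hβ hβ' hc hr hcr
    (fun μ hμ => (hasDerivAt_cexp_mul τ μ).mul (h.hasDerivAt μ hμ))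
    ((((continuous_const.mul hexp).continuousOn).mul h.continuousOn).add
      (hexp.continuousOn.mul h.continuousOn_deriv))
  · refine expBound_of_norm_le (by positivity) fun μ hμ => (h.norm_le μ hμ).trans ?_
    gcongr
    nlinarith
  · intro μ hμ
    have e : Complex.exp (μ * τ) * φ μ + μ * (τ * Complex.exp (μ * τ) * φ μ +
        Complex.exp (μ * τ) * φ' μ) = Complex.exp (μ * τ) * (φ μ + τ * μ * φ μ + μ * φ' μ) := by
      ring
    have h1 : ‖φ μ + τ * μ * φ μ + μ * φ' μ‖ ≤ A * (2 + τ) * ((1 + ‖μ‖) * ‖μ‖ ^ (-β)) := by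
      have h2 : ‖(τ : ℂ) * μ * φ μ‖ ≤ τ * ‖μ‖ * (A * ‖μ‖ ^ (-β)) := by
        rw [norm_mul, norm_mul, Complex.norm_real, Real.norm_of_nonneg hτ.le]
        gcongr
        exact h.norm_le μ hμ
      have h3 := norm_add₃_le (a := φ μ) (b := τ * μ * φ μ) (c := μ * φ' μ)
      have h4 := h.norm_le μ hμ
      have h5 := h.norm_deriv_le μ hμ
      have h6 : 0 ≤ A * ‖μ‖ ^ (-β) := mul_nonneg hA (hpos μ)
      have h7 : 0 ≤ (A * ‖μ‖ ^ (-β)) * (2 * ‖μ‖ + τ) := by positivity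
      nlinarith
    simp only [e]
    rw [norm_mul, norm_cexp_mul]
    calc Real.exp (τ * μ.re) * ‖φ μ + τ * μ * φ μ + μ * φ' μ‖
        ≤ Real.exp (τ * μ.re) * (A * (2 + τ) * ((1 + ‖μ‖) * ‖μ‖ ^ (-β))) := by gcongr
      _ = _ := by ring

theorem hasDerivAt_cpow_neg (hθ : π / 2 < θ) (hθ' : θ < π) (β : ℝ) {μ : ℂ} (hμ : μ ∈ sector θ) :
    HasDerivAt (fun μ : ℂ => μ ^ (-(β : ℂ))) (-(β : ℂ) * μ ^ (-((β + 1 : ℝ) : ℂ))) μ := by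
  convert! (hasDerivAt_id μ).cpow_const (c := -(β : ℂ))
    (sector_subset_slitPlane hθ hθ' hμ) using 1
  rw [mul_one]
  congr 2
  push_cast
  ring

theorem norm_cpow_neg (β : ℝ) (μ : ℂ) : ‖μ ^ (-(β : ℂ))‖ = ‖μ‖ ^ (-β) := by
  rw [← Complex.ofReal_neg, Complex.norm_cpow_real]

theorem continuousOn_cpow_neg (hθ : π / 2 < θ) (hθ' : θ < π) (β : ℝ) :
    ContinuousOn (fun μ : ℂ => μ ^ (-(β : ℂ))) (sector θ) := fun _ hμ =>
  (hasDerivAt_cpow_neg hθ hθ' β hμ).continuousAt.continuousWithinAt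

theorem mul_cpow_neg_add_one {μ : ℂ} (hμ : μ ≠ 0) (β : ℝ) :
    μ * μ ^ (-((β + 1 : ℝ) : ℂ)) = μ ^ (-(β : ℂ)) := by
  nth_rewrite 1 [← Complex.cpow_one μ]
  rw [← Complex.cpow_add _ _ hμ]
  congr 1
  push_cast
  ring

theorem isSymbol_cpow_neg (hθ : π / 2 < θ) (hθ' : θ < π) (hβ : 0 ≤ β) :
    IsSymbol θ β (1 + β) (fun μ : ℂ => μ ^ (-(β : ℂ)))
      fun μ => -(β : ℂ) * μ ^ (-((β + 1 : ℝ) : ℂ)) where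
  hasDerivAt _ hμ := hasDerivAt_cpow_neg hθ hθ' β hμ
  continuousOn_deriv := continuousOn_const.mul (continuousOn_cpow_neg hθ hθ' (β + 1))
  norm_le μ _ := by
    rw [norm_cpow_neg]
    nlinarith [Real.rpow_nonneg (norm_nonneg μ) (-β)]
  norm_deriv_le μ hμ := by
    rw [mul_left_comm, mul_cpow_neg_add_one hμ.1, norm_mul, norm_cpow_neg, norm_neg,
      Complex.norm_real, Real.norm_of_nonneg hβ]
    nlinarith [Real.rpow_nonneg (norm_nonneg μ) (-β)]

end Symbols

/-! ### Hankel's integral for `τ^{β-1} / Γ(β)`. -/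

section Hankel

variable {θ β τ c r : ℝ}

/-- The angle `ψ` stands for `φ ± π`, chosen so that `τ e^{iψ} = -τ e^{iφ}` has positive real part
and principal argument `ψ`. The Gamma integral then applies with this rate. -/
theorem integral_ray_exp_mul_cpow {φ ψ : ℝ} (hφ : |φ| < π) (hψ : |ψ| < π) (hφψ : -dir φ = dir ψ)
    (hcos : Real.cos φ < 0) (hβ : β < 1) (hτ : 0 < τ) :
    ∫ ρ in Ioi (0 : ℝ), dir φ • (Complex.exp (((0 : ℂ) + ρ * dir φ) * τ) *
        ((0 : ℂ) + ρ * dir φ) ^ (-(β : ℂ))) =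
      Real.Gamma (1 - β) * ((τ ^ (β - 1) : ℝ) : ℂ) * dir ((1 - β) * (φ - ψ)) := by
  have hz : 0 < ((τ : ℂ) * dir ψ).re := by
    rw [← hφψ, Complex.re_ofReal_mul, Complex.neg_re, dir_re]
    exact mul_pos hτ (by linarith)
  have h1 : ∫ ρ in Ioi (0 : ℝ), dir φ • (Complex.exp (((0 : ℂ) + ρ * dir φ) * τ) *
        ((0 : ℂ) + ρ * dir φ) ^ (-(β : ℂ))) =
      ∫ ρ in Ioi (0 : ℝ), dir φ * dir (-β * φ) *
        (((ρ ^ (-β) : ℝ) : ℂ) * Complex.exp (-(((τ : ℂ) * dir ψ) * ρ))) := by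
    refine setIntegral_congr_fun measurableSet_Ioi fun ρ hρ => ?_
    simp only [zero_add, smul_eq_mul]
    rw [← Complex.ofReal_neg, cpow_ray (-β) hρ hφ, ← hφψ]
    ring_nf
  rw [h1, integral_const_mul, integral_rpow_mul_cexp (by linarith) hz]
  have h2 : (-(((-β : ℝ) : ℂ) + 1)) = ((β - 1 : ℝ) : ℂ) := by push_cast; ring
  rw [h2, cpow_ray (β - 1) hτ hψ, neg_add_eq_sub, ← dir_add]
  have h3 : dir ((1 - β) * (φ - ψ)) = dir (φ + -β * φ) * dir ((β - 1) * ψ) := by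
    rw [← dir_add]
    congr 1
    ring
  rw [h3]
  ring

/-- The two rays differ only in their phases `e^{± i(1-β)π}`. Their difference is `2i sin(πβ)`, and
the reflection formula turns `Γ(1-β) sin(πβ)` into `π / Γ(β)`. -/
theorem raysIntegral_exp_mul_cpow (hθ : π / 2 < θ) (hθ' : θ < π) (hβ : 0 < β) (hβ' : β < 1)
    (hτ : 0 < τ) :
    raysIntegral 0 θ 0 (fun μ : ℂ => Complex.exp (μ * τ) * μ ^ (-(β : ℂ))) =
      2 * π * Complex.I * fracKernel β τ := by
  have hπ : dir π = -1 := by simp [dir]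
  have hπ' : dir (-π) = -1 := by
    apply Complex.ext <;> simp [dir_re, dir_im]
  have hcos := Real.cos_neg_of_pi_div_two_lt_of_lt hθ (by linarith)
  have h1 := integral_ray_exp_mul_cpow (φ := θ) (ψ := θ + -π) (β := β) (τ := τ)
    (by rw [abs_of_pos (by linarith [pi_pos])]; exact hθ')
    (by rw [abs_lt]; constructor <;> linarith) (by rw [dir_add, hπ']; ring) hcos hβ' hτ
  have h2 := integral_ray_exp_mul_cpow (φ := -θ) (ψ := -θ + π) (β := β) (τ := τ)
    (by rw [abs_neg, abs_of_pos (by linarith [pi_pos])]; exact hθ')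
    (by rw [abs_lt]; constructor <;> linarith) (by rw [dir_add, hπ]; ring)
    (by rwa [Real.cos_neg]) hβ' hτ
  rw [raysIntegral, h1, h2]
  have e1 : (1 - β) * (θ - (θ + -π)) = (1 - β) * π := by ring
  have e2 : (1 - β) * (-θ - (-θ + π)) = -((1 - β) * π) := by ring
  have hs : Real.sin ((1 - β) * π) = Real.sin (π * β) := by
    rw [sub_mul, one_mul, Real.sin_pi_sub, mul_comm]
  have hG := Real.Gamma_mul_Gamma_one_sub β
  have hsin : Real.sin (π * β) ≠ 0 :=
    (Real.sin_pos_of_pos_of_lt_pi (by positivity) (by nlinarith [pi_pos])).ne'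
  have hG0 := (Real.Gamma_pos_of_pos hβ).ne'
  have hG1 : Real.Gamma (1 - β) * Real.sin (π * β) = π / Real.Gamma β := by
    rw [eq_div_iff hsin] at hG
    rw [eq_div_iff hG0]
    linear_combination hG
  rw [e1, e2, fracKernel]
  have hd := dir_sub_dir_neg ((1 - β) * π)
  rw [hs] at hd
  have hG2 : (Real.Gamma (1 - β) : ℂ) * Real.sin (π * β) = π / Real.Gamma β := by
    exact_mod_cast hG1
  calc -((Real.Gamma (1 - β) : ℂ) * (τ ^ (β - 1) : ℝ) * dir (-((1 - β) * π))) +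
        Real.Gamma (1 - β) * (τ ^ (β - 1) : ℝ) * dir ((1 - β) * π)
      = (Real.Gamma (1 - β) : ℂ) * (τ ^ (β - 1) : ℝ) *
          (dir ((1 - β) * π) - dir (-((1 - β) * π))) := by ring
    _ = 2 * Complex.I * (τ ^ (β - 1) : ℝ) * ((Real.Gamma (1 - β) : ℂ) * Real.sin (π * β)) := by
        rw [hd]; ring
    _ = _ := by rw [hG2]; push_cast; ring

/-- Dominated convergence along the contour. -/
theorem tendsto_keyAt {ι : Type*} {l : Filter ι} [l.IsCountablyGenerated] {F : ι → ℂ → ℂ}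
    {F₀ : ℂ → ℂ} {A : ℝ} (hA : 0 ≤ A) (hθ : π / 2 < θ) (hθ' : θ < π) (hτ : 0 < τ) (hβ : 0 ≤ β)
    (hc : 0 ≤ c) (hr : 0 ≤ r) (hcr : 0 < c + r) (hF : ∀ᶠ n in l, ExpBound θ τ β A (F n))
    (hFc : ∀ᶠ n in l, ContinuousOn (F n) (sector θ))
    (hlim : ∀ μ ∈ sector θ, Tendsto (fun n => F n μ) l (𝓝 (F₀ μ))) :
    Tendsto (fun n => keyAt c θ r (F n)) l (𝓝 (keyAt c θ r F₀)) := by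
  have hθ0 : 0 < θ := by linarith [pi_pos]
  set D : ℂ → ℝ := fun μ => A * ((1 + ‖μ‖) * Real.exp (τ * μ.re) * ‖μ‖ ^ (-β)) with hD
  have hDc : ContinuousOn D (sector θ) := by
    refine continuousOn_const.mul (ContinuousOn.mul (by fun_prop) ?_)
    exact continuous_norm.continuousOn.rpow_const fun μ hμ => Or.inl (norm_ne_zero_iff.2 hμ.1)
  have hDi : KeyIntAt c θ r fun μ => (D μ : ℂ) := by
    refine ExpBound.keyIntAt (τ := τ) (β := β) (A := A) (fun μ _ => ?_) hA hθ hθ' hτ hβ hc hr hcr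
      (Complex.continuous_ofReal.comp_continuousOn hDc)
    rw [Complex.norm_real, Real.norm_of_nonneg (by positivity)]
  have hray : ∀ φ, |φ| = θ → IntegrableOn (fun ρ : ℝ => (D (c + ρ * dir φ) : ℂ)) (Ioi r) →
      Tendsto (fun n => ∫ ρ in Ioi r, dir φ • F n (c + ρ * dir φ)) l
        (𝓝 (∫ ρ in Ioi r, dir φ • F₀ (c + ρ * dir φ))) := by
    intro φ hφ hi
    refine tendsto_integral_filter_of_dominated_convergence _ ?_ ?_ hi.norm ?_
    · filter_upwards [hFc] with n hn
      exact ((continuousOn_comp_ray hn hθ hθ' hc hr hφ.le).aestronglyMeasurable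
        measurableSet_Ioi).const_smul (dir φ)
    · filter_upwards [hF] with n hn
      filter_upwards [ae_restrict_mem measurableSet_Ioi] with ρ hρ
      rw [mem_Ioi] at hρ
      rw [norm_smul, norm_dir, one_mul, Complex.norm_real]
      exact (hn _ (add_mul_dir_mem_sector hθ hθ' hφ.le hc (hr.trans hρ.le)
        (by linarith))).trans (le_abs_self _)
    · filter_upwards [ae_restrict_mem measurableSet_Ioi] with ρ hρ
      rw [mem_Ioi] at hρ
      exact (hlim _ (add_mul_dir_mem_sector hθ hθ' hφ.le hc (hr.trans hρ.le)
        (by linarith))).const_smul (dir φ)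
  have harc : Tendsto (fun n => ∫ φ in (-θ)..θ, (Complex.I * (r * dir φ)) • F n (c + r * dir φ)) l
      (𝓝 (∫ φ in (-θ)..θ, (Complex.I * (r * dir φ)) • F₀ (c + r * dir φ))) := by
    have hmem : ∀ φ ∈ uIoc (-θ) θ, (c : ℂ) + r * dir φ ∈ sector θ := fun φ hφ => by
      rw [uIoc_of_le (by linarith)] at hφ
      exact add_mul_dir_mem_sector hθ hθ' (abs_le.2 ⟨hφ.1.le, hφ.2⟩) hc hr hcr
    refine intervalIntegral.tendsto_integral_filter_of_dominated_convergence _ ?_ ?_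
      (intervalIntegrable_arc hDi).norm ?_
    · filter_upwards [hFc] with n hn
      have : ContinuousOn (fun φ : ℝ => (Complex.I * (r * dir φ)) • F n (c + r * dir φ))
          (Icc (-θ) θ) :=
        (continuous_const.mul (continuous_const.mul continuous_dir)).continuousOn.smul
          (continuousOn_comp_arc hn hθ hθ' hc hr hcr)
      rw [uIoc_of_le (by linarith)]
      exact (this.mono Ioc_subset_Icc_self).aestronglyMeasurable measurableSet_Ioc
    · filter_upwards [hF] with n hn
      refine Eventually.of_forall fun φ hφ => ?_
      rw [norm_smul, norm_smul, Complex.norm_real]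
      gcongr
      exact (hn _ (hmem φ hφ)).trans (le_abs_self _)
    · exact Eventually.of_forall fun φ hφ => (hlim _ (hmem φ hφ)).const_smul _
  exact ((hray (-θ) (by rw [abs_neg, abs_of_pos hθ0]) hDi.1).neg.add
    (hray θ (abs_of_pos hθ0) hDi.2.1)).add harc

/-- Hankel's formula for the reciprocal of the Gamma function. -/
theorem keyAt_exp_mul_cpow (hθ : π / 2 < θ) (hθ' : θ < π) (hτ : 0 < τ) (hc : 0 ≤ c) (hr : 0 ≤ r)
    (hcr : 0 < c + r) (hβ : 0 < β) :
    keyAt c θ r (fun μ : ℂ => Complex.exp (μ * τ) * μ ^ (-(β : ℂ))) =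
      2 * π * Complex.I * fracKernel β τ := by
  have hlt : ∀ β : ℝ, 0 < β → β < 1 →
      keyAt c θ r (fun μ : ℂ => Complex.exp (μ * τ) * μ ^ (-(β : ℂ))) =
        2 * π * Complex.I * fracKernel β τ := fun β hβ hβ' => by
    rw [(isSymbol_cpow_neg hθ hθ' hβ.le).keyAt_eq_raysIntegral (by linarith) hθ hθ' hτ hβ.le hβ'
      hc hr hcr, raysIntegral_exp_mul_cpow hθ hθ' hβ hβ' hτ]
  -- Collapsing the contour onto the origin requires `β < 1`, so the value at `β = 1` is obtained as
  -- a limit from below on the fixed contour.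
  have hone : keyAt c θ r (fun μ : ℂ => Complex.exp (μ * τ) * μ ^ (-((1 : ℝ) : ℂ))) =
      2 * π * Complex.I * fracKernel 1 τ := by
    have hev : ∀ᶠ β : ℝ in 𝓝[<] 1, β ∈ Ioo (0 : ℝ) 1 := Ioo_mem_nhdsLT one_pos
    have h1 : Tendsto (fun β : ℝ => keyAt c θ r
        (fun μ : ℂ => Complex.exp (μ * τ) * μ ^ (-(β : ℂ)))) (𝓝[<] 1)
        (𝓝 (keyAt c θ r (fun μ : ℂ => Complex.exp (μ * τ) * μ ^ (-((1 : ℝ) : ℂ))))) := by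
      -- For `0 < β < 1`, `‖μ‖^{1-β} ≤ 1 + ‖μ‖`, so all integrands obey one bound with exponent `1`;
      -- the slack factor `1 + ‖μ‖` pays for it.
      refine tendsto_keyAt (β := 1) (A := 1) zero_le_one hθ hθ' hτ zero_le_one hc hr hcr ?_ ?_ ?_
      · filter_upwards [hev] with β hβ μ hμ
        have hn : 0 < ‖μ‖ := norm_pos_iff.2 hμ.1
        have h2 : ‖μ‖ ^ (1 - β) ≤ 1 + ‖μ‖ := by
          rcases le_total ‖μ‖ 1 with h | h
          · have := Real.rpow_le_one hn.le h (by linarith [hβ.2] : 0 ≤ 1 - β)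
            linarith
          · have := Real.rpow_le_rpow_of_exponent_le h (by linarith [hβ.1] : 1 - β ≤ 1)
            rw [Real.rpow_one] at this
            linarith
        have h3 : ‖μ‖ ^ (-β) = ‖μ‖ ^ (1 - β) * ‖μ‖ ^ (-1 : ℝ) := by
          rw [← Real.rpow_add hn]
          congr 1
          ring
        rw [norm_mul, norm_cexp_mul, norm_cpow_neg, h3, one_mul, mul_comm (1 + ‖μ‖), mul_assoc]
        gcongr
      · filter_upwards with β
        exact (by fun_prop : Continuous fun μ : ℂ => Complex.exp (μ * τ)).continuousOn.mul
          (continuousOn_cpow_neg hθ hθ' β)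
      · intro μ hμ
        have h2 : ContinuousAt (fun β : ℝ => μ ^ (-(β : ℂ))) 1 :=
          ContinuousAt.const_cpow (by fun_prop) (Or.inl hμ.1)
        exact (h2.tendsto.mono_left nhdsWithin_le_nhds).const_mul _
    have h2 : Tendsto (fun β : ℝ => 2 * π * Complex.I * fracKernel β τ) (𝓝[<] 1)
        (𝓝 (2 * π * Complex.I * fracKernel 1 τ)) := by
      have h3 : ContinuousAt (fun β : ℝ => τ ^ (β - 1) / Real.Gamma β) 1 := by
        refine ContinuousAt.div ?_ ?_ (by simp)
        · exact ContinuousAt.rpow continuousAt_const (by fun_prop) (Or.inl hτ.ne')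
        · exact (Real.differentiableAt_Gamma fun m => by
            have : (0 : ℝ) ≤ m := m.cast_nonneg
            linarith).continuousAt
      have h4 := (Complex.continuous_ofReal.continuousAt.comp h3).tendsto
      exact (h4.mono_left nhdsWithin_le_nhds).const_mul _
    refine tendsto_nhds_unique h1 (h2.congr' ?_)
    filter_upwards [hev] with β hβ
    exact (hlt β hβ.1 hβ.2).symm
  -- Integrating the derivative of `e^{μ τ} μ^{-β}` relates orders `β` and `β + 1`, in step with
  -- `Γ(β + 1) = β Γ(β)`. Every positive order is reached from `(0, 1]`.
  have hstep : ∀ β : ℝ, 0 < β →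
      keyAt c θ r (fun μ : ℂ => Complex.exp (μ * τ) * μ ^ (-(β : ℂ))) =
        2 * π * Complex.I * fracKernel β τ →
      keyAt c θ r (fun μ : ℂ => Complex.exp (μ * τ) * μ ^ (-((β + 1 : ℝ) : ℂ))) =
        2 * π * Complex.I * fracKernel (β + 1) τ := by
    intro β hβ h
    have hS0 := isSymbol_cpow_neg hθ hθ' hβ.le
    have hS1 := isSymbol_cpow_neg hθ hθ' (by linarith : 0 ≤ β + 1)
    have hI0 := keyIntAt_exp_mul (by linarith) hS0.continuousOn hS0.norm_le hθ hθ' hτ hβ.le hc hr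
      hcr
    have hI1 := keyIntAt_exp_mul (by linarith) hS1.continuousOn hS1.norm_le hθ hθ' hτ
      (by linarith) hc hr hcr
    have h0 := keyAt_deriv_eq_zero (c := c) (r := r)
      (G := fun μ : ℂ => Complex.exp (μ * τ) * μ ^ (-(β : ℂ)))
      (G' := fun μ => (τ : ℂ) • (Complex.exp (μ * τ) * μ ^ (-(β : ℂ))) +
        (-(β : ℂ)) • (Complex.exp (μ * τ) * μ ^ (-((β + 1 : ℝ) : ℂ)))) hθ hθ' hc hr hcr
      (fun μ hμ => by
        convert! (hasDerivAt_cexp_mul τ μ).mul (hasDerivAt_cpow_neg hθ hθ' β hμ) using 1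
        simp only [smul_eq_mul]
        ring)
      ((hI0.smul (τ : ℂ)).add (hI1.smul (-(β : ℂ)))) (fun φ hφ => by
        refine (tendsto_mul_ray (expBound_of_norm_le (τ := τ) (by linarith) hS1.norm_le)
          (by linarith) hθ hθ' hτ (by linarith) hc hφ).congr' ?_
        filter_upwards [eventually_gt_atTop 0] with ρ hρ
        have hm := add_mul_dir_mem_sector hθ hθ' hφ.le hc hρ.le (by linarith)
        rw [mul_left_comm, mul_cpow_neg_add_one hm.1])
    rw [keyAt_add (hI0.smul (τ : ℂ)) (hI1.smul (-(β : ℂ))), keyAt_smul, keyAt_smul, h] at h0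
    have hβ0 : (β : ℂ) ≠ 0 := by exact_mod_cast hβ.ne'
    have hk : (β : ℂ) * fracKernel (β + 1) τ = τ * fracKernel β τ := by
      have h5 : β * (τ ^ (β + 1 - 1) / Real.Gamma (β + 1)) =
          τ * (τ ^ (β - 1) / Real.Gamma β) := by
        rw [Real.Gamma_add_one hβ.ne', add_sub_cancel_right, Real.rpow_sub_one hτ.ne']
        have := (Real.Gamma_pos_of_pos hβ).ne'
        field_simp
      unfold fracKernel
      exact_mod_cast h5
    refine mul_left_cancel₀ hβ0 ?_
    simp only [smul_eq_mul] at h0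
    linear_combination -h0 - 2 * π * Complex.I * hk
  have hle : ∀ β : ℝ, 0 < β → β ≤ 1 →
      keyAt c θ r (fun μ : ℂ => Complex.exp (μ * τ) * μ ^ (-(β : ℂ))) =
        2 * π * Complex.I * fracKernel β τ := by
    intro β hβ hβ'
    rcases hβ'.lt_or_eq with h | rfl
    · exact hlt β hβ h
    · exact hone
  have hnat : ∀ n : ℕ, ∀ β : ℝ, 0 < β → β ≤ n + 1 →
      keyAt c θ r (fun μ : ℂ => Complex.exp (μ * τ) * μ ^ (-(β : ℂ))) =
        2 * π * Complex.I * fracKernel β τ := by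
    intro n
    induction n with
    | zero => exact fun β hβ h => hle β hβ (by simpa using h)
    | succ n ih =>
      intro β hβ h
      rcases le_or_gt β 1 with h1 | h1
      · exact hle β hβ h1
      · have := hstep (β - 1) (by linarith) (ih (β - 1) (by linarith) (by push_cast at h; linarith))
        rwa [sub_add_cancel] at this
  obtain ⟨n, hn⟩ := exists_nat_ge β
  exact hnat n β hβ (by linarith)

end Hankel

/-! ### Pointwise estimates and series along a contour. -/

section ContourSet

/-- The points of the contour `c + Γ(θ, r)`. -/
def contour (c θ r : ℝ) : Set ℂ :=
  {μ | ∃ φ ρ : ℝ, |φ| ≤ θ ∧ (|φ| = θ ∧ r ≤ ρ ∨ ρ = r) ∧ μ = c + ρ * dir φ}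

variable {c θ r : ℝ}

theorem ray_mem_contour {φ ρ : ℝ} (hφ : |φ| = θ) (hρ : r ≤ ρ) :
    (c : ℂ) + ρ * dir φ ∈ contour c θ r :=
  ⟨φ, ρ, hφ.le, Or.inl ⟨hφ, hρ⟩, rfl⟩

theorem arc_mem_contour {φ : ℝ} (hφ : |φ| ≤ θ) : (c : ℂ) + r * dir φ ∈ contour c θ r :=
  ⟨φ, r, hφ, Or.inr rfl, rfl⟩

theorem contour_subset_sector (hθ : π / 2 < θ) (hθ' : θ < π) (hc : 0 ≤ c) (hr : 0 ≤ r)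
    (hcr : 0 < c + r) : contour c θ r ⊆ sector θ := by
  rintro μ ⟨φ, ρ, hφ, h, rfl⟩
  have hρ : r ≤ ρ := by
    rcases h with h | h
    · exact h.2
    · exact h.ge
  exact add_mul_dir_mem_sector hθ hθ' hφ hc (hr.trans hρ) (by linarith)

theorem le_norm_of_mem_contour (hr : 0 ≤ r) {μ : ℂ} (hμ : μ ∈ contour 0 θ r) : r ≤ ‖μ‖ := by
  obtain ⟨φ, ρ, hφ, h, rfl⟩ := hμ
  have hρ : r ≤ ρ := by
    rcases h with h | h
    · exact h.2
    · exact h.ge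
  simpa [abs_of_nonneg (hr.trans hρ)] using hρ

variable {E : Type*} [NormedAddCommGroup E]

theorem aestronglyMeasurable_ray {F : ℂ → E} (hF : ContinuousOn F (contour c θ r)) {φ : ℝ}
    (hφ : |φ| = θ) :
    AEStronglyMeasurable (fun ρ : ℝ => F (c + ρ * dir φ)) (volume.restrict (Ioi r)) :=
  (hF.comp (continuous_ray c φ).continuousOn fun _ hρ =>
    ray_mem_contour hφ (le_of_lt hρ)).aestronglyMeasurable measurableSet_Ioi

theorem continuousOn_arc {F : ℂ → E} (hF : ContinuousOn F (contour c θ r)) :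
    ContinuousOn (fun φ : ℝ => F (c + r * dir φ)) (Icc (-θ) θ) :=
  hF.comp (continuous_arc c r).continuousOn fun _ hφ => arc_mem_contour (abs_le.2 hφ)

theorem KeyIntAt.mono {E' : Type*} [NormedAddCommGroup E'] {F : ℂ → E} {G : ℂ → E'}
    (hG : KeyIntAt c θ r G) (hθ : 0 < θ) (hF : ContinuousOn F (contour c θ r))
    (h : ∀ μ ∈ contour c θ r, ‖F μ‖ ≤ ‖G μ‖) : KeyIntAt c θ r F := by
  have hray : ∀ φ, |φ| = θ → IntegrableOn (fun ρ : ℝ => G (c + ρ * dir φ)) (Ioi r) →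
      IntegrableOn (fun ρ : ℝ => F (c + ρ * dir φ)) (Ioi r) := by
    intro φ hφ hi
    refine hi.norm.mono' (aestronglyMeasurable_ray hF hφ) ?_
    filter_upwards [ae_restrict_mem measurableSet_Ioi] with ρ hρ
    exact h _ (ray_mem_contour hφ (le_of_lt hρ))
  refine ⟨hray _ (by rw [abs_neg, abs_of_pos hθ]) hG.1, hray _ (abs_of_pos hθ) hG.2.1, ?_⟩
  refine ContinuousOn.intervalIntegrable ?_
  rw [uIcc_of_le (by linarith)]
  exact continuousOn_arc hF

variable [NormedSpace ℂ E]

theorem keyAt_congr_contour {F G : ℂ → E} (hθ : 0 < θ) (h : EqOn F G (contour c θ r)) :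
    keyAt c θ r F = keyAt c θ r G := by
  have hray : ∀ φ, |φ| = θ → ∫ ρ in Ioi r, dir φ • F (c + ρ * dir φ) =
      ∫ ρ in Ioi r, dir φ • G (c + ρ * dir φ) := fun φ hφ =>
    setIntegral_congr_fun measurableSet_Ioi fun ρ hρ => by
      simp only [h (ray_mem_contour hφ (le_of_lt hρ))]
  rw [keyAt, keyAt, raysIntegral, raysIntegral, hray _ (abs_of_pos hθ),
    hray (-θ) (by rw [abs_neg, abs_of_pos hθ])]
  congr 1
  refine intervalIntegral.integral_congr fun φ hφ => ?_
  rw [uIcc_of_le (by linarith)] at hφ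
  simp only [h (arc_mem_contour (abs_le.2 hφ))]

/-- A geometric factor times one integrable function dominates the series, so it may be integrated
termwise, also with operator values. -/
theorem hasSum_keyAt {F : ℕ → ℂ → E} {D : ℂ → ℝ} {S : ℂ → E} {q : ℝ} (hθ : 0 < θ)
    (hq : 0 ≤ q) (hq' : q < 1) (hD : KeyIntAt c θ r D)
    (hF : ∀ n, ContinuousOn (F n) (contour c θ r))
    (hFD : ∀ n, ∀ μ ∈ contour c θ r, ‖F n μ‖ ≤ q ^ n * D μ)
    (hS : ∀ μ ∈ contour c θ r, HasSum (fun n => F n μ) (S μ)) :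
    HasSum (fun n => keyAt c θ r (F n)) (keyAt c θ r S) := by
  have hgeo := summable_geometric_of_lt_one hq hq'
  have hray : ∀ φ, |φ| = θ → IntegrableOn (fun ρ : ℝ => D (c + ρ * dir φ)) (Ioi r) →
      HasSum (fun n => ∫ ρ in Ioi r, dir φ • F n (c + ρ * dir φ))
        (∫ ρ in Ioi r, dir φ • S (c + ρ * dir φ)) := by
    intro φ hφ hi
    refine hasSum_integral_of_dominated_convergence
      (fun n ρ => q ^ n * D (c + ρ * dir φ)) (fun n => ?_) (fun n => ?_) ?_ ?_ ?_
    · exact (aestronglyMeasurable_ray (hF n) hφ).const_smul (dir φ)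
    · filter_upwards [ae_restrict_mem measurableSet_Ioi] with ρ hρ
      rw [norm_smul, norm_dir, one_mul]
      exact hFD n _ (ray_mem_contour hφ (le_of_lt hρ))
    · exact Eventually.of_forall fun ρ => hgeo.mul_right _
    · simp only [tsum_mul_right]
      exact hi.const_mul _
    · filter_upwards [ae_restrict_mem measurableSet_Ioi] with ρ hρ
      exact (hS _ (ray_mem_contour hφ (le_of_lt hρ))).const_smul (dir φ)
  have harc : HasSum (fun n => ∫ φ in (-θ)..θ, (Complex.I * (r * dir φ)) • F n (c + r * dir φ))
      (∫ φ in (-θ)..θ, (Complex.I * (r * dir φ)) • S (c + r * dir φ)) := by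
    have hcont : Continuous fun φ : ℝ => Complex.I * (r * dir φ) :=
      continuous_const.mul (continuous_const.mul continuous_dir)
    have hmem : ∀ φ ∈ uIoc (-θ) θ, (c : ℂ) + r * dir φ ∈ contour c θ r := fun φ hφ => by
      rw [uIoc_of_le (by linarith)] at hφ
      exact arc_mem_contour (abs_le.2 ⟨hφ.1.le, hφ.2⟩)
    refine intervalIntegral.hasSum_integral_of_dominated_convergence
      (fun n φ => q ^ n * (‖Complex.I * (r * dir φ)‖ * D (c + r * dir φ)))
      (fun n => ?_) (fun n => ?_) ?_ ?_ ?_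
    · rw [uIoc_of_le (by linarith)]
      exact ((hcont.continuousOn.smul (continuousOn_arc (hF n))).mono
        Ioc_subset_Icc_self).aestronglyMeasurable measurableSet_Ioc
    · refine Eventually.of_forall fun φ hφ => ?_
      rw [norm_smul, mul_left_comm (q ^ n)]
      exact mul_le_mul_of_nonneg_left (hFD n _ (hmem φ hφ)) (norm_nonneg _)
    · exact Eventually.of_forall fun φ _ => hgeo.mul_right _
    · simp only [tsum_mul_right]
      exact (hD.2.2.continuousOn_mul hcont.norm.continuousOn).const_mul _
    · exact Eventually.of_forall fun φ hφ => (hS _ (hmem φ hφ)).const_smul _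
  exact ((hray (-θ) (by rw [abs_neg, abs_of_pos hθ]) hD.1).neg.add
    (hray θ (abs_of_pos hθ) hD.2.1)).add harc

end ContourSet

/-! ### Operator-valued contour integrals and their kernels. -/

section OperatorIntegrals

variable {X : Type*} [NormedAddCommGroup X] [NormedSpace ℂ X] [CompleteSpace X] {T : ℝ} (hT : 0 < T)
  {c θ r β A : ℝ} {ψ : ℂ → ℂ}

/-- The integral is at most `T`, and also at most `1 / (κρ)`; adding the two estimates covers small
and large `ρ` together. -/
theorem integral_exp_mul_le {κ ρ : ℝ} (hT : 0 < T) (hκ : 0 < κ) (hρ : 0 ≤ ρ) :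
    (1 + ρ) * ∫ s in (0 : ℝ)..T, Real.exp (-(κ * ρ) * s) ≤ T + κ⁻¹ := by
  have hc : Continuous fun s : ℝ => Real.exp (-(κ * ρ) * s) := by fun_prop
  have h1 : ∫ s in (0 : ℝ)..T, Real.exp (-(κ * ρ) * s) ≤ T := by
    calc ∫ s in (0 : ℝ)..T, Real.exp (-(κ * ρ) * s) ≤ ∫ _ in (0 : ℝ)..T, (1 : ℝ) := by
          refine intervalIntegral.integral_mono_on hT.le (hc.intervalIntegrable _ _)
            (continuous_const.intervalIntegrable _ _) fun s hs => Real.exp_le_one_iff.2 ?_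
          have : 0 ≤ κ * ρ * s := mul_nonneg (mul_nonneg hκ.le hρ) hs.1
          linarith
      _ = T := by simp
  have h2 : (κ * ρ) * ∫ s in (0 : ℝ)..T, Real.exp (-(κ * ρ) * s) ≤ 1 := by
    have hd : ∀ s ∈ uIcc 0 T, HasDerivAt (fun s => -Real.exp (-(κ * ρ) * s))
        ((κ * ρ) * Real.exp (-(κ * ρ) * s)) s := by
      intro s _
      convert! (((hasDerivAt_id s).const_mul (-(κ * ρ))).exp).neg using 1
      simp only [id]
      ring
    rw [← intervalIntegral.integral_const_mul,
      intervalIntegral.integral_eq_sub_of_hasDerivAt hd ((hc.const_mul _).intervalIntegrable _ _)]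
    simp only [mul_zero, Real.exp_zero]
    linarith [Real.exp_pos (-(κ * ρ) * T)]
  have h3 : ρ * ∫ s in (0 : ℝ)..T, Real.exp (-(κ * ρ) * s) ≤ κ⁻¹ := by
    rw [← one_div, le_div_iff₀ hκ]
    linarith
  linarith

/-- Integrating `|e^{μ s}|` over `(0, T)` gains a factor of order `(c + ρ)⁻¹`. The remaining density
`(c + ρ)^{-β-1}` is integrable at infinity for every `β > 0`. -/
theorem integrable_prod_ray (hT : 0 < T) (hθ : π / 2 < θ) (hθ' : θ < π) (hc : 0 ≤ c) (hr : 0 ≤ r)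
    (hcr : 0 < c + r) (hA : 0 ≤ A) (hβ : 0 < β) (hψ : ContinuousOn ψ (contour c θ r))
    (hψA : ∀ μ ∈ contour c θ r, ‖ψ μ‖ ≤ A * ‖μ‖ ^ (-β)) {φ : ℝ} (hφ : |φ| = θ) :
    Integrable (fun p : ℝ × ℝ => (dir φ * ψ (c + p.1 * dir φ)) *
      Complex.exp ((c + p.1 * dir φ) * p.2))
      ((volume.restrict (Ioi r)).prod (volume.restrict (Ioc 0 T))) := by
  have hm := (aestronglyMeasurable_ray hψ hφ).const_smul (dir φ)
  have hmeas : AEStronglyMeasurable (fun p : ℝ × ℝ => (dir φ * ψ (c + p.1 * dir φ)) *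
      Complex.exp ((c + p.1 * dir φ) * p.2))
      ((volume.restrict (Ioi r)).prod (volume.restrict (Ioc 0 T))) :=
    hm.comp_fst.mul (by fun_prop : Continuous fun p : ℝ × ℝ =>
      Complex.exp (((c : ℂ) + p.1 * dir φ) * p.2)).aestronglyMeasurable
  have hκ : 0 < -Real.cos θ := by
    have := Real.cos_neg_of_pi_div_two_lt_of_lt hθ (by linarith)
    linarith
  have hq := apt_pos hθ hθ'
  have hcos : Real.cos φ = Real.cos θ := by rw [← Real.cos_abs, hφ]
  rw [integrable_prod_iff hmeas]
  constructor
  · refine Eventually.of_forall fun ρ => ?_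
    have : Continuous fun s : ℝ => (dir φ * ψ (c + ρ * dir φ)) *
        Complex.exp ((c + ρ * dir φ) * s) := by fun_prop
    exact this.integrableOn_Ioc
  · refine Integrable.mono' (g := fun ρ => A * apt θ ^ (-β) * (Real.exp (c * T) *
      (T + (-Real.cos θ)⁻¹) * (1 + c)) * (ρ + c) ^ (-β - 1))
      ((integrableOn_add_rpow_Ioi_of_lt (by linarith) (by linarith)).const_mul _)
      hmeas.norm.integral_prod_right' ?_
    filter_upwards [ae_restrict_mem measurableSet_Ioi] with ρ hρ
    rw [mem_Ioi] at hρ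
    have hρ0 : 0 ≤ ρ := hr.trans hρ.le
    have hcρ : 0 < c + ρ := by linarith
    have e : ∀ s : ℝ, ‖(dir φ * ψ (c + ρ * dir φ)) * Complex.exp ((c + ρ * dir φ) * s)‖ =
        ‖ψ (c + ρ * dir φ)‖ * Real.exp (s * (c + ρ * Real.cos θ)) := by
      intro s
      rw [norm_mul, norm_mul, norm_dir, one_mul, norm_cexp_mul, re_add_mul_dir, hcos]
    simp only [e]
    rw [Real.norm_of_nonneg (integral_nonneg fun s => by positivity), integral_const_mul,
      ← intervalIntegral.integral_of_le hT.le]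
    have h1 : ‖ψ (c + ρ * dir φ)‖ ≤ A * (apt θ ^ (-β) * (c + ρ) ^ (-β)) := by
      refine (hψA _ (ray_mem_contour hφ hρ.le)).trans ?_
      gcongr
      rw [← Real.mul_rpow hq.le hcρ.le]
      exact Real.rpow_le_rpow_of_nonpos (mul_pos hq hcρ) (le_norm_add_mul_dir hθ' hφ.le hc hρ0)
        (by linarith)
    have h2 : ∫ s in (0 : ℝ)..T, Real.exp (s * (c + ρ * Real.cos θ)) ≤
        Real.exp (c * T) * (T + (-Real.cos θ)⁻¹) * (1 + c) * (c + ρ)⁻¹ := by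
      have h3 : ∫ s in (0 : ℝ)..T, Real.exp (s * (c + ρ * Real.cos θ)) ≤
          Real.exp (c * T) * ∫ s in (0 : ℝ)..T, Real.exp (-(-Real.cos θ * ρ) * s) := by
        rw [← intervalIntegral.integral_const_mul]
        refine intervalIntegral.integral_mono_on hT.le
          (Continuous.intervalIntegrable (by fun_prop) _ _)
          (Continuous.intervalIntegrable (by fun_prop) _ _) fun s hs => ?_
        rw [← Real.exp_add]
        refine Real.exp_le_exp.2 ?_
        have : c * s ≤ c * T := by
          gcongr
          exact hs.2
        linarith
      have h4 := integral_exp_mul_le hT hκ hρ0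
      have h5 : 0 ≤ ∫ s in (0 : ℝ)..T, Real.exp (-(-Real.cos θ * ρ) * s) :=
        integral_exp_nonneg hT _
      refine h3.trans ?_
      rw [← div_eq_mul_inv, le_div_iff₀ hcρ]
      calc Real.exp (c * T) * (∫ s in (0 : ℝ)..T, Real.exp (-(-Real.cos θ * ρ) * s)) * (c + ρ)
          ≤ Real.exp (c * T) * (∫ s in (0 : ℝ)..T, Real.exp (-(-Real.cos θ * ρ) * s)) *
            ((1 + ρ) * (1 + c)) := by
              gcongr
              nlinarith [mul_nonneg hc hρ0]
        _ = Real.exp (c * T) * ((1 + ρ) * ∫ s in (0 : ℝ)..T, Real.exp (-(-Real.cos θ * ρ) * s)) *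
            (1 + c) := by ring
        _ ≤ _ := by gcongr
    calc ‖ψ (c + ρ * dir φ)‖ * ∫ s in (0 : ℝ)..T, Real.exp (s * (c + ρ * Real.cos θ))
        ≤ (A * (apt θ ^ (-β) * (c + ρ) ^ (-β))) *
          (Real.exp (c * T) * (T + (-Real.cos θ)⁻¹) * (1 + c) * (c + ρ)⁻¹) := by
            refine mul_le_mul h1 h2 (intervalIntegral.integral_nonneg hT.le
              fun _ _ => (Real.exp_pos _).le) (by positivity)
      _ = _ := by
          rw [Real.rpow_sub_one (by linarith), add_comm ρ c]
          ring

theorem integrable_prod_arc (hψ : ContinuousOn ψ (contour c θ r)) :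
    Integrable (fun p : ℝ × ℝ => (Complex.I * (r * dir p.1) * ψ (c + r * dir p.1)) *
      Complex.exp ((c + r * dir p.1) * p.2))
      ((volume.restrict (Ioc (-θ) θ)).prod (volume.restrict (Ioc 0 T))) := by
  have h1 : ContinuousOn (fun φ : ℝ => Complex.I * (r * dir φ) * ψ (c + r * dir φ))
      (Icc (-θ) θ) :=
    (continuous_const.mul (continuous_const.mul continuous_dir)).continuousOn.mul
      (continuousOn_arc hψ)
  have h2 : ContinuousOn (fun p : ℝ × ℝ => (Complex.I * (r * dir p.1) * ψ (c + r * dir p.1)) *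
      Complex.exp ((c + r * dir p.1) * p.2)) (Icc (-θ) θ ×ˢ Icc 0 T) := by
    refine (h1.comp continuous_fst.continuousOn fun p hp => hp.1).mul (Continuous.continuousOn ?_)
    have := (continuous_arc c r).comp (continuous_fst (X := ℝ) (Y := ℝ))
    exact Complex.continuous_exp.comp (this.mul (Complex.continuous_ofReal.comp continuous_snd))
  rw [Measure.prod_restrict]
  exact (h2.integrableOn_compact (isCompact_Icc.prod isCompact_Icc)).mono_set
    (prod_mono Ioc_subset_Icc_self Ioc_subset_Icc_self)

theorem keyIntAt_smul_resB (hθ : π / 2 < θ) (hθ' : θ < π) (hc : 0 ≤ c) (hr : 0 ≤ r)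
    (hcr : 0 < c + r) (hA : 0 ≤ A) (hβ : 0 < β) (hψ : ContinuousOn ψ (contour c θ r))
    (hψA : ∀ μ ∈ contour c θ r, ‖ψ μ‖ ≤ A * ‖μ‖ ^ (-β)) :
    KeyIntAt c θ r fun μ => ψ μ • resB (X := X) hT μ := by
  have hθ0 : 0 < θ := by linarith [pi_pos]
  have hray : ∀ φ, |φ| = θ → IntegrableOn (fun ρ : ℝ => ψ (c + ρ * dir φ) •
      resB (X := X) hT (c + ρ * dir φ)) (Ioi r) := by
    intro φ hφ
    -- The Fubini statement carries the unimodular tangent factor `dir φ`; multiplying by its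
    -- inverse removes it.
    have h := (integrable_smul_resB (X := X) hT (continuous_ray c φ)
      ((aestronglyMeasurable_ray hψ hφ).const_smul (dir φ))
      (integrable_prod_ray hT hθ hθ' hc hr hcr hA hβ hψ hψA hφ)).smul (dir φ)⁻¹
    refine h.congr (Eventually.of_forall fun ρ => ?_)
    have : dir φ ≠ 0 := by simp [dir]
    simp only [Pi.smul_apply, smul_smul, smul_eq_mul, inv_mul_cancel_left₀ this]
  refine ⟨hray _ (by rw [abs_neg, abs_of_pos hθ0]), hray _ (abs_of_pos hθ0), ?_⟩
  refine ContinuousOn.intervalIntegrable ?_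
  rw [uIcc_of_le (by linarith)]
  exact continuousOn_arc (hψ.smul (continuous_resB hT).continuousOn)

/-- The kernel of the operator `∫ ψ(μ) (μ - B)⁻¹ dμ`. -/
theorem keyAt_smul_resB_apply (hθ : π / 2 < θ) (hθ' : θ < π) (hc : 0 ≤ c) (hr : 0 ≤ r)
    (hcr : 0 < c + r) (hA : 0 ≤ A) (hβ : 0 < β) (hψ : ContinuousOn ψ (contour c θ r))
    (hψA : ∀ μ ∈ contour c θ r, ‖ψ μ‖ ≤ A * ‖μ‖ ^ (-β)) :
    IntegrableOn (fun τ : ℝ => keyAt c θ r fun μ => Complex.exp (μ * τ) * ψ μ) (Ioc 0 T) ∧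
    ∀ (f : C(Icc (0 : ℝ) T, X)) (t : Icc (0 : ℝ) T),
      (keyAt c θ r fun μ => ψ μ • resB hT μ) f t =
        -∫ s in (0 : ℝ)..t, (keyAt c θ r fun μ => Complex.exp (μ * (t - s : ℝ)) * ψ μ) •
          IccExtend hT.le f s := by
  have hθ0 : 0 < θ := by linarith [pi_pos]
  have hn : |-θ| = θ := by rw [abs_neg, abs_of_pos hθ0]
  have hp : |θ| = θ := abs_of_pos hθ0
  have h1 := integrable_prod_ray hT hθ hθ' hc hr hcr hA hβ hψ hψA hn
  have h2 := integrable_prod_ray hT hθ hθ' hc hr hcr hA hβ hψ hψA hp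
  have h3 := integrable_prod_arc (T := T) hψ
  obtain ⟨K, hK⟩ : ∃ K : ℝ → ℝ → ℂ, ∀ φ τ, K φ τ = ∫ ρ in Ioi r, (dir φ * ψ (c + ρ * dir φ)) *
      Complex.exp ((c + ρ * dir φ) * τ) := ⟨_, fun _ _ => rfl⟩
  obtain ⟨L, hL⟩ : ∃ L : ℝ → ℂ, ∀ τ, L τ = ∫ φ in Ioc (-θ) θ,
      (Complex.I * (r * dir φ) * ψ (c + r * dir φ)) * Complex.exp ((c + r * dir φ) * τ) :=
    ⟨_, fun _ => rfl⟩
  have e : ∀ τ : ℝ, (keyAt c θ r fun μ => Complex.exp (μ * τ) * ψ μ) =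
      -K (-θ) τ + K θ τ + L τ := by
    intro τ
    rw [keyAt, raysIntegral, intervalIntegral.integral_of_le (by linarith), hK, hK, hL]
    simp only [smul_eq_mul]
    congr 2
    · congr 2 with ρ
      ring
    · congr 1 with ρ
      ring
    · ext φ
      ring
  have k1 : IntegrableOn (K (-θ)) (Ioc 0 T) := by
    rw [funext (hK (-θ))]
    exact h1.integral_prod_right
  have k2 : IntegrableOn (K θ) (Ioc 0 T) := by
    rw [funext (hK θ)]
    exact h2.integral_prod_right
  have k3 : IntegrableOn L (Ioc 0 T) := by
    rw [funext hL]
    exact h3.integral_prod_right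
  have hk : IntegrableOn (fun τ : ℝ => keyAt c θ r fun μ => Complex.exp (μ * τ) * ψ μ)
      (Ioc 0 T) := by
    simp only [e]
    exact (k1.neg.add k2).add k3
  refine ⟨hk, fun f t => ?_⟩
  have m1 : AEStronglyMeasurable (fun ρ : ℝ => dir (-θ) * ψ (c + ρ * dir (-θ)))
      (volume.restrict (Ioi r)) := (aestronglyMeasurable_ray hψ hn).const_smul (dir (-θ))
  have m2 : AEStronglyMeasurable (fun ρ : ℝ => dir θ * ψ (c + ρ * dir θ))
      (volume.restrict (Ioi r)) := (aestronglyMeasurable_ray hψ hp).const_smul (dir θ)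
  have m3 : AEStronglyMeasurable (fun φ : ℝ => Complex.I * (r * dir φ) * ψ (c + r * dir φ))
      (volume.restrict (Ioc (-θ) θ)) :=
    ((((continuous_const.mul (continuous_const.mul continuous_dir)).continuousOn.mul
      (continuousOn_arc hψ))).mono Ioc_subset_Icc_self).aestronglyMeasurable measurableSet_Ioc
  have a1 := integral_smul_resB_apply (X := X) hT (continuous_ray c (-θ)) m1 h1 f t
  have a2 := integral_smul_resB_apply (X := X) hT (continuous_ray c θ) m2 h2 f t
  have a3 := integral_smul_resB_apply (X := X) hT (continuous_arc c r) m3 h3 f t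
  simp only [← hK, ← hL] at a1 a2 a3
  have i1 := intervalIntegrable_conv hT k1 f t.2
  have i2 := intervalIntegrable_conv hT k2 f t.2
  have i3 := intervalIntegrable_conv hT k3 f t.2
  have hsum : ∫ s in (0 : ℝ)..t, (keyAt c θ r fun μ => Complex.exp (μ * (t - s : ℝ)) * ψ μ) •
      IccExtend hT.le f s = -(∫ s in (0 : ℝ)..t, K (-θ) (t - s) • IccExtend hT.le f s) +
        (∫ s in (0 : ℝ)..t, K θ (t - s) • IccExtend hT.le f s) +
        ∫ s in (0 : ℝ)..t, L (t - s) • IccExtend hT.le f s := by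
    have i1' : IntervalIntegrable (fun s => -(K (-θ) (t - s) • IccExtend hT.le f s))
      volume 0 t := i1.neg
    have i12 : IntervalIntegrable (fun s => -(K (-θ) (t - s) • IccExtend hT.le f s) +
      K θ (t - s) • IccExtend hT.le f s) volume 0 t := i1'.add i2
    rw [← intervalIntegral.integral_neg, ← intervalIntegral.integral_add i1' i2,
      ← intervalIntegral.integral_add i12 i3]
    refine intervalIntegral.integral_congr fun s _ => ?_
    simp only [e, add_smul, neg_smul]
  rw [hsum, neg_add, neg_add, ← a1, ← a2, ← a3, keyAt, raysIntegral,
    intervalIntegral.integral_of_le (by linarith)]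
  simp only [smul_smul, _root_.add_apply, _root_.neg_apply, ContinuousMap.add_apply,
    ContinuousMap.neg_apply]

end OperatorIntegrals

/-! ### Resolvents of the inverse of a bounded injective operator. -/

section InverseResolvent

variable {Y : Type*} [NormedAddCommGroup Y] [NormedSpace ℂ Y]

/-- The second identity says `J (z R f - f) = R f`. So `R f` lies in the range of `J`, and `J⁻¹`
takes it to `z R f - f`. -/
theorem isResolventAt_inverse {J R : Y →L[ℂ] Y} {z : ℂ} (hJ : Function.Injective J)
    (hcomm : J * R = R * J) (h : z • (J * R) = J + R) :
    IsResolventAt (LinearPMap.inverse ((J : Y →ₗ[ℂ] Y).toPMap ⊤)) z R := by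
  set P : Y →ₗ.[ℂ] Y := (J : Y →ₗ[ℂ] Y).toPMap ⊤ with hP
  have hker : LinearMap.ker P.toFun = ⊥ := by
    rw [LinearMap.ker_eq_bot]
    intro x y hxy
    exact Subtype.ext (hJ hxy)
  have hJR : ∀ f, z • J (R f) = J f + R f := fun f => DFunLike.congr_fun h f
  have hc : ∀ f, J (R f) = R (J f) := fun f => DFunLike.congr_fun hcomm f
  have hdom : ∀ y, y ∈ (LinearPMap.inverse P).domain ↔ ∃ g, J g = y := by
    intro y
    rw [LinearPMap.inverse_domain]
    constructor
    · rintro ⟨g, hg⟩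
      exact ⟨g, hg⟩
    · rintro ⟨g, hg⟩
      exact ⟨⟨g, trivial⟩, hg⟩
  have hval : ∀ (u : (LinearPMap.inverse P).domain) (g : Y), J g = u →
      LinearPMap.inverse P u = g := fun u g hg =>
    LinearPMap.inverse_apply_eq hker (x := ⟨g, trivial⟩) hg
  constructor
  · intro f
    have h1 : J (z • R f - f) = R f := by
      rw [map_sub, map_smul, hJR]
      abel
    refine ⟨⟨R f, (hdom _).2 ⟨_, h1⟩⟩, rfl, ?_⟩
    rw [hval _ _ h1]
    abel
  · intro u
    obtain ⟨g, hg⟩ := (hdom u).1 u.2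
    rw [hval u g hg, ← hg, map_sub, map_smul, ← hc, hJR]
    abel

end InverseResolvent

/-! ### `B^{-α}` as fractional integration, and its injectivity. -/

section FractionalIntegral

variable {X : Type*} [NormedAddCommGroup X] [NormedSpace ℂ X] {T : ℝ} (hT : 0 < T)
  {α β : ℝ}

/-- `V` is the operator of fractional integration of order `β`. -/
def IsFracInt (β : ℝ) (V : C(Icc (0 : ℝ) T, X) →L[ℂ] C(Icc (0 : ℝ) T, X)) : Prop :=
  ∀ (f : C(Icc (0 : ℝ) T, X)) (t : Icc (0 : ℝ) T),
    V f t = ∫ s in (0 : ℝ)..t, fracKernel β (t - s) • IccExtend hT.le f s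

variable {hT} {V W : C(Icc (0 : ℝ) T, X) →L[ℂ] C(Icc (0 : ℝ) T, X)}

theorem IsFracInt.eq (hV : IsFracInt hT β V) (hW : IsFracInt hT β W) : V = W := by
  ext f t
  rw [hV, hW]

theorem IsFracInt.mul [CompleteSpace X] (hα : 0 < α) (hβ : 0 < β) (hV : IsFracInt hT α V)
    (hW : IsFracInt hT β W) : IsFracInt hT (α + β) (V * W) := by
  intro f t
  change V (W f) t = _
  rw [hV]
  have h1 : ∫ s in (0 : ℝ)..t, fracKernel α (t - s) • IccExtend hT.le (W f) s =
      ∫ s in (0 : ℝ)..t, fracKernel α (t - s) •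
        ∫ u in (0 : ℝ)..s, fracKernel β (s - u) • IccExtend hT.le f u := by
    refine intervalIntegral.integral_congr_Ioo_of_le t.2.1 fun s ⟨hs, hst⟩ => ?_
    rw [IccExtend_of_mem hT.le _ (show s ∈ Icc 0 T from ⟨hs.le, hst.le.trans t.2.2⟩), hW]
  rw [h1, conv_conv hT (integrableOn_fracKernel hα T) (integrableOn_fracKernel hβ T) f t.2]
  -- The endpoint `s = t` is left out because the Beta identity needs `t - s > 0`.
  refine intervalIntegral.integral_congr_Ioo_of_le t.2.1 fun s ⟨hs, hst⟩ => ?_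
  simp only [fracKernel_conv hα hβ (sub_pos.2 hst)]

theorem isFracInt_neg_resB_zero [CompleteSpace X] : IsFracInt hT 1 (-resB (X := X) hT 0) := by
  intro f t
  rw [_root_.neg_apply, ContinuousMap.neg_apply, resB_apply, resFun]
  simp [fracKernel]

/-- Orders `2 - α` and `α` compose to order `2`, which is the square of `B⁻¹ = -(0 - B)⁻¹` and hence
injective. -/
theorem IsFracInt.injective [CompleteSpace X] (hα : 0 < α) (hα' : α < 2) (hV : IsFracInt hT α V)
    (hW : IsFracInt hT (2 - α) W) : Function.Injective V := by
  have hinj : Function.Injective (-resB (X := X) hT 0) := by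
    intro f g h
    exact (isResolventAt_resB hT 0).injective (neg_injective h)
  have h := isFracInt_neg_resB_zero (X := X) (hT := hT)
  have h2 := h.mul one_pos one_pos h
  have h3 := hW.mul (by linarith) hα hV
  rw [show 2 - α + α = (1 : ℝ) + 1 by ring] at h3
  have h4 := h3.eq h2
  intro f g hfg
  refine hinj (hinj ?_)
  have := DFunLike.congr_fun h4
  exact (this f).symm.trans ((congrArg W hfg).trans (this g))

variable [CompleteSpace X] {c θ r : ℝ}

/-- The value does not depend on the contour. This identifies the integral over the shifted
half-lines defining `B^{-α}` with those over the keyhole contours. -/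
theorem isFracInt_keyAt (hθ : π / 2 < θ) (hθ' : θ < π) (hc : 0 ≤ c) (hr : 0 ≤ r)
    (hcr : 0 < c + r) (hβ : 0 < β) : IsFracInt hT β (-((2 * π * Complex.I : ℂ)⁻¹ •
      keyAt c θ r fun μ => μ ^ (-(β : ℂ)) • resB (X := X) hT μ)) := by
  intro f t
  have h := (keyAt_smul_resB_apply (X := X) hT hθ hθ' hc hr hcr zero_le_one hβ
    ((continuousOn_cpow_neg hθ hθ' β).mono (contour_subset_sector hθ hθ' hc hr hcr))
    (fun μ _ => by rw [norm_cpow_neg, one_mul])).2 f t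
  rw [_root_.neg_apply, ContinuousMap.neg_apply, _root_.smul_apply, ContinuousMap.smul_apply, h,
    smul_neg, neg_neg, ← intervalIntegral.integral_smul]
  refine intervalIntegral.integral_congr_Ioo_of_le t.2.1 fun s ⟨hs, hst⟩ => ?_
  rw [keyAt_exp_mul_cpow hθ hθ' (sub_pos.2 hst) hc hr hcr hβ, smul_smul,
    inv_mul_cancel_left₀ (by simp [pi_ne_zero])]

variable (X) (hT) {a θ₀ : ℝ}

theorem isFracInt_negPowB (ha : 0 < a) (hθ₀ : π / 2 < θ₀) (hθ₀' : θ₀ < π) (hα : 0 < α) :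
    IsFracInt hT α (negPowB X hT a θ₀ α) := by
  have h := isFracInt_keyAt (X := X) (hT := hT) hθ₀ hθ₀' ha.le le_rfl (by simpa using ha) hα
  simpa only [negPowB, resolv_opB, raysIntegral_eq_keyAt] using h

theorem negPowB_injective (ha : 0 < a) (hθ₀ : π / 2 < θ₀) (hθ₀' : θ₀ < π) (hα : 0 < α)
    (hα' : α < 2) : Function.Injective (negPowB X hT a θ₀ α) :=
  (isFracInt_negPowB X hT ha hθ₀ hθ₀' hα).injective hα hα'
    (isFracInt_negPowB X hT ha hθ₀ hθ₀' (by linarith : 0 < 2 - α))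

end FractionalIntegral

/-! ### The resolvent of `B^α` as a series of fractional integrals. -/

section ResolventOfPower

variable {α θ r : ℝ} {z : ℂ}

/-- On `‖μ‖ ≥ r` one has `‖z‖ ≤ (‖z‖ / r^α) ‖μ‖^α`, so a fixed fraction of `‖μ‖^α` survives in the
denominator. -/
theorem norm_inv_sub_cpow_le (hα : 0 < α) (hr : 0 < r) (hz : ‖z‖ < r ^ α) {μ : ℂ} (hμ : r ≤ ‖μ‖) :
    ‖(z - μ ^ (α : ℂ))⁻¹‖ ≤ (1 - ‖z‖ / r ^ α)⁻¹ * ‖μ‖ ^ (-α) := by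
  have hr' : 0 < r ^ α := Real.rpow_pos_of_pos hr α
  have h1 : r ^ α ≤ ‖μ‖ ^ α := Real.rpow_le_rpow hr.le hμ hα.le
  have h2 : 0 < 1 - ‖z‖ / r ^ α := by
    rw [sub_pos, div_lt_one hr']
    exact hz
  have h3 : (1 - ‖z‖ / r ^ α) * ‖μ‖ ^ α ≤ ‖z - μ ^ (α : ℂ)‖ := by
    have h4 : ‖μ‖ ^ α - ‖z‖ ≤ ‖z - μ ^ (α : ℂ)‖ := by
      rw [← Complex.norm_cpow_real, norm_sub_rev]
      exact norm_sub_norm_le _ _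
    have h5 : ‖z‖ ≤ ‖z‖ / r ^ α * ‖μ‖ ^ α := by
      rw [div_mul_eq_mul_div, le_div_iff₀ hr']
      gcongr
    linarith
  rw [norm_inv, Real.rpow_neg (norm_nonneg μ), ← mul_inv]
  exact inv_anti₀ (mul_pos h2 (hr'.trans_le h1)) h3

theorem sub_cpow_ne_zero (hα : 0 < α) (hr : 0 < r) (hz : ‖z‖ < r ^ α) {μ : ℂ} (hμ : r ≤ ‖μ‖) :
    z - μ ^ (α : ℂ) ≠ 0 := by
  intro h
  have h1 : r ^ α ≤ ‖μ‖ ^ α := Real.rpow_le_rpow hr.le hμ hα.le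
  rw [← Complex.norm_cpow_real, ← sub_eq_zero.1 h] at h1
  linarith

theorem continuousOn_inv_sub_cpow (hθ : π / 2 < θ) (hθ' : θ < π) (hα : 0 < α) (hr : 0 < r)
    (hz : ‖z‖ < r ^ α) :
    ContinuousOn (fun μ : ℂ => (z - μ ^ (α : ℂ))⁻¹) (contour 0 θ r) := by
  refine ContinuousOn.inv₀ (continuousOn_const.sub ?_) fun μ hμ =>
    sub_cpow_ne_zero hα hr hz (le_norm_of_mem_contour hr.le hμ)
  have h := (continuousOn_cpow_neg hθ hθ' (-α)).mono
    (contour_subset_sector hθ hθ' le_rfl hr.le (by simpa using hr))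
  simpa using h

/-- Geometric series in `z / μ^α`. The sign arises because `μ^α`, the larger term, is the one
subtracted. -/
theorem hasSum_inv_sub_cpow (hα : 0 < α) (hr : 0 < r) (hz : ‖z‖ < r ^ α) {μ : ℂ} (hμ : r ≤ ‖μ‖) :
    HasSum (fun n : ℕ => z ^ n * μ ^ (-((α * (n + 1) : ℝ) : ℂ))) (-(z - μ ^ (α : ℂ))⁻¹) := by
  have hμ0 : μ ≠ 0 := norm_pos_iff.1 (hr.trans_le hμ)
  have hp : μ ^ (α : ℂ) ≠ 0 := by simp [Complex.cpow_eq_zero_iff, hμ0]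
  have h1 : ‖z / μ ^ (α : ℂ)‖ < 1 := by
    rw [norm_div, Complex.norm_cpow_real, div_lt_one (Real.rpow_pos_of_pos (hr.trans_le hμ) α)]
    exact hz.trans_le (Real.rpow_le_rpow hr.le hμ hα.le)
  have h2 := (hasSum_geometric_of_norm_lt_one h1).mul_right (μ ^ (α : ℂ))⁻¹
  have h3 : (1 - z / μ ^ (α : ℂ))⁻¹ * (μ ^ (α : ℂ))⁻¹ = -(z - μ ^ (α : ℂ))⁻¹ := by
    rw [← mul_inv, ← inv_neg]
    congr 1
    field_simp
    ring
  rw [h3] at h2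
  refine h2.congr_fun fun n => ?_
  have h4 : μ ^ (-((α * (n + 1) : ℝ) : ℂ)) = ((μ ^ (α : ℂ)) ^ (n + 1))⁻¹ := by
    rw [Complex.cpow_neg, ← Complex.cpow_mul_nat]
    congr 2
    push_cast
    ring
  rw [h4, div_pow, pow_succ (μ ^ (α : ℂ)), mul_inv]
  ring

variable {X : Type*} [NormedAddCommGroup X] [NormedSpace ℂ X] [CompleteSpace X] {T : ℝ} (hT : 0 < T)

theorem hasSum_resolvent (hθ : π / 2 < θ) (hθ' : θ < π) (hα : 0 < α) (hr : 0 < r)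
    (hz : ‖z‖ < r ^ α) :
    HasSum (fun n : ℕ => z ^ n • keyAt 0 θ r fun μ =>
        μ ^ (-((α * (n + 1) : ℝ) : ℂ)) • resB (X := X) hT μ)
      (-keyAt 0 θ r fun μ => (z - μ ^ (α : ℂ))⁻¹ • resB (X := X) hT μ) := by
  have hr0 : 0 < 0 + r := by simpa using hr
  have hθ0 : 0 < θ := by linarith [pi_pos]
  have hr' : 0 < r ^ α := Real.rpow_pos_of_pos hr α
  have hsub := contour_subset_sector hθ hθ' le_rfl hr.le hr0
  have hD : KeyIntAt 0 θ r fun μ => ‖μ ^ (-(α : ℂ)) • resB (X := X) hT μ‖ := by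
    have h := keyIntAt_smul_resB (X := X) hT hθ hθ' le_rfl hr.le hr0 zero_le_one hα
      ((continuousOn_cpow_neg hθ hθ' α).mono hsub) (fun μ _ => by rw [norm_cpow_neg, one_mul])
    exact ⟨h.1.norm, h.2.1.norm, h.2.2.norm⟩
  have h := hasSum_keyAt (c := 0) (θ := θ) (r := r)
    (F := fun (n : ℕ) μ => (z ^ n * μ ^ (-((α * (n + 1) : ℝ) : ℂ))) • resB (X := X) hT μ)
    (S := fun μ => (-(z - μ ^ (α : ℂ))⁻¹) • resB (X := X) hT μ)
    (q := ‖z‖ / r ^ α) hθ0 (by positivity) ((div_lt_one hr').2 hz) hD ?_ ?_ ?_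
  · convert! h using 1
    · ext1 n
      rw [← keyAt_smul]
      simp only [smul_smul]
    · simp only [neg_smul]
      rw [← neg_one_smul ℂ, ← keyAt_smul]
      simp only [neg_one_smul]
  · intro n
    exact (continuousOn_const.mul ((continuousOn_cpow_neg hθ hθ' _).mono hsub)).smul
      (continuous_resB hT).continuousOn
  · intro n μ hμ
    have hμr := le_norm_of_mem_contour hr.le hμ
    have hμ0 := hr.trans_le hμr
    have h1 : ‖μ‖ ^ (-(α * (n + 1))) = (‖μ‖ ^ (-α)) ^ n * ‖μ‖ ^ (-α) := by
      rw [← pow_succ, ← Real.rpow_mul_natCast (norm_nonneg μ)]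
      push_cast
      ring_nf
    have h2 : ‖μ‖ ^ (-α) ≤ r ^ (-α) := Real.rpow_le_rpow_of_nonpos hr hμr (by linarith)
    -- The common ratio on the contour; the dominating function is the norm of the integrand for
    -- `μ^{-α}`.
    have h3 : ‖z‖ * ‖μ‖ ^ (-α) ≤ ‖z‖ / r ^ α := by
      rw [div_eq_mul_inv, ← Real.rpow_neg hr.le]
      gcongr
    rw [norm_smul, norm_smul, norm_mul, norm_pow, norm_cpow_neg, norm_cpow_neg, h1, ← mul_assoc,
      ← mul_assoc, ← mul_pow]
    gcongr
  · intro μ hμ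
    exact (hasSum_inv_sub_cpow hα hr hz (le_norm_of_mem_contour hr.le hμ)).smul_const _

variable {a θ₀ : ℝ}

/-- By the semigroup law the terms `V n` are the powers `J^{n+1}`, so `-R = ∑ z^n J^{n+1}`.
Convergence comes from the contour, and no spectral radius estimate for `J` enters. -/
theorem isResolventAt_powB (ha : 0 < a) (hθ₀ : π / 2 < θ₀) (hθ₀' : θ₀ < π) (hα : 0 < α)
    (hα' : α < 2) (hθ : π / 2 < θ) (hθ' : θ < π) (hr : 0 < r) (hz : ‖z‖ < r ^ α) :
    IsResolventAt (powB X hT a θ₀ α) z (-((2 * π * Complex.I : ℂ)⁻¹ • keyAt 0 θ r fun μ =>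
      (z - μ ^ (α : ℂ))⁻¹ • resB (X := X) hT μ)) := by
  set R := -((2 * π * Complex.I : ℂ)⁻¹ • keyAt 0 θ r fun μ =>
      (z - μ ^ (α : ℂ))⁻¹ • resB (X := X) hT μ) with hR
  set J := negPowB X hT a θ₀ α
  have hJ : IsFracInt hT α J := isFracInt_negPowB X hT ha hθ₀ hθ₀' hα
  set V : ℕ → C(Icc (0 : ℝ) T, X) →L[ℂ] C(Icc (0 : ℝ) T, X) := fun n =>
    -((2 * π * Complex.I : ℂ)⁻¹ • keyAt 0 θ r fun μ =>
      μ ^ (-((α * (n + 1) : ℝ) : ℂ)) • resB (X := X) hT μ) with hVdef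
  have hβ : ∀ n : ℕ, 0 < α * ((n : ℝ) + 1) := fun n => by positivity
  have hV : ∀ n : ℕ, IsFracInt hT (α * (n + 1)) (V n) := fun n =>
    isFracInt_keyAt hθ hθ' le_rfl hr.le (by simpa using hr) (hβ n)
  have hsum : HasSum (fun n : ℕ => z ^ n • V n) (-R) := by
    have h := (hasSum_resolvent (X := X) hT hθ hθ' hα hr hz).const_smul
      (-(2 * π * Complex.I : ℂ)⁻¹)
    convert! h using 1
    · ext1 n
      simp only [hVdef]
      rw [smul_neg, neg_smul, smul_comm]
    · rw [hR, smul_neg, neg_smul]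
  have hV0 : V 0 = J := (hV 0).eq (by simpa using hJ)
  have hJV : ∀ n, J * V n = V (n + 1) := fun n => by
    refine (hJ.mul hα (hβ n) (hV n)).eq ?_
    have h := hV (n + 1)
    rwa [show α * (((n + 1 : ℕ) : ℝ) + 1) = α + α * (n + 1) by push_cast; ring] at h
  have hVJ : ∀ n, V n * J = V (n + 1) := fun n => by
    refine ((hV n).mul (hβ n) hα hJ).eq ?_
    have h := hV (n + 1)
    rwa [show α * (((n + 1 : ℕ) : ℝ) + 1) = α * (n + 1) + α by push_cast; ring] at h
  have hl : HasSum (fun n : ℕ => z ^ n • V (n + 1)) (J * -R) := by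
    have h := hsum.mul_left J
    simpa only [mul_smul_comm, hJV] using h
  have hr : HasSum (fun n : ℕ => z ^ n • V (n + 1)) (-R * J) := by
    have h := hsum.mul_right J
    simpa only [smul_mul_assoc, hVJ] using h
  have hcomm : J * R = R * J := by
    have h := hl.unique hr
    rwa [mul_neg, neg_mul, neg_inj] at h
  refine isResolventAt_inverse (negPowB_injective X hT ha hθ₀ hθ₀' hα hα') hcomm ?_
  -- Multiplying the series by `z J` shifts it by one, so `z J (-R)` equals `-R` minus the first
  -- term `J`.
  have h1 : HasSum (fun n : ℕ => z ^ (n + 1) • V (n + 1)) (z • (J * -R)) := by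
    have h := hl.const_smul z
    simpa only [smul_smul, ← pow_succ'] using h
  have h2 := (hasSum_nat_add_iff' 1).2 hsum
  have h3 := h1.unique h2
  rw [Finset.sum_range_one, pow_zero, one_smul, hV0, mul_neg, smul_neg] at h3
  rw [← neg_inj, h3]
  abel

theorem keyIntAt_exp_div (hθ : π / 2 < θ) (hθ' : θ < π) (hα : 0 < α) (hr : 0 < r)
    (hz : ‖z‖ < r ^ α) {τ : ℝ} (hτ : 0 < τ) :
    KeyIntAt 0 θ r fun μ : ℂ => Complex.exp (μ * τ) / (z - μ ^ (α : ℂ)) := by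
  have hr' : 0 < r ^ α := Real.rpow_pos_of_pos hr α
  set A : ℝ := (1 - ‖z‖ / r ^ α)⁻¹
  have hA : 0 ≤ A := inv_nonneg.2 (sub_nonneg.2 ((div_lt_one hr').2 hz).le)
  have hφ : ContinuousOn (fun μ : ℂ => ((A * ‖μ‖ ^ (-α) : ℝ) : ℂ)) (sector θ) := by
    refine Complex.continuous_ofReal.comp_continuousOn (continuousOn_const.mul ?_)
    exact continuous_norm.continuousOn.rpow_const fun μ hμ => Or.inl (norm_ne_zero_iff.2 hμ.1)
  have h := keyIntAt_exp_mul hA hφ (fun μ hμ => by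
    rw [Complex.norm_real, Real.norm_of_nonneg (by positivity)]) hθ hθ' hτ hα.le le_rfl hr.le
    (by simpa using hr)
  refine h.mono (by linarith [pi_pos]) ?_ fun μ hμ => ?_
  · simp only [div_eq_mul_inv]
    exact (by fun_prop : Continuous fun μ : ℂ => Complex.exp (μ * τ)).continuousOn.mul
      (continuousOn_inv_sub_cpow hθ hθ' hα hr hz)
  · rw [div_eq_mul_inv, norm_mul, norm_mul, Complex.norm_real,
      Real.norm_of_nonneg (by positivity)]
    gcongr
    exact norm_inv_sub_cpow_le hα hr hz (le_norm_of_mem_contour hr.le hμ)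

theorem resolvKernel_eq (α : ℝ) (z : ℂ) (θ r τ : ℝ) :
    resolvKernel α z θ r τ =
      keyAt 0 θ r fun μ => Complex.exp (μ * τ) * (z - μ ^ (α : ℂ))⁻¹ := by
  simp only [resolvKernel, keyholeIntegral_eq_keyAt, div_eq_mul_inv]

theorem resolvent_apply (hθ : π / 2 < θ) (hθ' : θ < π) (hα : 0 < α) (hr : 0 < r)
    (hz : ‖z‖ < r ^ α) :
    KeyIntAt 0 θ r (fun μ => (z - μ ^ (α : ℂ))⁻¹ • resB (X := X) hT μ) ∧
    IntegrableOn (resolvKernel α z θ r) (Ioc 0 T) ∧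
    ∀ (f : C(Icc (0 : ℝ) T, X)) (t : Icc (0 : ℝ) T),
      (-((2 * π * Complex.I : ℂ)⁻¹ • keyAt 0 θ r fun μ =>
        (z - μ ^ (α : ℂ))⁻¹ • resB (X := X) hT μ)) f t =
      (2 * π * Complex.I : ℂ)⁻¹ • ∫ s in (0 : ℝ)..t,
        resolvKernel α z θ r (t - s) • IccExtend hT.le f s := by
  have hr0 : 0 < 0 + r := by simpa using hr
  have hr' : 0 < r ^ α := Real.rpow_pos_of_pos hr α
  have hA : 0 ≤ (1 - ‖z‖ / r ^ α)⁻¹ := inv_nonneg.2 (sub_nonneg.2 ((div_lt_one hr').2 hz).le)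
  have hψ := continuousOn_inv_sub_cpow hθ hθ' hα hr hz
  have hb : ∀ μ ∈ contour 0 θ r, ‖(z - μ ^ (α : ℂ))⁻¹‖ ≤ (1 - ‖z‖ / r ^ α)⁻¹ * ‖μ‖ ^ (-α) :=
    fun μ hμ => norm_inv_sub_cpow_le hα hr hz (le_norm_of_mem_contour hr.le hμ)
  have h := keyAt_smul_resB_apply (X := X) hT hθ hθ' le_rfl hr.le hr0 hA hα hψ hb
  simp only [← resolvKernel_eq] at h
  refine ⟨keyIntAt_smul_resB hT hθ hθ' le_rfl hr.le hr0 hA hα hψ hb, h.1, fun f t => ?_⟩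
  rw [_root_.neg_apply, ContinuousMap.neg_apply, _root_.smul_apply, ContinuousMap.smul_apply,
    h.2, smul_neg, neg_neg]

end ResolventOfPower

/-! ### Size in `τ` of integrals over half-lines from `0`. -/

section RayEstimates

variable {θ τ b C : ℝ} {F : ℂ → ℂ}

/-- The exponent is left as `b + 1 - 1` to match the integrand of the Gamma integral of order `b +
1`. -/
theorem norm_exp_mul_ray_le (h : ∀ μ ∈ sector θ, ‖F μ‖ ≤ C * ‖μ‖ ^ b) (hθ : π / 2 < θ)
    (hθ' : θ < π) {φ ρ : ℝ} (hφ : |φ| = θ) (hρ : 0 < ρ) :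
    ‖Complex.exp (((0 : ℝ) + ρ * dir φ : ℂ) * τ) * F ((0 : ℝ) + ρ * dir φ)‖ ≤
      C * (ρ ^ (b + 1 - 1) * Real.exp (-(-Real.cos θ * τ * ρ))) := by
  have hcos : Real.cos φ = Real.cos θ := by rw [← Real.cos_abs, hφ]
  have hm := h _ (add_mul_dir_mem_sector hθ hθ' hφ.le le_rfl hρ.le (by linarith))
  have hn : ‖((0 : ℝ) : ℂ) + ρ * dir φ‖ = ρ := by simp [abs_of_pos hρ]
  rw [hn] at hm
  rw [norm_mul, norm_cexp_mul, re_add_mul_dir, hcos, add_sub_cancel_right]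
  calc _ ≤ Real.exp (τ * (0 + ρ * Real.cos θ)) * (C * ρ ^ b) := by gcongr
    _ = _ := by
      rw [mul_comm, mul_assoc]
      ring_nf

theorem integrableOn_rpow_mul_exp {κ : ℝ} (hκ : 0 < κ) (hb : -1 < b) :
    IntegrableOn (fun ρ : ℝ => ρ ^ (b + 1 - 1) * Real.exp (-(κ * ρ))) (Ioi 0) := by
  have := integrableOn_rpow_mul_exp_neg_mul_rpow hb one_pos hκ
  simpa only [add_sub_cancel_right, Real.rpow_one, neg_mul] using this

theorem keyIntAt_exp_mul_zero (hF : ContinuousOn F (sector θ))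
    (h : ∀ μ ∈ sector θ, ‖F μ‖ ≤ C * ‖μ‖ ^ b) (hθ : π / 2 < θ) (hθ' : θ < π) (hτ : 0 < τ)
    (hb : -1 < b) : KeyIntAt 0 θ 0 fun μ => Complex.exp (μ * τ) * F μ := by
  have hθ0 : 0 < θ := by linarith [pi_pos]
  have hκ : 0 < -Real.cos θ * τ := by
    have := Real.cos_neg_of_pi_div_two_lt_of_lt hθ (by linarith)
    exact mul_pos (by linarith) hτ
  have hc : ContinuousOn (fun μ : ℂ => Complex.exp (μ * τ) * F μ) (sector θ) :=
    (by fun_prop : Continuous fun μ : ℂ => Complex.exp (μ * τ)).continuousOn.mul hF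
  have hray : ∀ φ, |φ| = θ → IntegrableOn (fun ρ : ℝ =>
      Complex.exp (((0 : ℝ) + ρ * dir φ : ℂ) * τ) * F ((0 : ℝ) + ρ * dir φ)) (Ioi 0) := by
    intro φ hφ
    refine ((integrableOn_rpow_mul_exp hκ hb).const_mul C).mono'
      ((continuousOn_comp_ray hc hθ hθ' le_rfl le_rfl hφ.le).aestronglyMeasurable
        measurableSet_Ioi) ?_
    filter_upwards [ae_restrict_mem measurableSet_Ioi] with ρ hρ
    exact norm_exp_mul_ray_le h hθ hθ' hφ hρ
  refine ⟨hray _ (by rw [abs_neg, abs_of_pos hθ0]), hray _ (abs_of_pos hθ0), ?_⟩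
  simp

/-- A symbol growing like `‖μ‖^b` has inverse Laplace transform `O(τ^{-(b+1)})`, by the Gamma
integral with rate `|cos θ| τ`. -/
theorem norm_raysIntegral_le (h : ∀ μ ∈ sector θ, ‖F μ‖ ≤ C * ‖μ‖ ^ b) (hθ : π / 2 < θ)
    (hθ' : θ < π) (hτ : 0 < τ) (hb : -1 < b) :
    ‖raysIntegral (0 : ℝ) θ 0 fun μ => Complex.exp (μ * τ) * F μ‖ ≤
      2 * C * Real.Gamma (b + 1) * (-Real.cos θ) ^ (-(b + 1)) * τ ^ (-(b + 1)) := by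
  have hθ0 : 0 < θ := by linarith [pi_pos]
  have hcos : 0 < -Real.cos θ := by
    have := Real.cos_neg_of_pi_div_two_lt_of_lt hθ (by linarith)
    linarith
  have hκ : 0 < -Real.cos θ * τ := mul_pos hcos hτ
  have hray : ∀ φ, |φ| = θ → ‖∫ ρ in Ioi (0 : ℝ), dir φ •
      (Complex.exp (((0 : ℝ) + ρ * dir φ : ℂ) * τ) * F ((0 : ℝ) + ρ * dir φ))‖ ≤
      C * (Real.Gamma (b + 1) * (-Real.cos θ) ^ (-(b + 1)) * τ ^ (-(b + 1))) := by
    intro φ hφ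
    have e : ∫ ρ in Ioi (0 : ℝ), C * (ρ ^ (b + 1 - 1) * Real.exp (-(-Real.cos θ * τ * ρ))) =
        C * (Real.Gamma (b + 1) * (-Real.cos θ) ^ (-(b + 1)) * τ ^ (-(b + 1))) := by
      rw [integral_const_mul, Real.integral_rpow_mul_exp_neg_mul_Ioi (by linarith) hκ, one_div,
        Real.inv_rpow hκ.le, ← Real.rpow_neg hκ.le, Real.mul_rpow hcos.le hτ.le]
      ring
    rw [← e]
    refine norm_integral_le_of_norm_le ((integrableOn_rpow_mul_exp hκ hb).const_mul C) ?_
    filter_upwards [ae_restrict_mem measurableSet_Ioi] with ρ hρ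
    rw [norm_smul, norm_dir, one_mul]
    exact norm_exp_mul_ray_le h hθ hθ' hφ hρ
  have h1 := hray _ (abs_of_pos hθ0)
  have h2 := hray (-θ) (by rw [abs_neg, abs_of_pos hθ0])
  rw [raysIntegral]
  refine (norm_add_le _ _).trans ?_
  rw [norm_neg]
  linarith

/-- Each outward ray integral equals `-1/τ` whatever its direction, so the opposite orientations
cancel. -/
theorem raysIntegral_exp (hθ : π / 2 < θ) (hθ' : θ < π) (hτ : 0 < τ) :
    raysIntegral (0 : ℝ) θ 0 (fun μ => Complex.exp (μ * τ)) = 0 := by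
  have hcos := Real.cos_neg_of_pi_div_two_lt_of_lt hθ (by linarith)
  have hray : ∀ φ, Real.cos φ < 0 → ∫ ρ in Ioi (0 : ℝ), dir φ •
      Complex.exp (((0 : ℝ) + ρ * dir φ : ℂ) * τ) = -(τ : ℂ)⁻¹ := by
    intro φ hφ
    have h0 : dir φ ≠ 0 := by simp [dir]
    have h1 : (dir φ * τ).re < 0 := by
      rw [Complex.re_mul_ofReal, dir_re]
      exact mul_neg_of_neg_of_pos hφ hτ
    have h := integral_exp_mul_complex_Ioi h1 0
    have e : ∀ ρ : ℝ, (((0 : ℝ) : ℂ) + ρ * dir φ) * τ = dir φ * τ * ρ := fun ρ => by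
      push_cast
      ring
    simp only [e]
    rw [integral_smul, h]
    have : (τ : ℂ) ≠ 0 := by exact_mod_cast hτ.ne'
    simp
    field_simp
  rw [raysIntegral, hray _ hcos, hray (-θ) (by rwa [Real.cos_neg])]
  simp

end RayEstimates

/-! ### The sectorial estimate for `B^α`. -/

section SectorialBound

variable {α θ c₀ τ r : ℝ} {z : ℂ}

/-- With `σ = sin δ`, the law of cosines bounds the squared norm below by `x² + y² - 2xy cos 2δ`,
which equals `σ² (x + y)² + (1 - σ²)(x - y)²`. -/
theorem sin_mul_add_le_norm_sub {δ x y a b : ℝ} (hx : 0 ≤ x) (hy : 0 ≤ y) (hδ : 0 ≤ δ)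
    (h : 2 * δ ≤ |a - b|) (h' : |a - b| ≤ 2 * π - 2 * δ) :
    Real.sin δ * (x + y) ≤ ‖(x : ℂ) * dir a - y * dir b‖ := by
  have h0 := abs_nonneg (a - b)
  have hcos : Real.cos (a - b) ≤ Real.cos (2 * δ) := by
    rw [← Real.cos_abs (a - b)]
    rcases le_total |a - b| π with hle | hle
    · exact Real.cos_le_cos_of_nonneg_of_le_pi (by linarith) hle h
    · rw [← Real.cos_two_pi_sub |a - b|]
      exact Real.cos_le_cos_of_nonneg_of_le_pi (by linarith) (by linarith) (by linarith)
  have hsq : ‖(x : ℂ) * dir a - y * dir b‖ ^ 2 =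
      x ^ 2 + y ^ 2 - 2 * (x * y) * Real.cos (a - b) := by
    rw [← Complex.normSq_eq_norm_sq, Complex.normSq_apply, Real.cos_sub]
    simp only [Complex.sub_re, Complex.sub_im, Complex.re_ofReal_mul, Complex.im_ofReal_mul, dir_re,
      dir_im]
    nlinarith [Real.sin_sq_add_cos_sq a, Real.sin_sq_add_cos_sq b]
  refine le_of_sq_le_sq ?_ (norm_nonneg _)
  rw [hsq]
  have h2 : Real.cos (2 * δ) = 1 - 2 * Real.sin δ ^ 2 := by
    rw [Real.cos_two_mul, ← Real.sin_sq_add_cos_sq δ]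
    ring
  rw [h2] at hcos
  have h3 := mul_le_mul_of_nonneg_left hcos (mul_nonneg hx hy)
  have h4 : 0 ≤ (1 - Real.sin δ ^ 2) * (x - y) ^ 2 := by
    refine mul_nonneg ?_ (sq_nonneg _)
    linarith [Real.sin_sq_add_cos_sq δ, sq_nonneg (Real.cos δ)]
  nlinarith

/-- The arguments `arg z` and `α arg μ` differ by at least `ε/2`, whence `δ = ε/4`. Since `απ/2 + ε
≤ |arg z| ≤ π`, they differ by at most `2π - ε/2`, so the gap also holds modulo `2π`. -/
theorem le_norm_sub_cpow {ε : ℝ} (hα : 0 < α) (hε : 0 < ε) (hz : α * π / 2 + ε ≤ |z.arg|)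
    (hθ : 0 ≤ θ) (hθε : α * θ ≤ α * π / 2 + ε / 2) {μ : ℂ} (hμ : μ ∈ sector θ) :
    Real.sin (ε / 4) * (‖z‖ + ‖μ‖ ^ α) ≤ ‖z - μ ^ (α : ℂ)‖ := by
  have hμa := abs_arg_le_of_mem_sector hθ hμ
  have hza := Complex.abs_arg_le_pi z
  have h1 : |α * μ.arg| ≤ α * π / 2 + ε / 2 := by
    rw [abs_mul, abs_of_pos hα]
    exact (mul_le_mul_of_nonneg_left hμa hα.le).trans hθε
  have e1 : z = ‖z‖ * dir z.arg := (Complex.norm_mul_exp_arg_mul_I z).symm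
  have e2 : μ ^ (α : ℂ) = ((‖μ‖ ^ α : ℝ) : ℂ) * dir (α * μ.arg) := by
    rw [Complex.cpow_def_of_ne_zero hμ.1, Complex.log, dir, add_mul, Complex.exp_add,
      ← Complex.ofReal_mul, ← Complex.ofReal_exp, ← Real.rpow_def_of_pos (norm_pos_iff.2 hμ.1)]
    congr 2
    push_cast
    ring
  have h := sin_mul_add_le_norm_sub (x := ‖z‖) (y := ‖μ‖ ^ α) (δ := ε / 4) (a := z.arg)
    (b := α * μ.arg) (norm_nonneg _) (by positivity) (by linarith)
    (by linarith [abs_sub_abs_le_abs_sub z.arg (α * μ.arg)])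
    (by linarith [abs_sub z.arg (α * μ.arg)])
  rwa [← e1, ← e2] at h

/-- Order `0` suffices here: it permits the collapse onto half-lines from the origin, and the
`z`-dependent constant never enters the final estimate. -/
theorem isSymbol_inv_sub_cpow (hα : 0 < α) (hc₀ : 0 < c₀) (hz : z ≠ 0) (hθ : π / 2 < θ)
    (hθ' : θ < π) (h : ∀ μ ∈ sector θ, c₀ * (‖z‖ + ‖μ‖ ^ α) ≤ ‖z - μ ^ (α : ℂ)‖) :
    IsSymbol θ 0 (1 / (c₀ * ‖z‖) + α / (c₀ ^ 2 * ‖z‖)) (fun μ : ℂ => (z - μ ^ (α : ℂ))⁻¹)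
      fun μ => (α * μ ^ (((α - 1 : ℝ)) : ℂ)) / (z - μ ^ (α : ℂ)) ^ 2 := by
  have hz' := norm_pos_iff.2 hz
  have hne : ∀ μ ∈ sector θ, z - μ ^ (α : ℂ) ≠ 0 := fun μ hμ => by
    refine norm_pos_iff.1 (lt_of_lt_of_le ?_ (h μ hμ))
    positivity
  have hcont : ∀ β : ℝ, ContinuousOn (fun μ : ℂ => μ ^ (β : ℂ)) (sector θ) := fun β => by
    simpa using continuousOn_cpow_neg hθ hθ' (-β)
  have hp : 0 ≤ α / (c₀ ^ 2 * ‖z‖) := by positivity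
  have hp' : 0 ≤ 1 / (c₀ * ‖z‖) := by positivity
  refine ⟨fun μ hμ => ?_, ?_, fun μ hμ => ?_, fun μ hμ => ?_⟩
  · have h1 := (hasDerivAt_id μ).cpow_const (c := (α : ℂ)) (sector_subset_slitPlane hθ hθ' hμ)
    convert! (h1.const_sub z).inv (hne μ hμ) using 1
    rw [neg_neg, mul_one]
    push_cast
    rfl
  · exact (continuousOn_const.mul (hcont _)).div ((continuousOn_const.sub (hcont α)).pow 2)
      fun μ hμ => pow_ne_zero 2 (hne μ hμ)
  · have h0 : c₀ * ‖z‖ ≤ ‖z - μ ^ (α : ℂ)‖ := by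
      refine le_trans ?_ (h μ hμ)
      gcongr
      linarith [Real.rpow_nonneg (norm_nonneg μ) α]
    rw [neg_zero, Real.rpow_zero, mul_one, norm_inv, ← one_div]
    have := one_div_le_one_div_of_le (by positivity) h0
    linarith
  · have e : μ * (α * μ ^ (((α - 1 : ℝ)) : ℂ) / (z - μ ^ (α : ℂ)) ^ 2) =
        α * μ ^ (α : ℂ) / (z - μ ^ (α : ℂ)) ^ 2 := by
      have := mul_cpow_neg_add_one hμ.1 (-α)
      rw [show ((-α + 1 : ℝ) : ℂ) = -((α - 1 : ℝ) : ℂ) by push_cast; ring, neg_neg] at this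
      rw [Complex.ofReal_neg, neg_neg] at this
      rw [← this]
      ring
    have hy : 0 ≤ ‖μ‖ ^ α := Real.rpow_nonneg (norm_nonneg μ) α
    rw [e, neg_zero, Real.rpow_zero, mul_one, norm_div, norm_mul, norm_pow, Complex.norm_cpow_real,
      Complex.norm_real, Real.norm_of_nonneg hα.le]
    have h1 : α * ‖μ‖ ^ α / ‖z - μ ^ (α : ℂ)‖ ^ 2 ≤ α / (c₀ ^ 2 * ‖z‖) := by
      rw [div_le_div_iff₀ (pow_pos (norm_pos_iff.2 (hne μ hμ)) 2) (by positivity), mul_assoc]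
      gcongr
      calc ‖μ‖ ^ α * (c₀ ^ 2 * ‖z‖) ≤ (c₀ * (‖z‖ + ‖μ‖ ^ α)) ^ 2 := by
            rw [mul_pow]
            nlinarith [mul_nonneg (sq_nonneg c₀) (mul_nonneg hz'.le hy),
              mul_nonneg (sq_nonneg c₀) (sq_nonneg ‖z‖),
              mul_nonneg (sq_nonneg c₀) (sq_nonneg (‖μ‖ ^ α))]
        _ ≤ _ := pow_le_pow_left₀ (by positivity) (h μ hμ) 2
    linarith

theorem mul_rpow_half_le_add {x y : ℝ} (hx : 0 ≤ x) (hy : 0 ≤ y) :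
    x ^ (1 / 2 : ℝ) * y ^ (1 / 2 : ℝ) ≤ x + y := by
  rw [← Real.sqrt_eq_rpow, ← Real.sqrt_eq_rpow]
  nlinarith [Real.sq_sqrt hx, Real.sq_sqrt hy, sq_nonneg (√x - √y), Real.sqrt_nonneg x,
    Real.sqrt_nonneg y]

/-- Using `‖z‖ + ‖μ‖^α ≥ ‖z‖^{1/2} ‖μ‖^{α/2}` trades half of the decay for a symbol of order `-α/2 >
-1`. Its kernel is integrable near `τ = 0`. -/
theorem norm_mul_inv_le_small (hc₀ : 0 < c₀) (hz : z ≠ 0)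
    {μ : ℂ} (hμ : μ ≠ 0) (h : c₀ * (‖z‖ + ‖μ‖ ^ α) ≤ ‖z - μ ^ (α : ℂ)‖) :
    ‖z * (z - μ ^ (α : ℂ))⁻¹‖ ≤ (c₀⁻¹ * ‖z‖ ^ (1 / 2 : ℝ)) * ‖μ‖ ^ (-(α / 2)) := by
  have hz' := norm_pos_iff.2 hz
  have hμ' := norm_pos_iff.2 hμ
  have h1 := mul_rpow_half_le_add hz'.le (Real.rpow_nonneg hμ'.le α)
  rw [← Real.rpow_mul hμ'.le, show α * (1 / 2) = α / 2 by ring] at h1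
  have h2 : 0 < c₀ * (‖z‖ ^ (1 / 2 : ℝ) * ‖μ‖ ^ (α / 2)) := by positivity
  have h3 := (mul_le_mul_of_nonneg_left h1 hc₀.le).trans h
  rw [norm_mul, norm_inv]
  calc ‖z‖ * ‖z - μ ^ (α : ℂ)‖⁻¹ ≤ ‖z‖ * (c₀ * (‖z‖ ^ (1 / 2 : ℝ) * ‖μ‖ ^ (α / 2)))⁻¹ := by
        gcongr
    _ = _ := by
        have e : ‖z‖ = ‖z‖ ^ (1 / 2 : ℝ) * ‖z‖ ^ (1 / 2 : ℝ) := by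
          rw [← Real.rpow_add hz']
          norm_num
        nth_rewrite 1 [e]
        rw [Real.rpow_neg hμ'.le]
        have : ‖z‖ ^ (1 / 2 : ℝ) ≠ 0 := by positivity
        field_simp

theorem norm_cpow_mul_inv_le (hc₀ : 0 < c₀) (hz : z ≠ 0)
    {μ : ℂ} (h : c₀ * (‖z‖ + ‖μ‖ ^ α) ≤ ‖z - μ ^ (α : ℂ)‖) :
    ‖μ ^ (α : ℂ) * (z - μ ^ (α : ℂ))⁻¹‖ ≤ (c₀⁻¹ * ‖z‖⁻¹) * ‖μ‖ ^ α := by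
  have hz' := norm_pos_iff.2 hz
  have hy : 0 ≤ ‖μ‖ ^ α := Real.rpow_nonneg (norm_nonneg μ) α
  have h0 : c₀ * ‖z‖ ≤ ‖z - μ ^ (α : ℂ)‖ := by
    refine le_trans ?_ h
    gcongr
    linarith
  rw [norm_mul, norm_inv, Complex.norm_cpow_real, mul_comm, ← mul_inv]
  gcongr

/-- The first bound serves small times and the second large times. For the second, `z / (z - μ^α) =
1 + μ^α / (z - μ^α)`; the constant `1` contributes nothing for `τ > 0`, and the rest is `O(‖μ‖^α /
‖z‖)`. -/
theorem norm_mul_resolvKernel_le (hα : 0 < α) (hα' : α < 2) (hc₀ : 0 < c₀) (hz : z ≠ 0)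
    (hθ : π / 2 < θ) (hθ' : θ < π) (hr : 0 < r) (hτ : 0 < τ)
    (h : ∀ μ ∈ sector θ, c₀ * (‖z‖ + ‖μ‖ ^ α) ≤ ‖z - μ ^ (α : ℂ)‖) :
    ‖z * resolvKernel α z θ r τ‖ ≤ 2 * (c₀⁻¹ * ‖z‖ ^ (1 / 2 : ℝ)) * Real.Gamma (-(α / 2) + 1) *
        (-Real.cos θ) ^ (-(-(α / 2) + 1)) * τ ^ (-(-(α / 2) + 1)) ∧
    ‖z * resolvKernel α z θ r τ‖ ≤ 2 * (c₀⁻¹ * ‖z‖⁻¹) * Real.Gamma (α + 1) *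
        (-Real.cos θ) ^ (-(α + 1)) * τ ^ (-(α + 1)) := by
  have hz' := norm_pos_iff.2 hz
  have hsym := isSymbol_inv_sub_cpow hα hc₀ hz hθ hθ' h
  have hk : z * resolvKernel α z θ r τ =
      keyAt 0 θ 0 fun μ => Complex.exp (μ * τ) * (z * (z - μ ^ (α : ℂ))⁻¹) := by
    rw [resolvKernel_eq, hsym.keyAt_eq_raysIntegral (by positivity) hθ hθ' hτ le_rfl one_pos le_rfl
      hr.le (by simpa using hr), ← Complex.ofReal_zero, raysIntegral_eq_keyAt, ← smul_eq_mul,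
      ← keyAt_smul]
    simp only [smul_eq_mul]
    congr 1 with μ
    ring
  constructor
  · rw [hk, ← raysIntegral_eq_keyAt]
    exact norm_raysIntegral_le (fun μ hμ => norm_mul_inv_le_small hc₀ hz hμ.1 (h μ hμ)) hθ hθ' hτ
      (by linarith)
  · have hcpow : ContinuousOn (fun μ : ℂ => μ ^ (α : ℂ)) (sector θ) := by
      simpa using continuousOn_cpow_neg hθ hθ' (-α)
    have hb : ∀ μ ∈ sector θ, ‖μ ^ (α : ℂ) * (z - μ ^ (α : ℂ))⁻¹‖ ≤ (c₀⁻¹ * ‖z‖⁻¹) * ‖μ‖ ^ α :=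
      fun μ hμ => norm_cpow_mul_inv_le hc₀ hz (h μ hμ)
    have i1 := keyIntAt_exp_mul_zero (F := fun _ => 1) (C := 1) (b := 0) continuousOn_const
      (fun μ _ => by simp) hθ hθ' hτ (by norm_num)
    have i2 := keyIntAt_exp_mul_zero (F := fun μ : ℂ => μ ^ (α : ℂ) * (z - μ ^ (α : ℂ))⁻¹)
      (hcpow.mul hsym.continuousOn) hb hθ hθ' hτ (by linarith)
    have hadd := keyAt_add i1 i2
    have e1 : (keyAt 0 θ 0 fun μ => Complex.exp (μ * τ) * 1) = 0 := by
      simp only [mul_one]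
      rw [← raysIntegral_eq_keyAt, raysIntegral_exp hθ hθ' hτ]
    rw [e1, zero_add] at hadd
    have e2 : z * resolvKernel α z θ r τ =
        keyAt 0 θ 0 fun μ => Complex.exp (μ * τ) * (μ ^ (α : ℂ) * (z - μ ^ (α : ℂ))⁻¹) := by
      rw [hk, ← hadd]
      refine keyAt_congr_contour (by linarith [pi_pos]) fun μ hμ => ?_
      have hne : z - μ ^ (α : ℂ) ≠ 0 := by
        obtain ⟨φ, ρ, hφ, hρ, rfl⟩ := hμ
        have hρ0 : 0 ≤ ρ := hρ.elim (fun h => h.2) fun h => h.ge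
        rcases hρ0.eq_or_lt with rfl | hpos
        -- The degenerate contour contains the vertex `0`, which lies outside `sector θ`; there `μ^α
        -- = 0` and `z ≠ 0` is used instead.
        · simpa [Complex.zero_cpow, hα.ne'] using hz
        · refine norm_pos_iff.1 (lt_of_lt_of_le ?_
            (h _ (add_mul_dir_mem_sector hθ hθ' hφ le_rfl hρ0 (by linarith))))
          positivity
      field_simp
      ring
    rw [e2, ← raysIntegral_eq_keyAt]
    exact norm_raysIntegral_le hb hθ hθ' hτ (by linarith)

/-- The first power is integrable at `0` and the second at infinity; `x₀` marks the change from one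
to the other. -/
theorem setIntegral_le_of_le_rpow {g : ℝ → ℝ} {T P Q x₀ : ℝ} (hα : 0 < α) (hx₀ : 0 < x₀)
    (hP : 0 ≤ P) (hQ : 0 ≤ Q) (hg : IntegrableOn g (Ioc 0 T))
    (h1 : ∀ τ, 0 < τ → g τ ≤ P * τ ^ (-(-(α / 2) + 1)))
    (h2 : ∀ τ, 0 < τ → g τ ≤ Q * τ ^ (-(α + 1))) :
    ∫ τ in Ioc 0 T, g τ ≤ P * (x₀ ^ (α / 2) / (α / 2)) + Q * (x₀ ^ (-α) / α) := by
  have i1 : IntegrableOn (fun τ : ℝ => τ ^ (-(-(α / 2) + 1))) (Ioc 0 x₀) :=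
    (intervalIntegral.intervalIntegrable_rpow' (a := 0) (b := x₀) (by linarith)).1
  have i2 : IntegrableOn (fun τ : ℝ => τ ^ (-(α + 1))) (Ioi x₀) :=
    integrableOn_Ioi_rpow_of_lt (by linarith) hx₀
  have j1 := IntegrableOn.integrable_indicator (i1.const_mul P) measurableSet_Ioc
  have j2 := IntegrableOn.integrable_indicator (i2.const_mul Q) measurableSet_Ioi
  have e1 : ∫ τ in Ioc 0 x₀, P * τ ^ (-(-(α / 2) + 1)) = P * (x₀ ^ (α / 2) / (α / 2)) := by
    rw [integral_const_mul, ← intervalIntegral.integral_of_le hx₀.le,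
      integral_rpow (Or.inl (by linarith)), show -(-(α / 2) + 1) + 1 = α / 2 by ring,
      Real.zero_rpow (by positivity), sub_zero]
  have e2 : ∫ τ in Ioi x₀, Q * τ ^ (-(α + 1)) = Q * (x₀ ^ (-α) / α) := by
    rw [integral_const_mul, integral_Ioi_rpow_of_lt (by linarith) hx₀,
      show -(α + 1) + 1 = -α by ring, neg_div_neg_eq]
  rw [← e1, ← e2, ← integral_indicator measurableSet_Ioc, ← integral_indicator measurableSet_Ioc,
    ← integral_indicator measurableSet_Ioi,
    ← integral_add j1 j2]
  refine integral_mono (hg.integrable_indicator measurableSet_Ioc)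
    (j1.add j2) fun τ => ?_
  have hn1 : 0 ≤ (Ioc 0 x₀).indicator (fun τ : ℝ => P * τ ^ (-(-(α / 2) + 1))) τ :=
    indicator_nonneg (fun τ hτ => mul_nonneg hP (Real.rpow_nonneg hτ.1.le _)) τ
  have hn2 : 0 ≤ (Ioi x₀).indicator (fun τ : ℝ => Q * τ ^ (-(α + 1))) τ :=
    indicator_nonneg (fun τ hτ => mul_nonneg hQ (Real.rpow_nonneg (hx₀.trans hτ).le _)) τ
  by_cases hτ : τ ∈ Ioc 0 T
  · rw [indicator_of_mem hτ]
    by_cases hx : τ ≤ x₀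
    · rw [indicator_of_mem (show τ ∈ Ioc 0 x₀ from ⟨hτ.1, hx⟩)]
      linarith [h1 τ hτ.1]
    · rw [indicator_of_mem (show τ ∈ Ioi x₀ from not_le.1 hx) (fun τ : ℝ => Q * τ ^ (-(α + 1)))]
      linarith [h2 τ hτ.1]
  · rw [indicator_of_notMem hτ]
    exact add_nonneg hn1 hn2

variable {X : Type*} [NormedAddCommGroup X] [NormedSpace ℂ X] [CompleteSpace X] {T : ℝ} (hT : 0 < T)
  {a θ₀ : ℝ}

theorem exists_norm_lt_rpow (hα : 0 < α) (z : ℂ) : ∃ r : ℝ, 0 < r ∧ ‖z‖ < r ^ α := by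
  refine ⟨(‖z‖ + 1) ^ α⁻¹, by positivity, ?_⟩
  rw [Real.rpow_inv_rpow (by positivity) hα.ne']
  linarith

/-- The right-hand side does not contain `z`. With the split at `x₀ = ‖z‖^{-1/α}`, the powers of
`‖z‖` cancel in both halves of the `L¹` norm of the kernel. -/
theorem norm_smul_resolv_le (ha : 0 < a) (hθ₀ : π / 2 < θ₀) (hθ₀' : θ₀ < π) (hα : 0 < α)
    (hα' : α < 2) (hc₀ : 0 < c₀) (hz : z ≠ 0) (hθ : π / 2 < θ) (hθ' : θ < π)
    (h : ∀ μ ∈ sector θ, c₀ * (‖z‖ + ‖μ‖ ^ α) ≤ ‖z - μ ^ (α : ℂ)‖) :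
    ‖z • resolv (powB X hT a θ₀ α) z‖ ≤ (2 * π)⁻¹ *
      (2 * c₀⁻¹ * Real.Gamma (-(α / 2) + 1) * (-Real.cos θ) ^ (-(-(α / 2) + 1)) * (α / 2)⁻¹ +
        2 * c₀⁻¹ * Real.Gamma (α + 1) * (-Real.cos θ) ^ (-(α + 1)) * α⁻¹) := by
  obtain ⟨r, hr, hzr⟩ := exists_norm_lt_rpow hα z
  have hz' := norm_pos_iff.2 hz
  have hcos : 0 < -Real.cos θ := by
    have := Real.cos_neg_of_pi_div_two_lt_of_lt hθ (by linarith)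
    linarith
  have hΓ1 : 0 < Real.Gamma (-(α / 2) + 1) := Real.Gamma_pos_of_pos (by linarith)
  have hΓ2 : 0 < Real.Gamma (α + 1) := Real.Gamma_pos_of_pos (by linarith)
  obtain ⟨-, hint, happ⟩ := resolvent_apply (X := X) hT hθ hθ' hα hr hzr
  rw [(isResolventAt_powB hT ha hθ₀ hθ₀' hα hα' hθ hθ' hr hzr).resolv_eq]
  set K : ℝ := 2 * c₀⁻¹ * Real.Gamma (-(α / 2) + 1) * (-Real.cos θ) ^ (-(-(α / 2) + 1)) *
    (α / 2)⁻¹ + 2 * c₀⁻¹ * Real.Gamma (α + 1) * (-Real.cos θ) ^ (-(α + 1)) * α⁻¹ with hK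
  have hx1 : (‖z‖ ^ (-α⁻¹)) ^ (α / 2) = (‖z‖ ^ (1 / 2 : ℝ))⁻¹ := by
    rw [← Real.rpow_mul hz'.le, ← Real.rpow_neg hz'.le]
    congr 1
    field_simp
  have hx2 : (‖z‖ ^ (-α⁻¹)) ^ (-α) = ‖z‖ := by
    rw [← Real.rpow_mul hz'.le, neg_mul_neg, inv_mul_cancel₀ hα.ne', Real.rpow_one]
  have hbound : ∫ τ in Ioc 0 T, ‖z * resolvKernel α z θ r τ‖ ≤ K := by
    refine (setIntegral_le_of_le_rpow hα (x₀ := ‖z‖ ^ (-α⁻¹)) (by positivity) ?_ ?_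
      (hint.const_mul z).norm
      (fun τ hτ => (norm_mul_resolvKernel_le hα hα' hc₀ hz hθ hθ' hr hτ h).1)
      fun τ hτ => (norm_mul_resolvKernel_le hα hα' hc₀ hz hθ hθ' hr hτ h).2).trans_eq ?_
    · positivity
    · positivity
    · have : ‖z‖ ^ (1 / 2 : ℝ) ≠ 0 := by positivity
      rw [hx1, hx2, hK]
      field_simp
  have hK0 : 0 ≤ K := (integral_nonneg fun _ => norm_nonneg _).trans hbound
  refine ContinuousLinearMap.opNorm_le_bound _ (by positivity) fun f => ?_
  rw [ContinuousMap.norm_le _ (by positivity)]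
  intro t
  have hn : ‖(2 * π * Complex.I : ℂ)⁻¹‖ = (2 * π)⁻¹ := by simp [abs_of_pos pi_pos]
  have e : (z • ∫ s in (0 : ℝ)..t, resolvKernel α z θ r (t - s) • IccExtend hT.le f s) =
      ∫ s in (0 : ℝ)..t, (z * resolvKernel α z θ r (t - s)) • IccExtend hT.le f s := by
    rw [← intervalIntegral.integral_smul]
    simp only [smul_smul]
  rw [_root_.smul_apply, ContinuousMap.smul_apply, happ, smul_comm, e, norm_smul, hn,
    mul_assoc (2 * π)⁻¹]
  gcongr
  exact (norm_conv_le hT (hint.const_mul z) f t.2).trans (by gcongr)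

theorem isOfType_powB (ha : 0 < a) (hθ₀ : π / 2 < θ₀) (hθ₀' : θ₀ < π) (hα : 0 < α)
    (hα' : α < 2) : IsOfType (powB X hT a θ₀ α) (α * π / 2) := by
  have hπ := pi_pos
  refine ⟨by positivity, by nlinarith, fun z _ => ?_, fun ε hε => ?_⟩
  · obtain ⟨r, hr, hzr⟩ := exists_norm_lt_rpow hα z
    exact ⟨_, isResolventAt_powB hT ha hθ₀ hθ₀' hα hα' hθ₀ hθ₀' hr hzr⟩
  · by_cases hε' : α * π / 2 + ε ≤ π
    -- The first entry keeps `αθ ≤ απ/2 + ε/2`, half of the available gap; the second keeps `θ < π`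
    -- when `ε / α` is large.
    · set θ := min (π / 2 + ε / (2 * α)) (3 * π / 4)
      have hθ : π / 2 < θ := lt_min (by linarith [show 0 < ε / (2 * α) by positivity]) (by linarith)
      have hθ' : θ < π := (min_le_right _ _).trans_lt (by linarith)
      have hθε : α * θ ≤ α * π / 2 + ε / 2 := by
        calc α * θ ≤ α * (π / 2 + ε / (2 * α)) := by
              gcongr
              exact min_le_left _ _
          _ = _ := by field_simp
      have hc₀ : 0 < Real.sin (ε / 4) :=
        Real.sin_pos_of_pos_of_lt_pi (by linarith) (by nlinarith [mul_pos hα hπ])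
      have hcos : 0 < -Real.cos θ := by
        have := Real.cos_neg_of_pi_div_two_lt_of_lt hθ (by linarith)
        linarith
      have hΓ1 : 0 < Real.Gamma (-(α / 2) + 1) := Real.Gamma_pos_of_pos (by linarith)
      have hΓ2 : 0 < Real.Gamma (α + 1) := Real.Gamma_pos_of_pos (by linarith)
      refine ⟨_, ?_, fun z hz => norm_smul_resolv_le hT ha hθ₀ hθ₀' hα hα' hc₀ ?_ hθ hθ' fun μ hμ =>
        le_norm_sub_cpow hα hε hz (by linarith) hθε hμ⟩
      · positivity
      · rintro rfl
        rw [Complex.arg_zero, abs_zero] at hz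
        nlinarith [mul_pos hα hπ]
    -- If `απ/2 + ε > π` no point satisfies the condition, as `|arg z| ≤ π`.
    · exact ⟨1, one_pos, fun z hz => absurd (hz.trans (Complex.abs_arg_le_pi z)) hε'⟩

end SectorialBound

end FracDeriv

/-! ### The main theorem. -/

theorem proposition5 {X : Type*} [NormedAddCommGroup X] [NormedSpace ℂ X] [CompleteSpace X]
    {T : ℝ} (hT : 0 < T)
    -- the contour `{μ : |Arg (μ - a)| = θ₀}` fixed in the definition of `B^{-α}`
    {a θ₀ : ℝ} (ha : 0 < a) (hθ₀ : Real.pi / 2 < θ₀) (hθ₀' : θ₀ < Real.pi)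
    {α : ℝ} (hα : 0 < α) (hα' : α < 2) :
    -- `B^{-α}` is injective, so that `B^α` is its inverse
    Function.Injective (FracDeriv.negPowB X hT a θ₀ α) ∧
    -- (I)
    (∀ (lam : ℂ) (θ r : ℝ), Real.pi / 2 < θ → θ < Real.pi → α * θ < Real.pi →
      0 < r → ‖lam‖ < r ^ α →
      lam ∈ FracDeriv.resolvSet (FracDeriv.powB X hT a θ₀ α) ∧
      FracDeriv.KeyholeIntegrable θ r (fun μ : ℂ =>
        (lam - μ ^ (α : ℂ))⁻¹ • FracDeriv.resolv (FracDeriv.opB X hT) μ) ∧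
      FracDeriv.resolv (FracDeriv.powB X hT a θ₀ α) lam =
        -((2 * Real.pi * Complex.I : ℂ)⁻¹ • FracDeriv.keyholeIntegral θ r (fun μ : ℂ =>
          (lam - μ ^ (α : ℂ))⁻¹ • FracDeriv.resolv (FracDeriv.opB X hT) μ)) ∧
      (∀ τ : ℝ, 0 < τ → FracDeriv.KeyholeIntegrable θ r (fun μ : ℂ =>
        Complex.exp (μ * τ) / (lam - μ ^ (α : ℂ)))) ∧
      ∀ (f : C(Set.Icc (0 : ℝ) T, X)) (t : Set.Icc (0 : ℝ) T),
        IntervalIntegrable (fun s : ℝ =>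
          FracDeriv.resolvKernel α lam θ r (t - s) • Set.IccExtend hT.le f s)
          MeasureTheory.volume 0 t ∧
        FracDeriv.resolv (FracDeriv.powB X hT a θ₀ α) lam f t =
          (2 * Real.pi * Complex.I : ℂ)⁻¹ • ∫ s in (0 : ℝ)..t,
            FracDeriv.resolvKernel α lam θ r (t - s) • Set.IccExtend hT.le f s) ∧
    -- (II)
    FracDeriv.IsOfType (FracDeriv.powB X hT a θ₀ α) (α * Real.pi / 2) := by
  refine ⟨FracDeriv.negPowB_injective X hT ha hθ₀ hθ₀' hα hα', ?_,
    FracDeriv.isOfType_powB hT ha hθ₀ hθ₀' hα hα'⟩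
  intro lam θ r hθ hθ' _ hr hlam
  have hR := FracDeriv.isResolventAt_powB (X := X) hT ha hθ₀ hθ₀' hα hα' hθ hθ' hr hlam
  obtain ⟨h1, h2, h3⟩ := FracDeriv.resolvent_apply (X := X) hT hθ hθ' hα hr hlam
  simp only [FracDeriv.resolv_opB, FracDeriv.keyholeIntegrable_iff,
    FracDeriv.keyholeIntegral_eq_keyAt]
  refine ⟨⟨_, hR⟩, h1, hR.resolv_eq, fun τ hτ => FracDeriv.keyIntAt_exp_div hθ hθ' hα hr hlam hτ,
    fun f t => ⟨FracDeriv.intervalIntegrable_conv hT h2 f t.2, ?_⟩⟩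
  rw [hR.resolv_eq, h3]
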